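/- Let $\mathscr H$ be a complex Hilbert space, $\mathscr F_{\rm b}(\mathscr H)=\bigoplus_{n\ge0}\otimes_{\rm s}^n\mathscr H$ the boson Fock space over $\mathscr H$ (with $\otimes^0_{\rm s}\mathscr H=\mathbb C$), and $S_n$ the symmetrization operator on $\otimes^n\mathscr H$. For a self-adjoint operator $T$ on $\mathscr H$ let $d\Gamma_{\rm b}(T)=\bigoplus_{n\ge 0}T^{(n)}_{\rm b}$ be its second quantization, where $T^{(0)}_{\rm b}=0$ and $T^{(n)}_{\rm b}$ ($n\geq 1$) is the closure of $\sum_{j=1}^n I\otimes\cdots\otimes T\otimes\cdots\otimes I$ ($T$ in the $j$-th place) on the algebraic $n$-fold symmetric tensor product of $D(T)$. For $h\in\mathscr H$ let $A(h)^*$ be the creation operator, $(A(h)^*\psi)^{(0)}=0$, $(A(h)^*\psi)^{(n)}=\sqrt n\,S_n(h\otimes\psi^{(n-1)})$ for $n\ge1$, on the domain of all $\psi$ for which these components are square summable; let $A(h)$ be the closed operator with adjoint $A(h)^*$, and let $\Phi_{\rm s}(h)$ be the closure of $\frac1{\sqrt2}(A(h)+A(h)^*)$. For $f,g\in\mathscr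 H$ and $\eta,\lambda\in\mathbb R$ put $$H(\lambda)=d\Gamma_{\rm b}(T)+\tfrac{\lambda}{2}\Phi_{\rm s}(g)^2,\qquad H(\eta,\lambda)=H(\lambda)+\eta\,\Phi_{\rm s}(f),$$ with the natural domains of products and sums of operators. Suppose that $T$ is injective, non-negative and self-adjoint, that $f\in D(T^{-1/2})$ and that $0\neq g\in D(T^{-1/2})\cap D(T)$. Put $$\lambda_T(g)=\|T^{-1/2}g\|^{-1}\bigl(\|T^{-1/2}g\|+\|T^{1/2}g\|\bigr)^{-1},\qquad \lambda_{{\rm c},0}=-\|T^{-1/2}g\|^{-2}.$$ Then the following hold. 1. If $|\lambda|<\lambda_T(g)$, then for all $\eta\in\mathbb R$ the operator $H(\eta,\lambda)$ is self-adjoint with $D(H(\eta,\lambda))=D(d\Gamma_{\rm b}(T))$, essentially self-adjoint on any core of $d\Gamma_{\rm b}(T)$, and bounded from below. 2. If $|\lambda|\ge\lambda_T(g)$ and $f\in D(T^{1/2})$, then for all $\eta\in\mathbb R$ the operator $H(\eta,\lambda)$ is essentially self-adjoint on any core of $d\Gamma_{\rm b}(T)$. If moreover $\lambda\ge\lambda_T(g)$,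 then $H(\eta,\lambda)$ is self-adjoint. 3. Let $f\in D(T^{1/2})$. Then $\overline{H(\lambda_{{\rm c},0})}$ is bounded from below. If $\lambda>\lambda_{{\rm c},0}$, then for all $\eta\in\mathbb R$ the operator $\overline{H(\eta,\lambda)}$ is bounded from below, and $D(d\Gamma_{\rm b}(T)^{1/2})=D((\overline{H(\eta,\lambda)}+M)^{1/2})$ for every constant $M\ge0$ with $\overline{H(\eta,\lambda)}+M\ge0$. -/

import Mathlib

noncomputable section

open scoped TensorProduct ComplexOrder

namespace FockModel

/-! ### Unbounded operators -/

section Operators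

variable {E : Type*} [NormedAddCommGroup E] [InnerProductSpace ℂ E]

/-- The product `B A` of two unbounded operators, with its natural domain
`{x ∈ D(A) | A x ∈ D(B)}`. -/
def opMul (B A : E →ₗ.[ℂ] E) : E →ₗ.[ℂ] E where
  domain :=
    { carrier := {x | ∃ h : x ∈ A.domain, A ⟨x, h⟩ ∈ B.domain}
      add_mem' := by
        rintro x y ⟨hx, hx'⟩ ⟨hy, hy'⟩
        refine ⟨A.domain.add_mem hx hy, ?_⟩
        have h : A ⟨x + y, A.domain.add_mem hx hy⟩ = A ⟨x, hx⟩ + A ⟨y, hy⟩ :=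
          A.map_add ⟨x, hx⟩ ⟨y, hy⟩
        rw [h]
        exact B.domain.add_mem hx' hy'
      zero_mem' := by
        refine ⟨A.domain.zero_mem, ?_⟩
        have h : A ⟨0, A.domain.zero_mem⟩ = 0 := A.map_zero
        rw [h]
        exact B.domain.zero_mem
      smul_mem' := by
        rintro c x ⟨hx, hx'⟩
        refine ⟨A.domain.smul_mem c hx, ?_⟩
        have h : A ⟨c • x, A.domain.smul_mem c hx⟩ = c • A ⟨x, hx⟩ := A.map_smul c ⟨x, hx⟩
        rw [h]
        exact B.domain.smul_mem c hx' }
  toFun :=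
    { toFun := fun x => B ⟨A ⟨x, x.2.fst⟩, x.2.snd⟩
      map_add' := by
        intro x y
        rw [← B.map_add]
        congr 1
        exact Subtype.ext (A.map_add ⟨x, x.2.fst⟩ ⟨y, y.2.fst⟩)
      map_smul' := by
        intro c x
        rw [RingHom.id_apply, ← B.map_smul]
        congr 1
        exact Subtype.ext (A.map_smul c ⟨x, x.2.fst⟩) }

/-- `⟨x, A x⟩ ≥ c ‖x‖²` for all `x ∈ D(A)`. -/
def IsBoundedBelowBy (A : E →ₗ.[ℂ] E) (c : ℝ) : Prop :=
  ∀ x : A.domain, c * ‖(x : E)‖ ^ 2 ≤ (inner ℂ (x : E) (A x)).re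

/-- `A` is non-negative, `A ≥ 0`. -/
def IsNonneg (A : E →ₗ.[ℂ] E) : Prop :=
  ∀ x : A.domain, 0 ≤ (inner ℂ (x : E) (A x)).re

/-- `A` is bounded from below. -/
def IsBoundedBelow (A : E →ₗ.[ℂ] E) : Prop :=
  ∃ c : ℝ, IsBoundedBelowBy A c

/-- The operator `A + M`, with domain `D(A)`. -/
def addConst (A : E →ₗ.[ℂ] E) (M : ℝ) : E →ₗ.[ℂ] E :=
  ((M : ℂ) • (LinearMap.id : E →ₗ[ℂ] E)) +ᵥ A

variable [CompleteSpace E]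

/-- `A` is essentially self-adjoint on the subspace `D ⊆ D(A)`: the closure of the restriction of
`A` to `D` is self-adjoint. -/
def IsEssentiallySelfAdjointOn (A : E →ₗ.[ℂ] E) (D : Submodule ℂ E) : Prop :=
  D ≤ A.domain ∧ IsSelfAdjoint (A.domRestrict D).closure

/-- `S` is a non-negative self-adjoint square root of `A`. -/
def IsSqrt (S A : E →ₗ.[ℂ] E) : Prop :=
  IsSelfAdjoint S ∧ IsNonneg S ∧ opMul S S = A

open scoped Classical in
/-- The square root `A^{1/2}`: for a non-negative self-adjoint operator `A`, this is the (unique)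
non-negative self-adjoint operator whose square, with its natural domain, is `A`.
(For operators that have no such square root the value is irrelevant; it is set to be `A`.) -/
def opSqrt (A : E →ₗ.[ℂ] E) : E →ₗ.[ℂ] E :=
  if h : ∃ S : E →ₗ.[ℂ] E, IsSqrt S A then h.choose else A

/-- `A^{-1/2}`, the inverse of `A^{1/2}`; its domain is the range of `A^{1/2}`. -/
def opInvSqrt (A : E →ₗ.[ℂ] E) : E →ₗ.[ℂ] E := (opSqrt A).inverse

/-- `D(A) ⊆ D(A^{1/2})`. -/
theorem domain_le_domain_opSqrt (A : E →ₗ.[ℂ] E) : A.domain ≤ (opSqrt A).domain := by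
  unfold opSqrt
  split_ifs with h
  · intro x hx
    have h3 := h.choose_spec.2.2
    rw [← h3] at hx
    exact hx.fst
  · exact le_rfl

end Operators

/-! ### Hilbert space tensor powers -/

section TensorPower

variable (H : Type*) [NormedAddCommGroup H] [InnerProductSpace ℂ H] (n : ℕ)

/-- The algebraic `n`-fold tensor power of `H`. (A separate name, so that it carries the norm of
the inner product and not the projective norm.) -/
def AlgTensor : Type _ := ⨂[ℂ] _ : Fin n, H

instance : AddCommGroup (AlgTensor H n) := inferInstanceAs (AddCommGroup (⨂[ℂ] _ : Fin n, H))

instance : Module ℂ (AlgTensor H n) := inferInstanceAs (Module ℂ (⨂[ℂ] _ : Fin n, H))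

variable {H n}

/-- The pure tensor `x 0 ⊗ ⋯ ⊗ x (n - 1)`, as a multilinear map. -/
def algTprod : MultilinearMap ℂ (fun _ : Fin n => H) (AlgTensor H n) :=
  PiTensorProduct.tprod ℂ

/-- The universal property of the algebraic tensor power. -/
def algLift {V : Type*} [AddCommGroup V] [Module ℂ V]
    (φ : MultilinearMap ℂ (fun _ : Fin n => H) V) : AlgTensor H n →ₗ[ℂ] V :=
  PiTensorProduct.lift φ

@[simp]
theorem algLift_algTprod {V : Type*} [AddCommGroup V] [Module ℂ V]
    (φ : MultilinearMap ℂ (fun _ : Fin n => H) V) (x : Fin n → H) :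
    algLift φ (algTprod x) = φ x :=
  PiTensorProduct.lift.tprod x

theorem algTensor_induction {p : AlgTensor H n → Prop} (t : AlgTensor H n)
    (smul_tprod : ∀ (c : ℂ) (x : Fin n → H), p (c • algTprod x))
    (add : ∀ s t, p s → p t → p (s + t)) : p t :=
  PiTensorProduct.induction_on (motive := p) t smul_tprod add

/-- The linear functional `y ↦ ∏ᵢ ⟨xᵢ, yᵢ⟩` on the algebraic tensor power. -/
def pairing (x : Fin n → H) : AlgTensor H n →ₗ[ℂ] ℂ :=
  algLift ((MultilinearMap.mkPiAlgebra ℂ (Fin n) ℂ).compLinearMap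
    fun i => (innerₛₗ ℂ (x i) : H →ₗ[ℂ] ℂ))

@[simp]
theorem pairing_algTprod (x y : Fin n → H) :
    pairing x (algTprod y) = ∏ i, inner ℂ (x i) (y i) := by
  simp [pairing]

theorem conj_pairing_algTprod (x y : Fin n → H) :
    starRingEnd ℂ (pairing x (algTprod y)) = pairing y (algTprod x) := by
  simp [map_prod]

/-- The inner product of the algebraic tensor power as a map that is linear in its first argument
and antilinear in its second one: it sends `t`, `s` to `⟨s, t⟩`. -/
def innerForm : AlgTensor H n →ₗ[ℂ] AlgTensor H n →ₛₗ[starRingEnd ℂ] ℂ :=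
  algLift
    { toFun := fun x =>
        { toFun := fun s => starRingEnd ℂ (pairing x s)
          map_add' := by intro s t; simp
          map_smul' := by intro c s; simp }
      map_update_add' := by
        intro _ x i a b
        ext s
        simp only [LinearMap.coe_mk, AddHom.coe_mk, LinearMap.add_apply]
        induction s using algTensor_induction with
        | smul_tprod c y =>
          simp only [map_smul, smul_eq_mul, map_mul, conj_pairing_algTprod,
            MultilinearMap.map_update_add, map_add, mul_add]
        | add s t hs ht => simp only [map_add, hs, ht]; ring
      map_update_smul' := by
        intro _ x i a b
        ext s
        simp only [LinearMap.coe_mk, AddHom.coe_mk, LinearMap.smul_apply]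
        induction s using algTensor_induction with
        | smul_tprod c y =>
          simp only [map_smul, smul_eq_mul, map_mul, conj_pairing_algTprod,
            MultilinearMap.map_update_smul]
          ring
        | add s t hs ht => simp only [map_add, hs, ht, smul_add] }

theorem innerForm_algTprod (x y : Fin n → H) :
    innerForm (algTprod y) (algTprod x) = ∏ i, inner ℂ (x i) (y i) := by
  have h : innerForm (algTprod y) (algTprod x) = starRingEnd ℂ (pairing y (algTprod x)) := by
    simp [innerForm]
  rw [h, conj_pairing_algTprod, pairing_algTprod]

theorem conj_innerForm (s t : AlgTensor H n) :
    starRingEnd ℂ (innerForm s t) = innerForm t s := by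
  induction s using algTensor_induction with
  | smul_tprod c x =>
    induction t using algTensor_induction with
    | smul_tprod d y => simp [innerForm_algTprod, map_prod]; ring
    | add s t hs ht => simp only [map_add, LinearMap.add_apply, hs, ht]
  | add s t hs ht => simp only [map_add, LinearMap.add_apply, hs, ht]

/-- The kernel `∏ᵢ ⟨xᵢ, yᵢ⟩` is positive semidefinite. -/
theorem posSemidef_prod_inner {ι : Type*} [Finite ι] (v : ι → Fin n → H) (s : Finset (Fin n)) :
    (Matrix.of fun k l : ι => ∏ i ∈ s, inner ℂ (v k i) (v l i)).PosSemidef := by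
  classical
  induction s using Finset.induction_on with
  | empty =>
    have h := Matrix.posSemidef_gram ℂ (fun _ : ι => (1 : ℂ))
    have e : (Matrix.of fun k l : ι => ∏ i ∈ (∅ : Finset (Fin n)), inner ℂ (v k i) (v l i)) =
        Matrix.gram ℂ (fun _ : ι => (1 : ℂ)) := by
      ext k l
      simp [Matrix.gram]
    rw [e]
    exact h
  | insert a s ha ih =>
    have h := (Matrix.posSemidef_gram ℂ (fun k : ι => v k a)).hadamard ih
    have e : (Matrix.of fun k l : ι => ∏ i ∈ insert a s, inner ℂ (v k i) (v l i)) =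
        Matrix.hadamard (Matrix.gram ℂ (fun k : ι => v k a))
          (Matrix.of fun k l : ι => ∏ i ∈ s, inner ℂ (v k i) (v l i)) := by
      ext k l
      simp [Matrix.gram, Finset.prod_insert ha, Matrix.hadamard]
    rw [e]
    exact h

theorem innerForm_self_nonneg (t : AlgTensor H n) : 0 ≤ innerForm t t := by
  have ht : t ∈ Submodule.span ℂ (Set.range (algTprod : MultilinearMap ℂ (fun _ : Fin n => H) _)) :=
    (PiTensorProduct.span_tprod_eq_top (R := ℂ) (s := fun _ : Fin n => H)).ge Submodule.mem_top
  obtain ⟨c, rfl⟩ := Finsupp.mem_span_range_iff_exists_finsupp.1 ht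
  have h := (posSemidef_prod_inner (fun k : c.support => (k : Fin n → H))
    Finset.univ).dotProduct_mulVec_nonneg fun k => c k
  refine h.trans_eq ?_
  simp only [Finsupp.sum, map_sum, LinearMap.sum_apply, map_smul, LinearMap.smul_apply,
    LinearMap.map_smulₛₗ, innerForm_algTprod, smul_eq_mul, dotProduct, Matrix.mulVec,
    Matrix.of_apply, Pi.star_apply, RCLike.star_def, Finset.mul_sum]
  rw [← Finset.sum_coe_sort c.support]
  refine Finset.sum_congr rfl fun x _ => ?_
  rw [← Finset.sum_coe_sort c.support]
  refine Finset.sum_congr rfl fun y _ => ?_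
  ring

/-- The inner product on the algebraic tensor power, determined by
`⟨⊗ᵢ xᵢ, ⊗ᵢ yᵢ⟩ = ∏ᵢ ⟨xᵢ, yᵢ⟩`. -/
@[reducible]
def algTensorCore (H : Type*) [NormedAddCommGroup H] [InnerProductSpace ℂ H] (n : ℕ) :
    PreInnerProductSpace.Core ℂ (AlgTensor H n) where
  inner s t := innerForm t s
  conj_inner_symm s t := conj_innerForm s t
  re_inner_nonneg s := (Complex.nonneg_iff.1 (innerForm_self_nonneg s)).1
  add_left s t u := by simp
  smul_left s t c := by simp

instance : SeminormedAddCommGroup (AlgTensor H n) :=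
  @InnerProductSpace.Core.toSeminormedAddCommGroup ℂ _ _ _ _ (algTensorCore H n)

instance : InnerProductSpace ℂ (AlgTensor H n) :=
  InnerProductSpace.ofCore (algTensorCore H n)

theorem inner_algTprod (x y : Fin n → H) :
    inner ℂ (algTprod x) (algTprod y) = ∏ i, inner ℂ (x i) (y i) :=
  innerForm_algTprod x y

variable (H n) in
/-- The Hilbert space tensor power `⊗ⁿ H`: the completion of the algebraic one. -/
abbrev HTensor : Type _ := UniformSpace.Completion (AlgTensor H n)

/-- The pure tensor `x 0 ⊗ ⋯ ⊗ x (n - 1)` in `⊗ⁿ H`. -/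
def pureTensor (x : Fin n → H) : HTensor H n := ((algTprod x : AlgTensor H n) : HTensor H n)

/-- The permutation of tensor factors: `x ↦ ⊗ᵢ x (σ i)` on pure tensors. -/
def algPerm (σ : Equiv.Perm (Fin n)) : AlgTensor H n →ₗ[ℂ] AlgTensor H n :=
  algLift (algTprod.domDomCongr σ)

@[simp]
theorem algPerm_algTprod (σ : Equiv.Perm (Fin n)) (x : Fin n → H) :
    algPerm σ (algTprod x) = algTprod fun i => x (σ i) := by
  simp [algPerm, MultilinearMap.domDomCongr_apply]

theorem inner_algPerm (σ : Equiv.Perm (Fin n)) (s t : AlgTensor H n) :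
    inner ℂ (algPerm σ s) (algPerm σ t) = inner ℂ s t := by
  induction s using algTensor_induction with
  | smul_tprod c x =>
    induction t using algTensor_induction with
    | smul_tprod d y =>
      simp only [map_smul, inner_smul_left, inner_smul_right, algPerm_algTprod, inner_algTprod]
      rw [Equiv.prod_comp σ fun i => inner ℂ (x i) (y i)]
    | add s t hs ht => simp only [map_add, inner_add_right, hs, ht]
  | add s t hs ht => simp only [map_add, inner_add_left, hs, ht]

theorem norm_algPerm (σ : Equiv.Perm (Fin n)) (t : AlgTensor H n) : ‖algPerm σ t‖ = ‖t‖ := by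
  rw [norm_eq_sqrt_re_inner (𝕜 := ℂ), norm_eq_sqrt_re_inner (𝕜 := ℂ) t, inner_algPerm]

/-- The permutation of tensor factors on `⊗ⁿ H`. -/
def permOp (σ : Equiv.Perm (Fin n)) : HTensor H n →L[ℂ] HTensor H n :=
  ((algPerm σ).mkContinuous 1 fun t => by rw [norm_algPerm, one_mul]).completion

@[simp]
theorem permOp_pureTensor (σ : Equiv.Perm (Fin n)) (x : Fin n → H) :
    permOp σ (pureTensor x) = pureTensor fun i => x (σ i) := by
  simp [permOp, pureTensor]

theorem permOp_permOp (σ τ : Equiv.Perm (Fin n)) (ψ : HTensor H n) :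
    permOp σ (permOp τ ψ) = permOp (τ * σ) ψ := by
  induction ψ using UniformSpace.Completion.induction_on with
  | hp => exact isClosed_eq (by fun_prop) (by fun_prop)
  | ih t =>
    induction t using algTensor_induction with
    | smul_tprod c x =>
      have h := fun ρ : Equiv.Perm (Fin n) => permOp_pureTensor (H := H) ρ
      simp only [pureTensor] at h
      simp only [UniformSpace.Completion.coe_smul, map_smul, h, Equiv.Perm.mul_apply]
    | add s t hs ht => simp only [UniformSpace.Completion.coe_add, map_add, hs, ht]

variable (H n) in
/-- The symmetrization operator `S_n` on `⊗ⁿ H`. -/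
def symmetrizer : HTensor H n →L[ℂ] HTensor H n :=
  ((n.factorial : ℂ)⁻¹) • ∑ σ : Equiv.Perm (Fin n), permOp σ

variable (H n) in
/-- The `n`-fold symmetric tensor product Hilbert space `⊗ₛⁿ H`: the closed subspace of the
vectors of `⊗ⁿ H` that are invariant under all permutations, that is, the range of `S_n`. -/
def symTensor : Submodule ℂ (HTensor H n) :=
  ⨅ σ : Equiv.Perm (Fin n), (permOp σ).eqLocus (ContinuousLinearMap.id ℂ (HTensor H n))

theorem mem_symTensor {ψ : HTensor H n} :
    ψ ∈ symTensor H n ↔ ∀ σ : Equiv.Perm (Fin n), permOp σ ψ = ψ := by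
  simp [symTensor, Submodule.mem_iInf]

theorem symmetrizer_mem (ψ : HTensor H n) : symmetrizer H n ψ ∈ symTensor H n := by
  rw [mem_symTensor]
  intro σ
  simp only [symmetrizer, smul_apply, sum_apply, map_smul,
    map_sum, permOp_permOp]
  congr 1
  exact Equiv.sum_comp (Equiv.mulRight σ) fun τ => permOp τ ψ

theorem symmetrizer_of_mem {ψ : HTensor H n} (h : ψ ∈ symTensor H n) :
    symmetrizer H n ψ = ψ := by
  rw [mem_symTensor] at h
  have h0 : (n.factorial : ℂ) ≠ 0 := by exact_mod_cast n.factorial_ne_zero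
  simp [symmetrizer, h, Fintype.card_perm, ← Nat.cast_smul_eq_nsmul ℂ, smul_smul, h0]

instance : CompleteSpace (symTensor H n) := by
  refine IsClosed.completeSpace_coe (hs := ?_)
  have h : (symTensor H n : Set (HTensor H n)) =
      ⋂ σ : Equiv.Perm (Fin n), {ψ | permOp σ ψ = ψ} := by
    ext ψ
    simp [mem_symTensor]
  rw [h]
  exact isClosed_iInter fun σ => isClosed_eq (by fun_prop) (by fun_prop)

variable (H n) in
/-- The symmetrization operator as a map `⊗ⁿ H → ⊗ₛⁿ H`. -/
def toSym : HTensor H n →L[ℂ] symTensor H n :=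
  (symmetrizer H n).codRestrict (symTensor H n) symmetrizer_mem

/-- `t ↦ f ⊗ t` on algebraic tensors. -/
def algConsTensor (f : H) : AlgTensor H n →ₗ[ℂ] AlgTensor H (n + 1) :=
  algLift ((algTprod (H := H) (n := n + 1)).curryLeft f)

@[simp]
theorem algConsTensor_algTprod (f : H) (x : Fin n → H) :
    algConsTensor f (algTprod x) = algTprod (Fin.cons f x : Fin (n + 1) → H) := by
  simp [algConsTensor]

theorem inner_algConsTensor (f : H) (s t : AlgTensor H n) :
    inner ℂ (algConsTensor f s) (algConsTensor f t) = inner ℂ f f * inner ℂ s t := by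
  induction s using algTensor_induction with
  | smul_tprod c x =>
    induction t using algTensor_induction with
    | smul_tprod d y =>
      simp only [map_smul, inner_smul_left, inner_smul_right, algConsTensor_algTprod,
        inner_algTprod, Fin.prod_univ_succ, Fin.cons_zero, Fin.cons_succ]
      ring
    | add s t hs ht => simp only [map_add, inner_add_right, hs, ht, mul_add]
  | add s t hs ht => simp only [map_add, inner_add_left, hs, ht, mul_add]

theorem norm_algConsTensor (f : H) (t : AlgTensor H n) : ‖algConsTensor f t‖ = ‖f‖ * ‖t‖ := by
  have h : ‖algConsTensor f t‖ ^ 2 = (‖f‖ * ‖t‖) ^ 2 := by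
    have h1 := inner_algConsTensor f t t
    simp only [inner_self_eq_norm_sq_to_K] at h1
    rw [mul_pow]
    exact_mod_cast h1
  exact (sq_eq_sq₀ (norm_nonneg _) (by positivity)).1 h

/-- `ψ ↦ f ⊗ ψ`, from `⊗ⁿ H` to `⊗ⁿ⁺¹ H`. -/
def consTensor (f : H) : HTensor H n →L[ℂ] HTensor H (n + 1) :=
  ((algConsTensor f).mkContinuous ‖f‖ fun t => (norm_algConsTensor f t).le).completion

end TensorPower

/-! ### The boson Fock space and its operators -/

section Fock

variable (H : Type*) [NormedAddCommGroup H] [InnerProductSpace ℂ H]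

/-- The boson Fock space `⊕ₙ ⊗ₛⁿ H` (a Hilbert space direct sum over `n = 0, 1, 2, …`). -/
abbrev BosonFock : Type _ := lp (fun n : ℕ => symTensor H n) 2

variable {H}

/-- The operator `T_b⁽ⁿ⁾` on `⊗ₛⁿ H`: the closure of `∑ⱼ I ⊗ ⋯ ⊗ T ⊗ ⋯ ⊗ I` on the algebraic
symmetric tensor power of `D(T)`, which is the span of the vectors `S_n(x₁ ⊗ ⋯ ⊗ xₙ)` with
`xᵢ ∈ D(T)`. It is given through its graph; the operator maps `S_n(x₁ ⊗ ⋯ ⊗ xₙ)` to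
`∑ⱼ S_n(x₁ ⊗ ⋯ ⊗ T xⱼ ⊗ ⋯ ⊗ xₙ)`. For `n = 0` it is the zero operator. -/
def dGammaN (T : H →ₗ.[ℂ] H) (n : ℕ) : symTensor H n →ₗ.[ℂ] symTensor H n :=
  (Submodule.span ℂ (Set.range fun x : Fin n → T.domain =>
    (toSym H n (pureTensor fun i => (x i : H)),
      ∑ j, toSym H n (pureTensor (Function.update (fun i => (x i : H)) j (T (x j))))))
    ).topologicalClosure.toLinearPMap

/-- The graph of the direct sum of the operators `A n`. -/
def directSumGraph (A : ∀ n : ℕ, symTensor H n →ₗ.[ℂ] symTensor H n) :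
    Submodule ℂ (BosonFock H × BosonFock H) where
  carrier := {p | ∀ n, (p.1 n, p.2 n) ∈ (A n).graph}
  add_mem' hp hq n := (A n).graph.add_mem (hp n) (hq n)
  zero_mem' n := (A n).graph.zero_mem
  smul_mem' c _ hp n := (A n).graph.smul_mem c (hp n)

/-- The direct sum `⊕ₙ Aₙ`: its domain consists of the `ψ` with `ψ⁽ⁿ⁾ ∈ D(Aₙ)` for all `n` and
`∑ₙ ‖Aₙ ψ⁽ⁿ⁾‖² < ∞`, and it acts componentwise. -/
def directSum (A : ∀ n : ℕ, symTensor H n →ₗ.[ℂ] symTensor H n) :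
    BosonFock H →ₗ.[ℂ] BosonFock H :=
  (directSumGraph A).toLinearPMap

theorem directSum_graph (A : ∀ n : ℕ, symTensor H n →ₗ.[ℂ] symTensor H n) :
    (directSum A).graph = directSumGraph A := by
  refine Submodule.toLinearPMap_graph_eq _ fun p hp hp0 => ?_
  ext1
  funext n
  refine (A n).graph_fst_eq_zero_snd (hp n) ?_
  rw [hp0]
  rfl

/-- The second quantization operator `dΓ_b(T)`. -/
def dGamma (T : H →ₗ.[ℂ] H) : BosonFock H →ₗ.[ℂ] BosonFock H :=
  directSum (dGammaN T)

/-- The graph of the creation operator. -/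
def creationGraph (f : H) : Submodule ℂ (BosonFock H × BosonFock H) where
  carrier := {p | p.2 0 = 0 ∧ ∀ n : ℕ, p.2 (n + 1) =
    ((√((n : ℝ) + 1) : ℝ) : ℂ) • toSym H (n + 1) (consTensor f (p.1 n : HTensor H n))}
  add_mem' := by
    rintro p q ⟨hp0, hp⟩ ⟨hq0, hq⟩
    refine ⟨?_, fun n => ?_⟩
    · simp [hp0, hq0]
    · simp [hp n, hq n]
  zero_mem' := by
    refine ⟨rfl, fun n => ?_⟩
    simp
  smul_mem' := by
    rintro c p ⟨hp0, hp⟩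
    refine ⟨?_, fun n => ?_⟩
    · simp [hp0]
    · simp [hp n, smul_comm c]

/-- The creation operator `A(f)^*`: `(A(f)^* ψ)⁽⁰⁾ = 0` and
`(A(f)^* ψ)⁽ⁿ⁺¹⁾ = √(n+1) S_{n+1}(f ⊗ ψ⁽ⁿ⁾)`, on the domain of all `ψ` for which these components
are square summable. -/
def creation (f : H) : BosonFock H →ₗ.[ℂ] BosonFock H := (creationGraph f).toLinearPMap

theorem creation_graph (f : H) : (creation f).graph = creationGraph f := by
  refine Submodule.toLinearPMap_graph_eq _ fun p hp hp0 => ?_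
  ext1
  funext n
  cases n with
  | zero => exact hp.1
  | succ n =>
    rw [hp.2 n, hp0]
    simp

/-- The annihilation operator `A(f)`: the densely defined closed operator whose adjoint is the
creation operator, that is, the adjoint of the (densely defined, closed) creation operator. -/
def annihilation (f : H) : BosonFock H →ₗ.[ℂ] BosonFock H := (creation f).adjoint

/-- The Segal field operator `Φ_s(f)`, the closure of `(A(f) + A(f)^*) / √2`. -/
def segal (f : H) : BosonFock H →ₗ.[ℂ] BosonFock H :=
  (((1 / √2 : ℝ) : ℂ) • (annihilation f + creation f)).closure

/-- `H(λ) = dΓ_b(T) + (λ/2) Φ_s(g)²`, with the natural domain of a sum of operators. -/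
def ham (T : H →ₗ.[ℂ] H) (g : H) (lam : ℝ) : BosonFock H →ₗ.[ℂ] BosonFock H :=
  dGamma T + ((lam / 2 : ℝ) : ℂ) • opMul (segal g) (segal g)

/-- `H(η, λ) = H(λ) + η Φ_s(f)`, with the natural domain of a sum of operators. -/
def hamEta (T : H →ₗ.[ℂ] H) (f g : H) (eta lam : ℝ) : BosonFock H →ₗ.[ℂ] BosonFock H :=
  ham T g lam + ((eta : ℝ) : ℂ) • segal f

variable [CompleteSpace H]

/-- `λ_T(g) = ‖T^{-1/2} g‖⁻¹ (‖T^{-1/2} g‖ + ‖T^{1/2} g‖)⁻¹`. -/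
def lambdaT (T : H →ₗ.[ℂ] H) (g : H) (hg : g ∈ (opInvSqrt T).domain) (hg' : g ∈ T.domain) : ℝ :=
  ‖opInvSqrt T ⟨g, hg⟩‖⁻¹ *
    (‖opInvSqrt T ⟨g, hg⟩‖ + ‖opSqrt T ⟨g, domain_le_domain_opSqrt T hg'⟩‖)⁻¹

/-- `λ_{c,0} = -‖T^{-1/2} g‖⁻²`. -/
def lambdaC0 (T : H →ₗ.[ℂ] H) (g : H) (hg : g ∈ (opInvSqrt T).domain) : ℝ :=
  -(‖opInvSqrt T ⟨g, hg⟩‖ ^ 2)⁻¹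

end Fock

end FockModel

end

noncomputable section

open scoped TensorProduct ComplexOrder

namespace FockModel

/-! ### Self-adjointness criteria in terms of graphs -/

section SelfAdjoint

open Filter Topology

variable {E : Type*} [NormedAddCommGroup E] [InnerProductSpace ℂ E]

/-- A linear relation is symmetric if `⟨y, x'⟩ = ⟨x, y'⟩` for all its elements `(x, y)`,
`(x', y')`. -/
def SymmGraph (G : Submodule ℂ (E × E)) : Prop :=
  ∀ p ∈ G, ∀ q ∈ G, inner ℂ p.2 q.1 = inner ℂ p.1 q.2

theorem SymmGraph.topologicalClosure {G : Submodule ℂ (E × E)} (h : SymmGraph G) :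
    SymmGraph G.topologicalClosure := by
  have h1 : ∀ p ∈ G.topologicalClosure, ∀ q ∈ G, inner ℂ p.2 q.1 = inner ℂ p.1 q.2 := by
    intro p hp q hq
    refine closure_minimal (s := (G : Set (E × E)))
      (t := {p | inner ℂ p.2 q.1 = inner ℂ p.1 q.2}) (fun p hp => h p hp q hq)
      (isClosed_eq (by fun_prop) (by fun_prop)) hp
  intro p hp q hq
  exact closure_minimal (s := (G : Set (E × E)))
      (t := {q | inner ℂ p.2 q.1 = inner ℂ p.1 q.2}) (fun q hq => h1 p hp q hq)
      (isClosed_eq (by fun_prop) (by fun_prop)) hq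

theorem SymmGraph.im_inner {G : Submodule ℂ (E × E)} (h : SymmGraph G) {p : E × E} (hp : p ∈ G) :
    (inner ℂ p.1 p.2).im = 0 := by
  have h1 := h p hp p hp
  rw [← inner_conj_symm] at h1
  exact Complex.conj_eq_iff_im.1 h1

theorem SymmGraph.inner_eq_re {G : Submodule ℂ (E × E)} (h : SymmGraph G) {p : E × E}
    (hp : p ∈ G) : inner ℂ p.1 p.2 = ((inner ℂ p.1 p.2).re : ℂ) := by
  apply Complex.ext
  · simp
  · simp [h.im_inner hp]

theorem SymmGraph.norm_sub_sq {G : Submodule ℂ (E × E)} (h : SymmGraph G) {p : E × E}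
    (hp : p ∈ G) (κ : ℝ) :
    ‖p.2 - (Complex.I * κ) • p.1‖ ^ 2 = ‖p.2‖ ^ 2 + κ ^ 2 * ‖p.1‖ ^ 2 := by
  have h0 : inner ℂ p.2 p.1 = ((inner ℂ p.1 p.2).re : ℂ) := by
    rw [h p hp p hp, ← h.inner_eq_re hp]
  rw [@_root_.norm_sub_sq ℂ, inner_smul_right, h0, norm_smul]
  simp [mul_pow]

theorem SymmGraph.le_norm_sub {G : Submodule ℂ (E × E)} (h : SymmGraph G) {p : E × E}
    (hp : p ∈ G) (κ : ℝ) : |κ| * ‖p.1‖ ≤ ‖p.2 - (Complex.I * κ) • p.1‖ := by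
  refine abs_le_of_sq_le_sq' ?_ (norm_nonneg _) |>.2
  rw [h.norm_sub_sq hp, mul_pow, sq_abs]
  nlinarith [sq_nonneg ‖p.2‖]

/-- Bounds from below for real spectral parameters. -/
theorem le_norm_add_of_nonneg {x y : E} (h : 0 ≤ (inner ℂ x y).re) {k : ℝ} (hk : 0 ≤ k) :
    k * ‖x‖ ≤ ‖y - ((-k : ℝ) : ℂ) • x‖ := by
  have h1 : ‖y - ((-k : ℝ) : ℂ) • x‖ ^ 2 =
      ‖y‖ ^ 2 + 2 * k * (inner ℂ x y).re + k ^ 2 * ‖x‖ ^ 2 := by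
    rw [@norm_sub_sq ℂ, inner_smul_right, norm_smul]
    have : (inner ℂ y x).re = (inner ℂ x y).re := inner_re_symm (𝕜 := ℂ) y x
    simp [mul_pow, this]
    ring
  refine abs_le_of_sq_le_sq' ?_ (norm_nonneg _) |>.2
  rw [h1, mul_pow]
  nlinarith [sq_nonneg ‖y‖, mul_nonneg hk h]

variable [CompleteSpace E]

theorem isSelfAdjoint_of_graph {A : E →ₗ.[ℂ] E} (hd : Dense (A.domain : Set E))
    (hs : SymmGraph A.graph)
    (hm : ∀ y z : E, (∀ p ∈ A.graph, inner ℂ p.2 y = inner ℂ p.1 z) → (y, z) ∈ A.graph) :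
    IsSelfAdjoint A := by
  rw [LinearPMap.isSelfAdjoint_def]
  refine LinearPMap.eq_of_eq_graph ?_
  rw [LinearPMap.adjoint_graph_eq_graph_adjoint hd]
  ext ⟨y, z⟩
  rw [Submodule.mem_adjoint_iff]
  constructor
  · intro h
    exact hm y z fun p hp => sub_eq_zero.1 (h p.1 p.2 hp)
  · intro h a b hab
    exact sub_eq_zero.2 (hs (a, b) hab (y, z) h)

theorem _root_.IsSelfAdjoint.mem_graph_iff {A : E →ₗ.[ℂ] E} (hA : IsSelfAdjoint A) {y z : E} :
    (y, z) ∈ A.graph ↔ ∀ p ∈ A.graph, inner ℂ p.2 y = inner ℂ p.1 z := by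
  have h := LinearPMap.adjoint_graph_eq_graph_adjoint hA.dense_domain
  rw [LinearPMap.isSelfAdjoint_def.1 hA] at h
  constructor
  · intro hyz p hp
    rw [h, Submodule.mem_adjoint_iff] at hyz
    exact sub_eq_zero.1 (hyz p.1 p.2 hp)
  · intro hyz
    rw [h, Submodule.mem_adjoint_iff]
    exact fun a b hab => sub_eq_zero.2 (hyz _ hab)

theorem _root_.IsSelfAdjoint.symmGraph {A : E →ₗ.[ℂ] E} (hA : IsSelfAdjoint A) :
    SymmGraph A.graph := fun p hp _ hq => hA.mem_graph_iff.1 hq p hp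

theorem SymmGraph.isClosable {A : E →ₗ.[ℂ] E} (hd : Dense (A.domain : Set E))
    (hs : SymmGraph A.graph) : A.IsClosable := by
  refine (LinearPMap.adjoint_isClosed hd).isClosable.leIsClosable ?_
  refine LinearPMap.IsFormalAdjoint.le_adjoint hd fun x y => ?_
  exact hs _ (A.mem_graph x) _ (A.mem_graph y)

theorem SymmGraph.closure_graph {A : E →ₗ.[ℂ] E} (hd : Dense (A.domain : Set E))
    (hs : SymmGraph A.graph) : A.closure.graph = A.graph.topologicalClosure :=
  (hs.isClosable hd).graph_closure_eq_closure_graph.symm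

/-- If `A - μ` is bounded from below and has dense range, where `A` is closed, then `A - μ` is
onto. -/
theorem exists_sub_eq {G : Submodule ℂ (E × E)} (hG : IsClosed (G : Set (E × E))) {μ : ℂ} {c : ℝ}
    (hc : 0 < c) (hb : ∀ p ∈ G, c * ‖p.1‖ ≤ ‖p.2 - μ • p.1‖)
    (hd : ∀ y : E, (∀ p ∈ G, inner ℂ (p.2 - μ • p.1) y = 0) → y = 0) (z : E) :
    ∃ p ∈ G, p.2 - μ • p.1 = z := by
  have : CompleteSpace G := hG.completeSpace_coe
  let L : G →L[ℂ] E :=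
    (ContinuousLinearMap.snd ℂ E E - μ • ContinuousLinearMap.fst ℂ E E).comp G.subtypeL
  have hL : ∀ p : G, L p = (p : E × E).2 - μ • (p : E × E).1 := fun p => rfl
  have hlip : AntilipschitzWith (Real.toNNReal (1 + c⁻¹ + ‖μ‖ * c⁻¹)) L := by
    refine L.antilipschitz_of_bound fun p => ?_
    have h1 := hb p p.2
    rw [← hL] at h1
    have hc' : 0 < c⁻¹ := inv_pos.2 hc
    have h2 : ‖(p : E × E).1‖ ≤ c⁻¹ * ‖L p‖ := by
      rw [inv_mul_eq_div, le_div_iff₀ hc]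
      linarith
    have h3 : ‖(p : E × E).2‖ ≤ ‖L p‖ + ‖μ‖ * (c⁻¹ * ‖L p‖) := by
      have : (p : E × E).2 = L p + μ • (p : E × E).1 := by rw [hL]; abel
      rw [this]
      refine (norm_add_le _ _).trans ?_
      rw [norm_smul]
      gcongr
    rw [Real.coe_toNNReal _ (by positivity)]
    change max ‖(p : E × E).1‖ ‖(p : E × E).2‖ ≤ _
    have h5 := norm_nonneg (L p)
    have h6 : 0 ≤ ‖μ‖ * (c⁻¹ * ‖L p‖) := by positivity
    have h7 : 0 ≤ c⁻¹ * ‖L p‖ := by positivity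
    refine max_le ?_ ?_ <;> nlinarith
  have hcl : IsClosed (L.range : Set E) := by
    rw [LinearMap.coe_range]
    exact hlip.isClosed_range L.uniformContinuous
  have htop : L.range = ⊤ := by
    have : CompleteSpace L.range := hcl.completeSpace_coe
    rw [← Submodule.orthogonal_eq_bot_iff, Submodule.eq_bot_iff]
    intro y hy
    refine hd y fun p hp => ?_
    exact (Submodule.mem_orthogonal _ _).1 hy _ ⟨⟨p, hp⟩, rfl⟩
  obtain ⟨p, hp⟩ : z ∈ L.range := htop ▸ Submodule.mem_top
  exact ⟨p, p.2, hp⟩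

theorem isSelfAdjoint_of_surjective {A : E →ₗ.[ℂ] E} (hd : Dense (A.domain : Set E))
    (hs : SymmGraph A.graph) (μ : ℂ)
    (h1 : ∀ z : E, ∃ p ∈ A.graph, p.2 - μ • p.1 = z)
    (h2 : ∀ z : E, ∃ p ∈ A.graph, p.2 - (starRingEnd ℂ μ) • p.1 = z) : IsSelfAdjoint A := by
  refine isSelfAdjoint_of_graph hd hs fun y z hyz => ?_
  obtain ⟨q, hq, hqe⟩ := h1 (z - μ • y)
  have key : ∀ p ∈ A.graph, inner ℂ (p.2 - (starRingEnd ℂ μ) • p.1) (y - q.1) = 0 := by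
    intro p hp
    have e : z - q.2 = μ • y - μ • q.1 := by
      rw [sub_eq_sub_iff_add_eq_add] at hqe ⊢
      rw [add_comm (μ • y), hqe]
    have : inner ℂ (p.2 - (starRingEnd ℂ μ) • p.1) (y - q.1) =
        inner ℂ p.1 (z - q.2) - inner ℂ p.1 (μ • y - μ • q.1) := by
      simp only [inner_sub_left, inner_sub_right, inner_smul_left, inner_smul_right, hyz p hp,
        hs p hp q hq, Complex.conj_conj]
      ring
    rw [this, e, sub_self]
  obtain ⟨p, hp, hpe⟩ := h2 (y - q.1)
  have h0 := key p hp
  rw [hpe, inner_self_eq_zero, sub_eq_zero] at h0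
  subst h0
  have : z = q.2 := by
    rw [sub_left_inj] at hqe
    exact hqe.symm
  rw [this]
  exact hq

theorem _root_.IsSelfAdjoint.exists_sub_eq {A : E →ₗ.[ℂ] E} (hA : IsSelfAdjoint A) {μ : ℂ} {c : ℝ}
    (hc : 0 < c) (hb : ∀ p ∈ A.graph, c * ‖p.1‖ ≤ ‖p.2 - μ • p.1‖)
    (hb' : ∀ p ∈ A.graph, c * ‖p.1‖ ≤ ‖p.2 - (starRingEnd ℂ μ) • p.1‖) (z : E) :
    ∃ p ∈ A.graph, p.2 - μ • p.1 = z := by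
  refine FockModel.exists_sub_eq hA.isClosed hc hb (fun y hy => ?_) z
  have h1 : (y, starRingEnd ℂ μ • y) ∈ A.graph := by
    rw [hA.mem_graph_iff]
    intro p hp
    have := hy p hp
    rw [inner_sub_left, inner_smul_left, sub_eq_zero] at this
    rw [this, inner_smul_right]
  have h2 := hb' _ h1
  simp only [sub_self, norm_zero] at h2
  have : ‖y‖ ≤ 0 := by
    by_contra h
    push Not at h
    nlinarith
  simpa using this

/-- The basic criterion for essential self-adjointness. -/
theorem isSelfAdjoint_closure {A : E →ₗ.[ℂ] E} (hd : Dense (A.domain : Set E))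
    (hs : SymmGraph A.graph) {μ : ℂ} {c : ℝ} (hc : 0 < c)
    (hb : ∀ p ∈ A.graph, c * ‖p.1‖ ≤ ‖p.2 - μ • p.1‖)
    (hb' : ∀ p ∈ A.graph, c * ‖p.1‖ ≤ ‖p.2 - (starRingEnd ℂ μ) • p.1‖)
    (h1 : ∀ y : E, (∀ p ∈ A.graph, inner ℂ (p.2 - μ • p.1) y = 0) → y = 0)
    (h2 : ∀ y : E, (∀ p ∈ A.graph, inner ℂ (p.2 - (starRingEnd ℂ μ) • p.1) y = 0) → y = 0) :
    IsSelfAdjoint A.closure := by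
  have hg := hs.closure_graph hd
  have hle : A.graph ≤ A.closure.graph := by rw [hg]; exact Submodule.le_topologicalClosure _
  have hcl : IsClosed (A.closure.graph : Set (E × E)) := (hs.isClosable hd).closure_isClosed
  have hbd : ∀ ν : ℂ, (∀ p ∈ A.graph, c * ‖p.1‖ ≤ ‖p.2 - ν • p.1‖) →
      ∀ p ∈ A.closure.graph, c * ‖p.1‖ ≤ ‖p.2 - ν • p.1‖ := by
    intro ν hν p hp
    rw [hg] at hp
    exact closure_minimal (s := (A.graph : Set (E × E)))
      (t := {p | c * ‖p.1‖ ≤ ‖p.2 - ν • p.1‖}) hν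
      (isClosed_le (by fun_prop) (by fun_prop)) hp
  refine isSelfAdjoint_of_surjective (hd.mono ?_) (by rw [hg]; exact hs.topologicalClosure) μ ?_ ?_
  · exact (LinearPMap.le_closure A).1
  · exact exists_sub_eq hcl hc (hbd _ hb) fun y hy => h1 y fun p hp => hy p (hle hp)
  · exact exists_sub_eq hcl hc (hbd _ hb') fun y hy => h2 y fun p hp => hy p (hle hp)

theorem isSelfAdjoint_closure_of_isClosed {A : E →ₗ.[ℂ] E} (h : IsSelfAdjoint A.closure)
    (hcl : A.IsClosed) : IsSelfAdjoint A := by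
  have : A.closure = A := by
    refine LinearPMap.eq_of_eq_graph ?_
    rw [← hcl.isClosable.graph_closure_eq_closure_graph]
    exact hcl.submodule_topologicalClosure_eq
  rwa [this] at h

end SelfAdjoint

/-! ### Resolvents and square roots of non-negative self-adjoint operators -/

section Resolvent

open Filter Topology

variable {E : Type*} [NormedAddCommGroup E] [InnerProductSpace ℂ E]

theorem IsNonneg.re_inner_nonneg {A : E →ₗ.[ℂ] E} (h : IsNonneg A) {p : E × E}
    (hp : p ∈ A.graph) : 0 ≤ (inner ℂ p.1 p.2).re := by
  obtain ⟨x, hx1, hx2⟩ := A.mem_graph_iff.1 hp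
  rw [← hx1, ← hx2]
  exact h x

theorem isNonneg_of_graph {A : E →ₗ.[ℂ] E} (h : ∀ p ∈ A.graph, 0 ≤ (inner ℂ p.1 p.2).re) :
    IsNonneg A := fun x => h _ (A.mem_graph x)

theorem mem_opMul_graph {A B : E →ₗ.[ℂ] E} {x z : E} :
    (x, z) ∈ (opMul B A).graph ↔ ∃ y, (x, y) ∈ A.graph ∧ (y, z) ∈ B.graph := by
  constructor
  · intro h
    obtain ⟨w, hw1, hw2⟩ := (LinearPMap.mem_graph_iff _).1 h
    simp only at hw1 hw2
    subst hw1
    refine ⟨A ⟨w, w.2.fst⟩, A.mem_graph ⟨w, w.2.fst⟩, ?_⟩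
    rw [← hw2]
    exact B.mem_graph ⟨A ⟨w, w.2.fst⟩, w.2.snd⟩
  · rintro ⟨y, h1, h2⟩
    obtain ⟨a, ha1, ha2⟩ := (LinearPMap.mem_graph_iff _).1 h1
    obtain ⟨b, hb1, hb2⟩ := (LinearPMap.mem_graph_iff _).1 h2
    simp only at ha1 ha2 hb1 hb2
    subst ha1 ha2 hb2
    have hm : (a : E) ∈ (opMul B A).domain := ⟨a.2, by rw [← hb1]; exact b.2⟩
    refine (LinearPMap.mem_graph_iff _).2 ⟨⟨a, hm⟩, rfl, ?_⟩
    change B ⟨A ⟨a, _⟩, _⟩ = B b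
    congr 1
    exact Subtype.ext hb1.symm

/-- `R = (1 + A / k)⁻¹`. -/
def IsResolvent (A : E →ₗ.[ℂ] E) (k : ℝ) (R : E →L[ℂ] E) : Prop :=
  ∀ x : E, (R x, (k : ℂ) • (x - R x)) ∈ A.graph

namespace IsResolvent

variable {A : E →ₗ.[ℂ] E} {k : ℝ} {R : E →L[ℂ] E}

theorem apply_eq (h : IsResolvent A k R) (h0 : IsNonneg A) (hk : 0 < k) {p : E × E}
    (hp : p ∈ A.graph) : R ((k : ℂ) • p.1 + p.2) = (k : ℂ) • p.1 := by
  set z : E := (k : ℂ) • p.1 + p.2 with hz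
  have h1 := A.graph.sub_mem (h z) (A.graph.smul_mem (k : ℂ) hp)
  have h2 := le_norm_add_of_nonneg (h0.re_inner_nonneg h1) hk.le
  have e : (((R z, (k : ℂ) • (z - R z)) - (k : ℂ) • p) : E × E).2 -
      ((-k : ℝ) : ℂ) • (((R z, (k : ℂ) • (z - R z)) - (k : ℂ) • p) : E × E).1 = 0 := by
    simp only [hz, Prod.snd_sub, Prod.smul_snd, Prod.fst_sub, Prod.smul_fst]
    push_cast
    module
  rw [e, norm_zero] at h2
  have h3 : ‖(((R z, (k : ℂ) • (z - R z)) - (k : ℂ) • p) : E × E).1‖ ≤ 0 := by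
    by_contra h
    push Not at h
    nlinarith
  have h4 := norm_le_zero_iff.1 h3
  simpa [sub_eq_zero] using h4

theorem smul_apply (h : IsResolvent A k R) (h0 : IsNonneg A) (hk : 0 < k) {p : E × E}
    (hp : p ∈ A.graph) : R p.2 = (k : ℂ) • (p.1 - R p.1) := by
  have := h.apply_eq h0 hk hp
  rw [map_add, map_smul] at this
  rw [smul_sub, ← this]
  abel

theorem mem_graph (h : IsResolvent A k R) (h0 : IsNonneg A) (hk : 0 < k) {p : E × E}
    (hp : p ∈ A.graph) : (R p.1, R p.2) ∈ A.graph := by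
  rw [h.smul_apply h0 hk hp]
  exact h p.1

theorem norm_apply_le (h : IsResolvent A k R) (h0 : IsNonneg A) (hk : 0 < k) (x : E) :
    ‖R x‖ ≤ ‖x‖ := by
  have h2 := le_norm_add_of_nonneg (h0.re_inner_nonneg (h x)) hk.le
  have e : (k : ℂ) • (x - R x) - ((-k : ℝ) : ℂ) • R x = (k : ℂ) • x := by
    push_cast
    module
  simp only [e, norm_smul, Complex.norm_real, Real.norm_eq_abs, abs_of_pos hk] at h2
  exact le_of_mul_le_mul_left h2 hk

theorem inner_left (h : IsResolvent A k R) (hs : SymmGraph A.graph) (hk : 0 < k) (x y : E) :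
    inner ℂ (R x) y = inner ℂ x (R y) := by
  have h1 := hs _ (h x) _ (h y)
  simp only [inner_smul_left, inner_smul_right, inner_sub_left, inner_sub_right,
    Complex.conj_ofReal] at h1
  have hk' : (k : ℂ) ≠ 0 := by exact_mod_cast hk.ne'
  have h2 := mul_left_cancel₀ hk' h1
  linear_combination -h2

theorem norm_sq_le (h : IsResolvent A k R) (h0 : IsNonneg A) (hk : 0 < k) (x : E) :
    ‖R x‖ ^ 2 ≤ (inner ℂ (R x) x).re := by
  have h1 := h0.re_inner_nonneg (h x)
  simp only [inner_smul_right, inner_sub_right, inner_self_eq_norm_sq_to_K, Complex.re_ofReal_mul]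
    at h1
  have h2 := nonneg_of_mul_nonneg_right h1 hk
  have h3 : (inner ℂ (R x) x - ((‖R x‖ : ℝ) : ℂ) ^ 2).re =
      (inner ℂ (R x) x).re - ‖R x‖ ^ 2 := by
    rw [Complex.sub_re]
    norm_cast
  have h4 : 0 ≤ (inner ℂ (R x) x - ((‖R x‖ : ℝ) : ℂ) ^ 2).re := h2
  rw [h3] at h4
  linarith

theorem re_inner_nonneg (h : IsResolvent A k R) (h0 : IsNonneg A) (hk : 0 < k) (x : E) :
    0 ≤ (inner ℂ (R x) x).re :=
  (sq_nonneg _).trans (h.norm_sq_le h0 hk x)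

end IsResolvent

variable [CompleteSpace E]

theorem exists_isResolvent {A : E →ₗ.[ℂ] E} (hA : IsSelfAdjoint A) (h0 : IsNonneg A) {k : ℝ}
    (hk : 0 < k) : ∃ R : E →L[ℂ] E, IsResolvent A k R := by
  let L : A.graph →ₗ[ℂ] E :=
    (LinearMap.snd ℂ E E + (k : ℂ) • LinearMap.fst ℂ E E).comp A.graph.subtype
  have hL : ∀ p : A.graph, L p = (p : E × E).2 - ((-k : ℝ) : ℂ) • (p : E × E).1 := by
    intro p
    simp [L]
  have hb : ∀ p ∈ A.graph, k * ‖p.1‖ ≤ ‖p.2 - ((-k : ℝ) : ℂ) • p.1‖ := fun p hp =>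
    le_norm_add_of_nonneg (h0.re_inner_nonneg hp) hk.le
  have hinj : Function.Injective L := by
    rw [← LinearMap.ker_eq_bot, LinearMap.ker_eq_bot']
    intro p hp
    have h1 := hb p p.2
    rw [← hL, hp, norm_zero] at h1
    have h2 : ‖(p : E × E).1‖ ≤ 0 := by
      by_contra h
      push Not at h
      nlinarith
    have h3 : (p : E × E).1 = 0 := norm_le_zero_iff.1 h2
    have h4 := A.graph_fst_eq_zero_snd p.2 h3
    exact Subtype.ext (Prod.ext h3 h4)
  have hsurj : Function.Surjective L := by
    intro z
    obtain ⟨p, hp, hpz⟩ := hA.exists_sub_eq hk hb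
      (fun p hp => by rw [Complex.conj_ofReal]; exact hb p hp) z
    exact ⟨⟨p, hp⟩, (hL _).trans hpz⟩
  let e := LinearEquiv.ofBijective L ⟨hinj, hsurj⟩
  have he : ∀ z, L (e.symm z) = z := fun z => e.apply_symm_apply z
  let R0 : E →ₗ[ℂ] E := (k : ℂ) • ((LinearMap.fst ℂ E E).comp A.graph.subtype).comp e.symm.toLinearMap
  have hR0 : ∀ z, R0 z = (k : ℂ) • ((e.symm z : A.graph) : E × E).1 := fun z => rfl
  refine ⟨R0.mkContinuous 1 fun z => ?_, fun z => ?_⟩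
  · have h1 := hb _ (e.symm z).2
    rw [← hL, he] at h1
    rw [hR0, norm_smul, Complex.norm_real, Real.norm_eq_abs, abs_of_pos hk, one_mul]
    exact h1
  · have h1 := A.graph.smul_mem (k : ℂ) (e.symm z).2
    have h2 := he z
    rw [hL] at h2
    have h3 : ((e.symm z : A.graph) : E × E).2 = z - R0 z := by
      rw [hR0]
      nth_rw 2 [← h2]
      push_cast
      module
    have h4 : (k : ℂ) • ((e.symm z : A.graph) : E × E) = (R0 z, (k : ℂ) • (z - R0 z)) :=
      Prod.ext (hR0 z).symm (by rw [← h3]; rfl)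
    rw [h4] at h1
    exact h1

theorem exists_resolvent_seq {A : E →ₗ.[ℂ] E} (hA : IsSelfAdjoint A) (h0 : IsNonneg A) :
    ∃ R : ℕ → E →L[ℂ] E, (∀ n : ℕ, IsResolvent A (n + 1) (R n)) ∧
      ∀ x, Tendsto (fun n => R n x) atTop (𝓝 x) := by
  have hpos : ∀ n : ℕ, (0 : ℝ) < n + 1 := fun n => by positivity
  choose R hR using fun n : ℕ => exists_isResolvent hA h0 (hpos n)
  refine ⟨R, hR, fun x => ?_⟩
  rw [Metric.tendsto_atTop]
  intro ε hε
  obtain ⟨y, hy, hxy⟩ := Metric.mem_closure_iff.1 (hA.dense_domain x) (ε / 3) (by positivity)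
  obtain ⟨z, hz⟩ := LinearPMap.mem_domain_iff.1 hy
  have hlim : Tendsto (fun n : ℕ => ‖z‖ * (1 / ((n : ℝ) + 1))) atTop (𝓝 (‖z‖ * 0)) :=
    tendsto_one_div_add_atTop_nhds_zero_nat.const_mul _
  rw [mul_zero] at hlim
  obtain ⟨n0, hn0⟩ := eventually_atTop.1 (hlim.eventually (gt_mem_nhds (show 0 < ε / 3 by positivity)))
  refine ⟨n0, fun n hn => ?_⟩
  have h1 : ‖R n x - R n y‖ ≤ ‖x - y‖ := by
    rw [← map_sub]
    exact (hR n).norm_apply_le h0 (hpos n) _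
  have h2 : ‖y - R n y‖ < ε / 3 := by
    refine lt_of_le_of_lt ?_ (hn0 n hn)
    have h3 := (hR n).smul_apply h0 (hpos n) hz
    have h4 := (hR n).norm_apply_le h0 (hpos n) z
    simp only at h3
    rw [h3, norm_smul, Complex.norm_real, Real.norm_eq_abs, abs_of_pos (hpos n)] at h4
    rw [mul_one_div, le_div_iff₀ (hpos n)]
    linarith
  rw [dist_eq_norm] at hxy ⊢
  have e : R n x - x = (R n x - R n y) - (y - R n y) - (x - y) := by abel
  rw [e]
  refine (norm_sub_le _ _).trans_lt ?_
  have := norm_sub_le (R n x - R n y) (y - R n y)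
  linarith

/-- Every non-negative self-adjoint operator has a non-negative self-adjoint square root. -/
theorem exists_isSqrt {A : E →ₗ.[ℂ] E} (hA : IsSelfAdjoint A) (h0 : IsNonneg A) :
    ∃ S, IsSqrt S A := by
  obtain ⟨R, hR⟩ := exists_isResolvent hA h0 one_pos
  have hs := hA.symmGraph
  have hR1 : ∀ x, (R x, x - R x) ∈ A.graph := fun x => by simpa using hR x
  have hRsym : ∀ x y, inner ℂ (R x) y = inner ℂ x (R y) := hR.inner_left hs one_pos
  have hR0 : 0 ≤ R := by
    rw [ContinuousLinearMap.nonneg_iff_isPositive]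
    refine ⟨fun x y => hRsym x y, fun x => ?_⟩
    exact hR.re_inner_nonneg h0 one_pos x
  have hR1' : 0 ≤ 1 - R := by
    rw [ContinuousLinearMap.nonneg_iff_isPositive]
    refine ⟨fun x y => ?_, fun x => ?_⟩
    · change inner ℂ (x - R x) y = inner ℂ x (y - R y)
      rw [inner_sub_left, inner_sub_right, hRsym]
    · change 0 ≤ (inner ℂ (x - R x) x).re
      have h1 := h0.re_inner_nonneg (hR1 x)
      simp only at h1
      have h2 : inner ℂ (x - R x) x = inner ℂ (x - R x) (x - R x) + inner ℂ (x - R x) (R x) := by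
        rw [← inner_add_right, sub_add_cancel]
      rw [h2, Complex.add_re]
      have h3 : 0 ≤ (inner ℂ (x - R x) (x - R x)).re := inner_self_nonneg (𝕜 := ℂ)
      have h4 : (inner ℂ (x - R x) (R x)).re = (inner ℂ (R x) (x - R x)).re :=
        inner_re_symm (𝕜 := ℂ) _ _
      linarith
  let Q : E →L[ℂ] E := CFC.sqrt R
  let P : E →L[ℂ] E := CFC.sqrt (1 - R)
  have hQ0 : 0 ≤ Q := CFC.sqrt_nonneg _
  have hP0 : 0 ≤ P := CFC.sqrt_nonneg _
  have hQQ : ∀ x, Q (Q x) = R x := fun x =>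
    congrArg (fun B : E →L[ℂ] E => B x) (CFC.sqrt_mul_sqrt_self R hR0)
  have hPP : ∀ x, P (P x) = x - R x := fun x =>
    congrArg (fun B : E →L[ℂ] E => B x) (CFC.sqrt_mul_sqrt_self (1 - R) hR1')
  have hcomm : Commute Q P := by
    have h1 : Commute R (1 - R) := (Commute.one_right R).sub_right (Commute.refl R)
    have h2 : Commute Q (1 - R) := h1.cfcₙ_nnreal NNReal.sqrt
    exact (h2.symm.cfcₙ_nnreal NNReal.sqrt).symm
  have hQP : ∀ x, Q (P x) = P (Q x) := fun x =>
    congrArg (fun B : E →L[ℂ] E => B x) hcomm.eq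
  have hQs : ∀ x y, inner ℂ (Q x) y = inner ℂ x (Q y) :=
    ((ContinuousLinearMap.nonneg_iff_isPositive Q).1 hQ0).isSymmetric
  have hPs : ∀ x y, inner ℂ (P x) y = inner ℂ x (P y) :=
    ((ContinuousLinearMap.nonneg_iff_isPositive P).1 hP0).isSymmetric
  have hQP0 : ∀ x, 0 ≤ (inner ℂ (Q (P x)) x).re :=
    fun x => ((ContinuousLinearMap.nonneg_iff_isPositive (Q * P)).1
      (hcomm.mul_nonneg hQ0 hP0)).re_inner_nonneg_left x
  have hRinj : ∀ x, R x = 0 → x = 0 := by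
    intro x hx
    have h1 := hR1 x
    have := A.graph_fst_eq_zero_snd h1 hx
    rwa [hx, sub_zero] at this
  have hQinj : ∀ x, Q x = 0 → x = 0 := fun x hx => hRinj x (by rw [← hQQ, hx, map_zero])
  let G : Submodule ℂ (E × E) := LinearMap.range (Q.toLinearMap.prod P.toLinearMap)
  have hG : ∀ p : E × E, p ∈ G ↔ ∃ y, (Q y, P y) = p := fun p => Iff.rfl
  have hgr : G.toLinearPMap.graph = G := by
    refine Submodule.toLinearPMap_graph_eq _ fun p hp hp0 => ?_
    obtain ⟨y, rfl⟩ := (hG p).1 hp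
    simp only at hp0 ⊢
    rw [hQinj y hp0, map_zero]
  have hdom : Dense (G.toLinearPMap.domain : Set E) := by
    refine hA.dense_domain.mono fun x hx => ?_
    obtain ⟨z, hz⟩ := LinearPMap.mem_domain_iff.1 hx
    refine LinearPMap.mem_domain_iff.2 ⟨P (Q (x + z)), ?_⟩
    rw [hgr]
    refine ⟨Q (x + z), ?_⟩
    have h1 := hR.apply_eq h0 one_pos hz
    simp only [Complex.ofReal_one, one_smul] at h1
    change (Q (Q (x + z)), P (Q (x + z))) = _
    rw [hQQ, h1]
  refine ⟨G.toLinearPMap, isSelfAdjoint_of_graph hdom ?_ ?_, ?_, ?_⟩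
  · rw [hgr]
    rintro _ ⟨y, rfl⟩ _ ⟨z, rfl⟩
    change inner ℂ (P y) (Q z) = inner ℂ (Q y) (P z)
    rw [hPs, hQs, hQP]
  · intro u v huv
    rw [hgr] at huv ⊢
    have h1 : P u = Q v := by
      refine ext_inner_left ℂ fun y => ?_
      rw [← hPs, ← hQs]
      exact huv _ ⟨y, rfl⟩
    refine ⟨Q u + P v, ?_⟩
    change (Q (Q u + P v), P (Q u + P v)) = (u, v)
    rw [map_add, map_add, ← hQP u, h1, hQQ, hQQ, hQP, ← h1, hPP, hPP]
    simp
  · refine isNonneg_of_graph fun p hp => ?_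
    rw [hgr] at hp
    obtain ⟨y, rfl⟩ := hp
    have := hQP0 y
    rw [hQs] at this
    have h2 : (inner ℂ (Q y) (P y)).re = (inner ℂ (P y) (Q y)).re := inner_re_symm (𝕜 := ℂ) _ _
    change 0 ≤ (inner ℂ (Q y) (P y)).re
    rw [h2]
    exact this
  · refine LinearPMap.eq_of_eq_graph ?_
    ext ⟨x, z⟩
    rw [mem_opMul_graph, hgr]
    constructor
    · rintro ⟨w, ⟨y, hy⟩, ⟨y', hy'⟩⟩
      have e1 : Q y = x := congrArg Prod.fst hy
      have e2 : P y = w := congrArg Prod.snd hy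
      have e3 : Q y' = w := congrArg Prod.fst hy'
      have e4 : P y' = z := congrArg Prod.snd hy'
      have h1 : y = Q (x + z) := by
        have := hPP y
        rw [e2, ← e3, ← hQP, e4, ← hQQ, e1] at this
        rw [map_add, this]
        abel
      have h2 : R (x + z) = x := by rw [← hQQ, ← h1, e1]
      have h3 := hR1 (x + z)
      rw [h2, add_sub_cancel_left] at h3
      exact h3
    · intro h
      have h1 := hR.apply_eq h0 one_pos h
      simp only [Complex.ofReal_one, one_smul] at h1
      refine ⟨P (Q (x + z)), ⟨Q (x + z), ?_⟩, ⟨P (x + z), ?_⟩⟩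
      · change (Q (Q (x + z)), P (Q (x + z))) = _
        rw [hQQ, h1]
      · change (Q (P (x + z)), P (P (x + z))) = _
        rw [hQP, hPP, h1, add_sub_cancel_left]

theorem isSqrt_opSqrt {A : E →ₗ.[ℂ] E} (hA : IsSelfAdjoint A) (h0 : IsNonneg A) :
    IsSqrt (opSqrt A) A := by
  have h := exists_isSqrt hA h0
  unfold opSqrt
  rw [dif_pos h]
  exact h.choose_spec

end Resolvent

/-! ### Perturbation theory -/

section Perturbation

open Filter Topology

variable {E : Type*} [NormedAddCommGroup E] [InnerProductSpace ℂ E]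

theorem mem_domRestrict_graph {A : E →ₗ.[ℂ] E} {D : Submodule ℂ E} {p : E × E} :
    p ∈ (A.domRestrict D).graph ↔ p.1 ∈ D ∧ p ∈ A.graph := by
  constructor
  · intro h
    obtain ⟨w, hw1, hw2⟩ := (LinearPMap.mem_graph_iff _).1 h
    refine ⟨hw1 ▸ w.2.1, LinearPMap.le_graph_of_le LinearPMap.domRestrict_le h⟩
  · rintro ⟨h1, h2⟩
    obtain ⟨w, hw1, hw2⟩ := (LinearPMap.mem_graph_iff _).1 h2
    refine (LinearPMap.mem_graph_iff _).2 ⟨⟨w, hw1 ▸ h1, w.2⟩, hw1, ?_⟩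
    rw [← hw2]
    exact LinearPMap.domRestrict_apply rfl

theorem mem_add_graph {A B : E →ₗ.[ℂ] E} {x z : E} :
    (x, z) ∈ (A + B).graph ↔ ∃ y w, (x, y) ∈ A.graph ∧ (x, w) ∈ B.graph ∧ z = y + w := by
  constructor
  · intro h
    obtain ⟨v, hv1, hv2⟩ := (LinearPMap.mem_graph_iff _).1 h
    simp only at hv1 hv2
    subst hv1
    refine ⟨A ⟨v, v.2.1⟩, B ⟨v, v.2.2⟩, A.mem_graph ⟨v, v.2.1⟩, B.mem_graph ⟨v, v.2.2⟩, ?_⟩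
    rw [← hv2]
    exact LinearPMap.add_apply A B v
  · rintro ⟨y, w, h1, h2, rfl⟩
    obtain ⟨a, ha1, ha2⟩ := (LinearPMap.mem_graph_iff _).1 h1
    obtain ⟨b, hb1, hb2⟩ := (LinearPMap.mem_graph_iff _).1 h2
    simp only at ha1 ha2 hb1 hb2
    subst ha1 ha2 hb2
    refine (LinearPMap.mem_graph_iff _).2 ⟨⟨a, a.2, hb1 ▸ b.2⟩, rfl, ?_⟩
    refine (LinearPMap.add_apply A B _).trans ?_
    congr 2
    exact Subtype.ext hb1.symm

theorem mem_smul_graph {A : E →ₗ.[ℂ] E} {c : ℂ} {x z : E} :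
    (x, z) ∈ (c • A).graph ↔ ∃ y, (x, y) ∈ A.graph ∧ z = c • y := by
  constructor
  · intro h
    obtain ⟨v, hv1, hv2⟩ := (LinearPMap.mem_graph_iff _).1 h
    simp only at hv1 hv2
    subst hv1
    exact ⟨A v, A.mem_graph v, hv2.symm⟩
  · rintro ⟨y, h1, rfl⟩
    obtain ⟨a, ha1, ha2⟩ := (LinearPMap.mem_graph_iff _).1 h1
    simp only at ha1 ha2
    subst ha1 ha2
    exact (LinearPMap.mem_graph_iff _).2 ⟨a, rfl, rfl⟩

theorem mem_addConst_graph {A : E →ₗ.[ℂ] E} {M : ℝ} {x z : E} :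
    (x, z) ∈ (addConst A M).graph ↔ ∃ y, (x, y) ∈ A.graph ∧ z = (M : ℂ) • x + y := by
  constructor
  · intro h
    obtain ⟨v, hv1, hv2⟩ := (LinearPMap.mem_graph_iff _).1 h
    simp only at hv1 hv2
    subst hv1
    exact ⟨A v, A.mem_graph v, hv2.symm⟩
  · rintro ⟨y, h1, rfl⟩
    obtain ⟨a, ha1, ha2⟩ := (LinearPMap.mem_graph_iff _).1 h1
    simp only at ha1 ha2
    subst ha1 ha2
    exact (LinearPMap.mem_graph_iff _).2 ⟨a, rfl, rfl⟩

theorem isBoundedBelowBy_iff {A : E →ₗ.[ℂ] E} {c : ℝ} :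
    IsBoundedBelowBy A c ↔ ∀ p ∈ A.graph, c * ‖p.1‖ ^ 2 ≤ (inner ℂ p.1 p.2).re := by
  constructor
  · intro h p hp
    obtain ⟨x, hx1, hx2⟩ := A.mem_graph_iff.1 hp
    rw [← hx1, ← hx2]
    exact h x
  · exact fun h x => h _ (A.mem_graph x)

theorem IsBoundedBelow.closure {A : E →ₗ.[ℂ] E} (h : IsBoundedBelow A) :
    IsBoundedBelow A.closure := by
  by_cases hA : A.IsClosable
  · obtain ⟨c, hc⟩ := h
    refine ⟨c, isBoundedBelowBy_iff.2 fun p hp => ?_⟩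
    rw [← hA.graph_closure_eq_closure_graph] at hp
    exact closure_minimal (s := (A.graph : Set (E × E)))
      (t := {p | c * ‖p.1‖ ^ 2 ≤ (inner ℂ p.1 p.2).re}) (isBoundedBelowBy_iff.1 hc)
      (isClosed_le (by fun_prop) (Complex.continuous_re.comp (by fun_prop))) hp
  · rwa [LinearPMap.closure_def' hA]

/-- Every point of the graph of `A` is a limit of points of the graph over `D`. -/
def GraphCore (A : E →ₗ.[ℂ] E) (D : Submodule ℂ E) : Prop :=
  ∀ p ∈ A.graph, p ∈ closure {q : E × E | q ∈ A.graph ∧ q.1 ∈ D}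

theorem graphCore_domain (A : E →ₗ.[ℂ] E) : GraphCore A A.domain :=
  fun p hp => subset_closure ⟨hp, LinearPMap.mem_domain_of_mem_graph (y := p.2) hp⟩

theorem hasCore_graphCore {A : E →ₗ.[ℂ] E} {D : Submodule ℂ E} (hA : A.IsClosable)
    (h : A.HasCore D) : GraphCore A D := by
  intro p hp
  rw [← h.closure_eq, ← (hA.leIsClosable LinearPMap.domRestrict_le).graph_closure_eq_closure_graph]
    at hp
  exact closure_mono (fun q hq => (mem_domRestrict_graph.1 hq).symm) hp

/-- A partially defined bounded map extends to limits. -/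
theorem exists_mem_closure_of_bound {V W : Type*} [NormedAddCommGroup V] [NormedSpace ℂ V]
    [NormedAddCommGroup W] [NormedSpace ℂ W] [CompleteSpace W] (G : Submodule ℂ (V × W)) {K : ℝ}
    (hK : ∀ p ∈ G, ‖p.2‖ ≤ K * ‖p.1‖) {v : V} (hv : v ∈ closure (Prod.fst '' (G : Set (V × W)))) :
    ∃ w, (v, w) ∈ closure (G : Set (V × W)) := by
  obtain ⟨a, ha, hlim⟩ := mem_closure_iff_seq_limit.1 hv
  choose b hb hab using ha
  have hcauchy : CauchySeq fun n => (b n).2 := by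
    have h1 : CauchySeq a := hlim.cauchySeq
    rw [Metric.cauchySeq_iff] at h1 ⊢
    intro ε hε
    obtain ⟨N, hN⟩ := h1 (ε / (|K| + 1)) (by positivity)
    refine ⟨N, fun m hm n hn => ?_⟩
    have h2 := hN m hm n hn
    rw [dist_eq_norm] at h2 ⊢
    have h3 := hK _ (G.sub_mem (hb m) (hb n))
    rw [Prod.snd_sub, Prod.fst_sub, hab, hab] at h3
    rw [lt_div_iff₀ (by positivity)] at h2
    have h4 : K * ‖a m - a n‖ ≤ |K| * ‖a m - a n‖ := by gcongr; exact le_abs_self K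
    nlinarith [norm_nonneg (a m - a n)]
  obtain ⟨w, hw⟩ := cauchySeq_tendsto_of_complete hcauchy
  refine ⟨w, mem_closure_iff_seq_limit.2 ⟨b, hb, ?_⟩⟩
  have : b = fun n => (a n, (b n).2) := by
    funext n
    rw [← hab]
  rw [this]
  exact hlim.prodMk_nhds hw

/-- The relation of all `((x, A x), B x)` with `x ∈ D`. -/
def jointGraph (A B : E →ₗ.[ℂ] E) (D : Submodule ℂ E) : Submodule ℂ ((E × E) × E) where
  carrier := {p | p.1 ∈ A.graph ∧ (p.1.1, p.2) ∈ B.graph ∧ p.1.1 ∈ D}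
  add_mem' hp hq := ⟨A.graph.add_mem hp.1 hq.1, B.graph.add_mem hp.2.1 hq.2.1,
    D.add_mem hp.2.2 hq.2.2⟩
  zero_mem' := ⟨A.graph.zero_mem, B.graph.zero_mem, D.zero_mem⟩
  smul_mem' c _ hp := ⟨A.graph.smul_mem c hp.1, B.graph.smul_mem c hp.2.1, D.smul_mem c hp.2.2⟩

theorem closure_domRestrict_of_graphCore {B : E →ₗ.[ℂ] E} {D : Submodule ℂ E} (hB : B.IsClosable)
    (hD : GraphCore B D) : (B.domRestrict D).closure = B.closure := by
  refine LinearPMap.eq_of_eq_graph ?_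
  rw [← hB.graph_closure_eq_closure_graph,
    ← (hB.leIsClosable LinearPMap.domRestrict_le).graph_closure_eq_closure_graph]
  refine le_antisymm (Submodule.topologicalClosure_mono
    (LinearPMap.le_graph_of_le LinearPMap.domRestrict_le)) ?_
  refine Submodule.topologicalClosure_minimal _ (fun p hp => ?_)
    (Submodule.isClosed_topologicalClosure _)
  exact closure_mono (fun q hq => mem_domRestrict_graph.2 hq.symm) (hD p hp)

theorem graphCore_addConst {A : E →ₗ.[ℂ] E} {D : Submodule ℂ E} (h : GraphCore A D) (M : ℝ) :
    GraphCore (addConst A M) D := by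
  rintro ⟨x, z⟩ hp
  obtain ⟨y, hy, rfl⟩ := mem_addConst_graph.1 hp
  refine map_mem_closure (f := fun p : E × E => (p.1, (M : ℂ) • p.1 + p.2)) (by fun_prop)
    (h _ hy) ?_
  rintro ⟨a, b⟩ ⟨h1, h2⟩
  exact ⟨mem_addConst_graph.2 ⟨b, h1, rfl⟩, h2⟩

variable [CompleteSpace E]

theorem exists_mem_closure_jointGraph {A B : E →ₗ.[ℂ] E} {D : Submodule ℂ E}
    (hD : GraphCore A D) (hDB : D ≤ B.domain) {K : ℝ}
    (hK : ∀ x y z : E, x ∈ D → (x, y) ∈ A.graph → (x, z) ∈ B.graph → ‖z‖ ≤ K * (‖x‖ + ‖y‖))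
    {p : E × E} (hp : p ∈ A.graph) :
    ∃ z, (p, z) ∈ closure (jointGraph A B D : Set ((E × E) × E)) := by
  refine exists_mem_closure_of_bound (jointGraph A B D) (K := 2 * |K|) ?_ ?_
  · rintro ⟨⟨x, y⟩, z⟩ ⟨h1, h2, h3⟩
    refine (hK x y z h3 h1 h2).trans ?_
    have e1 : ‖x‖ ≤ ‖(x, y)‖ := norm_fst_le (x, y)
    have e2 : ‖y‖ ≤ ‖(x, y)‖ := norm_snd_le (x, y)
    have e3 : K * (‖x‖ + ‖y‖) ≤ |K| * (‖x‖ + ‖y‖) := by gcongr; exact le_abs_self K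
    have e4 : |K| * (‖x‖ + ‖y‖) ≤ |K| * (‖(x, y)‖ + ‖(x, y)‖) := by gcongr
    linarith
  · refine closure_mono ?_ (hD p hp)
    rintro q ⟨hq1, hq2⟩
    obtain ⟨z, hz⟩ := LinearPMap.mem_domain_iff.1 (hDB hq2)
    exact ⟨(q, z), ⟨hq1, hz, hq2⟩, rfl⟩

/-- If `B` is bounded relative to `A` on a core of `A`, then the closure of `B` on that core
extends to the domain of `A`. -/
theorem mem_closure_graph_of_core {A B : E →ₗ.[ℂ] E} {D : Submodule ℂ E}
    (hD : GraphCore A D) (hDB : D ≤ B.domain) {K : ℝ}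
    (hK : ∀ x y z : E, x ∈ D → (x, y) ∈ A.graph → (x, z) ∈ B.graph → ‖z‖ ≤ K * (‖x‖ + ‖y‖))
    {x : E} (hx : x ∈ A.domain) :
    ∃ z, (x, z) ∈ closure {q : E × E | q ∈ B.graph ∧ q.1 ∈ D} := by
  obtain ⟨y, hy⟩ := LinearPMap.mem_domain_iff.1 hx
  obtain ⟨z, hz⟩ := exists_mem_closure_jointGraph hD hDB hK hy
  refine ⟨z, map_mem_closure (f := fun p : (E × E) × E => (p.1.1, p.2)) (by fun_prop) hz ?_⟩
  rintro p ⟨h1, h2, h3⟩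
  exact ⟨h2, h3⟩

theorem graphCore_of_relBound {A B : E →ₗ.[ℂ] E} {D : Submodule ℂ E} (hB : B.IsClosable)
    (hD : GraphCore A D) (hAB : B.domain = A.domain) (hDA : D ≤ A.domain) {K : ℝ}
    (hK : ∀ x y z : E, (x, y) ∈ A.graph → (x, z) ∈ B.graph → ‖z‖ ≤ K * (‖x‖ + ‖y‖)) :
    GraphCore B D := by
  rintro ⟨x, z⟩ hp
  have hx : x ∈ A.domain := hAB ▸ LinearPMap.mem_domain_of_mem_graph hp
  obtain ⟨w, hw⟩ := mem_closure_graph_of_core hD (hAB ▸ hDA)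
    (fun x y z _ h1 h2 => hK x y z h1 h2) hx
  have h1 : (x, w) ∈ B.closure.graph := by
    rw [← hB.graph_closure_eq_closure_graph]
    exact closure_mono (fun q hq => hq.1) hw
  have h2 : (x, z) ∈ B.closure.graph := LinearPMap.le_graph_of_le B.le_closure hp
  have h3 : z = w := B.closure.mem_graph_snd_inj h2 h1 rfl
  rw [h3]
  exact hw

theorem isClosed_of_relBound {A B : E →ₗ.[ℂ] E} (hA : A.IsClosed) (hB : B.IsClosable)
    (hAB : B.domain = A.domain) {K : ℝ}
    (hK : ∀ x y z : E, (x, y) ∈ A.graph → (x, z) ∈ B.graph → ‖y‖ ≤ K * (‖x‖ + ‖z‖)) :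
    B.IsClosed := by
  have h : B.closure.graph ≤ B.graph := by
    rintro ⟨x, z⟩ hp
    have hcore : GraphCore B.closure B.domain := by
      intro p hp
      rw [← hB.graph_closure_eq_closure_graph] at hp
      refine closure_mono ?_ hp
      exact fun q hq => ⟨LinearPMap.le_graph_of_le B.le_closure hq,
        LinearPMap.mem_domain_of_mem_graph (y := q.2) hq⟩
    obtain ⟨y, hy⟩ := mem_closure_graph_of_core (A := B.closure) (B := A) hcore hAB.le
      (K := K) (fun x z y hx h1 h2 => by
        obtain ⟨z', hz'⟩ := LinearPMap.mem_domain_iff.1 hx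
        have := B.closure.mem_graph_snd_inj h1 (LinearPMap.le_graph_of_le B.le_closure hz') rfl
        subst this
        exact hK x y z h2 hz') (LinearPMap.mem_domain_of_mem_graph hp)
    have hy' : (x, y) ∈ A.graph := by
      have : (x, y) ∈ closure (A.graph : Set (E × E)) := closure_mono (fun q hq => hq.1) hy
      rwa [IsClosed.closure_eq hA] at this
    have hx : x ∈ B.domain := hAB ▸ LinearPMap.mem_domain_of_mem_graph hy'
    obtain ⟨w, hw⟩ := LinearPMap.mem_domain_iff.1 hx
    have := B.closure.mem_graph_snd_inj hp (LinearPMap.le_graph_of_le B.le_closure hw) rfl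
    rw [this]
    exact hw
  have h2 : B.closure.graph = B.graph :=
    le_antisymm h (LinearPMap.le_graph_of_le B.le_closure)
  have := hB.closure_isClosed
  unfold LinearPMap.IsClosed at this ⊢
  rwa [h2] at this

/-- Kato–Rellich: perturbations of relative bound less than one. -/
theorem isSelfAdjoint_closure_of_relBound {A B : E →ₗ.[ℂ] E} (hA : IsSelfAdjoint A)
    (hB : SymmGraph B.graph) (hAB : B.domain = A.domain) {a b : ℝ} (ha0 : 0 ≤ a) (hb0 : 0 ≤ b)
    (ha : a < 1)
    (h : ∀ x y z : E, (x, y) ∈ A.graph → (x, z) ∈ B.graph → ‖z - y‖ ≤ a * ‖y‖ + b * ‖x‖) :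
    IsSelfAdjoint B.closure := by
  obtain ⟨κ, hκ, hκb⟩ : ∃ κ : ℝ, 0 < κ ∧ a + b / κ < 1 := by
    refine ⟨2 * b / (1 - a) + 1, ?_, ?_⟩
    · have : 0 < 1 - a := by linarith
      positivity
    · have h1 : 0 < 1 - a := by linarith
      have h2 : 0 < 2 * b / (1 - a) + 1 := by positivity
      rw [← lt_sub_iff_add_lt', div_lt_iff₀ h2, mul_add, mul_div_cancel₀ _ h1.ne']
      linarith
  have key : ∀ ν : ℝ, |ν| = κ → ∀ φ : E,
      (∀ p ∈ B.graph, inner ℂ (p.2 - (Complex.I * ν) • p.1) φ = 0) → φ = 0 := by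
    intro ν hν φ hφ
    have hs := hA.symmGraph
    obtain ⟨p, hp, hpφ⟩ := hA.exists_sub_eq (μ := Complex.I * ν) hκ
      (fun p hp => by rw [← hν]; exact hs.le_norm_sub hp ν)
      (fun p hp => by
        have := hs.le_norm_sub hp (-ν)
        rw [abs_neg, hν] at this
        simpa using this) φ
    have hx : p.1 ∈ B.domain := hAB ▸ LinearPMap.mem_domain_of_mem_graph (y := p.2) hp
    obtain ⟨z, hz⟩ := LinearPMap.mem_domain_iff.1 hx
    have h1 := hφ _ hz
    have h2 : z - (Complex.I * ν) • p.1 = (z - p.2) + φ := by rw [← hpφ]; abel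
    simp only [h2, inner_add_left] at h1
    have h3 : ‖φ‖ ^ 2 ≤ ‖z - p.2‖ * ‖φ‖ := by
      have h4 : inner ℂ φ φ = -inner ℂ (z - p.2) φ := by linear_combination h1
      have h5 : ‖inner ℂ φ φ‖ = ‖φ‖ ^ 2 := by
        rw [inner_self_eq_norm_sq_to_K]
        simp
      rw [← h5, h4, norm_neg]
      exact norm_inner_le_norm _ _
    have h6 := hs.norm_sub_sq hp ν
    rw [hpφ] at h6
    have h7 : ‖p.2‖ ≤ ‖φ‖ := by
      refine abs_le_of_sq_le_sq' ?_ (norm_nonneg _) |>.2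
      rw [h6]
      nlinarith [mul_nonneg (sq_nonneg ν) (sq_nonneg ‖p.1‖)]
    have h8 : κ * ‖p.1‖ ≤ ‖φ‖ := by
      rw [← hν, ← hpφ]
      exact hs.le_norm_sub hp ν
    have h9 := h _ _ _ hp hz
    have h10 : ‖z - p.2‖ ≤ (a + b / κ) * ‖φ‖ := by
      refine h9.trans ?_
      have : ‖p.1‖ ≤ ‖φ‖ / κ := by rw [le_div_iff₀ hκ]; linarith
      calc a * ‖p.2‖ + b * ‖p.1‖ ≤ a * ‖φ‖ + b * (‖φ‖ / κ) := by gcongr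
        _ = _ := by ring
    by_contra hne
    have hpos : 0 < ‖φ‖ := norm_pos_iff.2 hne
    have h11 : ‖z - p.2‖ * ‖φ‖ ≤ (a + b / κ) * ‖φ‖ * ‖φ‖ := by gcongr
    nlinarith [mul_pos hpos hpos]
  have hd : Dense (B.domain : Set E) := hAB ▸ hA.dense_domain
  have hconj : starRingEnd ℂ (Complex.I * (κ : ℂ)) = Complex.I * ((-κ : ℝ) : ℂ) := by simp
  refine isSelfAdjoint_closure hd hB (μ := Complex.I * κ) hκ ?_ ?_ ?_ ?_
  · intro p hp
    have := hB.le_norm_sub hp κ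
    rwa [abs_of_pos hκ] at this
  · intro p hp
    have := hB.le_norm_sub hp (-κ)
    rw [hconj]
    rwa [abs_neg, abs_of_pos hκ] at this
  · exact key κ (abs_of_pos hκ)
  · rw [hconj]
    exact key (-κ) (by rw [abs_neg, abs_of_pos hκ])

/-- Nelson's commutator theorem. -/
theorem isSelfAdjoint_closure_of_commutator {A B : E →ₗ.[ℂ] E} (hA : IsSelfAdjoint A)
    (hA0 : IsNonneg A) (hB : SymmGraph B.graph) (hAB : B.domain = A.domain) {K : ℝ}
    (hK0 : 0 ≤ K)
    (h : ∀ x y z : E, (x, y) ∈ A.graph → (x, z) ∈ B.graph →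
      |(inner ℂ y z).im| ≤ K * ((inner ℂ x y).re + ‖x‖ ^ 2)) :
    IsSelfAdjoint B.closure := by
  have hs := hA.symmGraph
  have key : ∀ ν : ℝ, |ν| = K + 1 → ∀ φ : E,
      (∀ p ∈ B.graph, inner ℂ (p.2 - (Complex.I * ν) • p.1) φ = 0) → φ = 0 := by
    intro ν hν φ hφ
    obtain ⟨R, hR⟩ := exists_isResolvent hA hA0 one_pos
    have hp : (R φ, φ - R φ) ∈ A.graph := by simpa using hR φ
    set x := R φ
    set y := φ - x with hy
    obtain ⟨z, hz⟩ := LinearPMap.mem_domain_iff.1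
      (show x ∈ B.domain from hAB ▸ LinearPMap.mem_domain_of_mem_graph hp)
    have h1 := hφ _ hz
    have h2 : φ = y + x := by simp [hy]
    rw [h2] at h1
    simp only [inner_sub_left, inner_add_right, inner_smul_left] at h1
    have h3 := congrArg Complex.im h1
    have i1 : (inner ℂ x y).im = 0 := hs.im_inner hp
    have i2 : (inner ℂ z x).im = 0 := by
      have := hB.im_inner hz
      rw [← inner_conj_symm, Complex.conj_im]
      simpa using this
    have i3 : inner ℂ x x = ((‖x‖ ^ 2 : ℝ) : ℂ) := by
      rw [inner_self_eq_norm_sq_to_K]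
      simp
    have i4 : (inner ℂ z y).im = -(inner ℂ y z).im := by
      rw [← inner_conj_symm, Complex.conj_im]
    rw [i3] at h3
    simp only [map_mul, Complex.conj_I, Complex.conj_ofReal, Complex.add_im, Complex.sub_im,
      Complex.mul_im, Complex.mul_re, Complex.neg_re, Complex.neg_im, Complex.I_re, Complex.I_im,
      Complex.ofReal_re, Complex.ofReal_im, Complex.zero_im, i1, i2, i4] at h3
    have h4 := h _ _ _ hp hz
    have h5 := hA0.re_inner_nonneg hp
    simp only at h5
    have h6 : (inner ℂ y z).im = ν * ((inner ℂ x y).re + ‖x‖ ^ 2) := by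
      linear_combination -h3
    have h7 : 0 ≤ (inner ℂ x y).re + ‖x‖ ^ 2 := by positivity
    rw [h6, abs_mul, abs_of_nonneg h7, hν] at h4
    have h8 : ‖x‖ ^ 2 ≤ 0 := by nlinarith
    have h9 : x = 0 := by
      have : ‖x‖ = 0 := by nlinarith [norm_nonneg x, sq_nonneg ‖x‖]
      simpa using this
    have h10 : y = 0 := A.graph_fst_eq_zero_snd hp h9
    rw [h2, h9, h10, add_zero]
  have hd : Dense (B.domain : Set E) := hAB ▸ hA.dense_domain
  have hpos : 0 < K + 1 := by linarith
  have hconj : starRingEnd ℂ (Complex.I * ((K + 1 : ℝ) : ℂ)) =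
      Complex.I * ((-(K + 1) : ℝ) : ℂ) := by
    simp only [map_mul, Complex.conj_I, Complex.conj_ofReal, Complex.ofReal_neg]
    ring
  refine isSelfAdjoint_closure hd hB (μ := Complex.I * ((K + 1 : ℝ) : ℂ)) hpos ?_ ?_ ?_ ?_
  · intro p hp
    have := hB.le_norm_sub hp (K + 1)
    rwa [abs_of_pos hpos] at this
  · intro p hp
    have := hB.le_norm_sub hp (-(K + 1))
    rw [hconj]
    rwa [abs_neg, abs_of_pos hpos] at this
  · exact key (K + 1) (abs_of_pos hpos)
  · rw [hconj]
    exact key (-(K + 1)) (by rw [abs_neg, abs_of_pos hpos])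

/-! ### Form domains -/

theorem IsSqrt.exists_graph {S A : E →ₗ.[ℂ] E} (h : IsSqrt S A) {x y : E} (hxy : (x, y) ∈ A.graph) :
    ∃ w, (x, w) ∈ S.graph ∧ (w, y) ∈ S.graph := by
  rw [← h.2.2] at hxy
  exact mem_opMul_graph.1 hxy

theorem IsSqrt.norm_sq {S A : E →ₗ.[ℂ] E} (h : IsSqrt S A) {x y w : E} (hxy : (x, y) ∈ A.graph)
    (hw : (x, w) ∈ S.graph) : ‖w‖ ^ 2 = (inner ℂ x y).re := by
  obtain ⟨w', h1, h2⟩ := h.exists_graph hxy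
  have := S.mem_graph_snd_inj hw h1 rfl
  subst this
  have h3 := h.1.symmGraph _ h1 _ h2
  simp only at h3
  rw [← h3, inner_self_eq_norm_sq_to_K]
  norm_cast

theorem IsSqrt.graphCore {S A : E →ₗ.[ℂ] E} (h : IsSqrt S A) {D : Submodule ℂ E}
    (hD : GraphCore A D) : GraphCore S D := by
  have h1 : GraphCore S A.domain := by
    rintro ⟨x, w⟩ hp
    obtain ⟨R, hR, hlim⟩ := exists_resolvent_seq h.1 h.2.1
    refine mem_closure_of_tendsto ((hlim x).prodMk_nhds (hlim w)) (Eventually.of_forall fun n => ?_)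
    have hpos : (0 : ℝ) < n + 1 := by positivity
    have h2 := (hR n).mem_graph h.2.1 hpos hp
    refine ⟨h2, ?_⟩
    rw [← h.2.2]
    exact LinearPMap.mem_domain_of_mem_graph (mem_opMul_graph.2 ⟨_, h2, hR n w⟩)
  intro p hp
  rw [← closure_closure]
  refine closure_mono ?_ (h1 p hp)
  rintro ⟨x, w⟩ ⟨hq1, hq2⟩
  obtain ⟨y, hy⟩ := LinearPMap.mem_domain_iff.1 hq2
  obtain ⟨a, ha, hlim⟩ := mem_closure_iff_seq_limit.1 (hD _ hy)
  have hex : ∀ n, ∃ v, ((a n).1, v) ∈ S.graph := fun n =>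
    (h.exists_graph (ha n).1).imp fun v hv => hv.1
  choose v hv using hex
  have hlim1 : Tendsto (fun n => (a n).1) atTop (𝓝 x) := (continuous_fst.tendsto _).comp hlim
  have hlim2 : Tendsto (fun n => (a n).2) atTop (𝓝 y) := (continuous_snd.tendsto _).comp hlim
  have hlim3 : Tendsto v atTop (𝓝 w) := by
    have hsq : ∀ n, ‖v n - w‖ ^ 2 = (inner ℂ ((a n).1 - x) ((a n).2 - y)).re := fun n =>
      h.norm_sq (A.graph.sub_mem (ha n).1 hy) (S.graph.sub_mem (hv n) hq1)
    have h4 : Tendsto (fun n => ‖v n - w‖ ^ 2) atTop (𝓝 0) := by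
      simp_rw [hsq]
      have h5 : Tendsto (fun n => inner ℂ ((a n).1 - x) ((a n).2 - y)) atTop
          (𝓝 (inner ℂ (x - x) (y - y))) :=
        (hlim1.sub_const x).inner (hlim2.sub_const y)
      have h6 := (Complex.continuous_re.tendsto _).comp h5
      rw [sub_self, inner_zero_left, Complex.zero_re] at h6
      exact h6
    rw [tendsto_iff_norm_sub_tendsto_zero]
    have h7 := h4.sqrt
    simpa [Real.sqrt_sq] using h7
  exact mem_closure_of_tendsto (hlim1.prodMk_nhds hlim3)
    (Eventually.of_forall fun n => ⟨hv n, (ha n).2⟩)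

theorem IsSqrt.domain_le {S A S' B : E →ₗ.[ℂ] E} (h : IsSqrt S A) (h' : IsSqrt S' B)
    {D : Submodule ℂ E} (hD : GraphCore A D) (hDA : D ≤ A.domain) (hDB : D ≤ B.domain)
    {K : ℝ} (hK0 : 0 ≤ K)
    (hK : ∀ x y z : E, x ∈ D → (x, y) ∈ A.graph → (x, z) ∈ B.graph →
      (inner ℂ x z).re ≤ K * ((inner ℂ x y).re + ‖x‖ ^ 2)) :
    S.domain ≤ S'.domain := by
  intro x hx
  have hDS' : D ≤ S'.domain := by
    intro x hx
    obtain ⟨z, hz⟩ := LinearPMap.mem_domain_iff.1 (hDB hx)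
    obtain ⟨w, hw, -⟩ := h'.exists_graph hz
    exact LinearPMap.mem_domain_of_mem_graph hw
  obtain ⟨z, hz⟩ := mem_closure_graph_of_core (h.graphCore hD) hDS' (K := √K) (by
    intro x v w hx hv hw
    obtain ⟨y, hy⟩ := LinearPMap.mem_domain_iff.1 (hDA hx)
    obtain ⟨z, hz⟩ := LinearPMap.mem_domain_iff.1 (hDB hx)
    have h1 := hK x y z hx hy hz
    rw [← h.norm_sq hy hv, ← h'.norm_sq hz hw] at h1
    refine abs_le_of_sq_le_sq' ?_ (by positivity) |>.2
    rw [mul_pow, Real.sq_sqrt hK0]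
    refine h1.trans ?_
    gcongr
    nlinarith [mul_nonneg (norm_nonneg x) (norm_nonneg v)]) hx
  have : (x, z) ∈ closure (S'.graph : Set (E × E)) := closure_mono (fun q hq => hq.1) hz
  rw [IsClosed.closure_eq h'.1.isClosed] at this
  exact LinearPMap.mem_domain_of_mem_graph this

theorem isSelfAdjoint_addConst {A : E →ₗ.[ℂ] E} (hA : IsSelfAdjoint A) (M : ℝ) :
    IsSelfAdjoint (addConst A M) := by
  have hs := hA.symmGraph
  refine isSelfAdjoint_of_graph (A := addConst A M) hA.dense_domain ?_ ?_
  · rintro ⟨x, z⟩ hp ⟨x', z'⟩ hp'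
    obtain ⟨y, hy, rfl⟩ := mem_addConst_graph.1 hp
    obtain ⟨y', hy', rfl⟩ := mem_addConst_graph.1 hp'
    have := hs _ hy _ hy'
    simp only at this
    simp only [inner_add_left, inner_add_right, inner_smul_left, inner_smul_right, this,
      Complex.conj_ofReal]
  · intro y z hyz
    refine mem_addConst_graph.2 ⟨z - (M : ℂ) • y, ?_, by abel⟩
    rw [hA.mem_graph_iff]
    rintro ⟨a, b⟩ hab
    have := hyz _ (mem_addConst_graph.2 ⟨b, hab, rfl⟩)
    simp only [inner_add_left, inner_smul_left, Complex.conj_ofReal] at this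
    simp only [inner_sub_right, inner_smul_right]
    linear_combination this

end Perturbation

/-! ### Quadratic perturbations: the abstract argument -/

section Model

open Filter Topology

variable {E : Type*} [NormedAddCommGroup E] [InnerProductSpace ℂ E]

namespace FieldBounds

theorem re_le_mul (x y : E) : (inner ℂ x y).re ≤ ‖x‖ * ‖y‖ :=
  (Complex.re_le_norm _).trans (norm_inner_le_norm _ _)

theorem norm_le_add {r d : ℝ} {x y u : E} (hd : 0 ≤ d)
    (hu : ‖u‖ ^ 2 ≤ 2 * r ^ 2 * (inner ℂ x y).re + d * ‖x‖ ^ 2) {δ : ℝ} (hδ : 0 < δ) :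
    ‖u‖ ≤ δ * ‖y‖ + (r ^ 2 / δ + d + 1) * ‖x‖ := by
  refine abs_le_of_sq_le_sq' ?_ (by positivity) |>.2
  have h1 : 2 * r ^ 2 * (inner ℂ x y).re ≤ 2 * r ^ 2 * (‖x‖ * ‖y‖) := by
    gcongr
    exact re_le_mul x y
  have h2 : δ * (r ^ 2 / δ) = r ^ 2 := mul_div_cancel₀ _ hδ.ne'
  have h3 : 0 ≤ r ^ 2 / δ := by positivity
  have h4 : (δ * ‖y‖ + (r ^ 2 / δ + d + 1) * ‖x‖) ^ 2 = (δ * ‖y‖) ^ 2 +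
      2 * (δ * (r ^ 2 / δ)) * (‖x‖ * ‖y‖) + 2 * δ * (d + 1) * (‖x‖ * ‖y‖) +
      (r ^ 2 / δ + d + 1) ^ 2 * ‖x‖ ^ 2 := by ring
  rw [h4, h2]
  have h5 : d * ‖x‖ ^ 2 ≤ (r ^ 2 / δ + d + 1) ^ 2 * ‖x‖ ^ 2 := by
    gcongr
    nlinarith
  have h6 : 0 ≤ 2 * δ * (d + 1) * (‖x‖ * ‖y‖) := by positivity
  nlinarith [sq_nonneg (δ * ‖y‖)]

/-- The operator `N + (λ / 2) P² + η Q` with its natural domain. -/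
def total (N P Q : E →ₗ.[ℂ] E) (eta lam : ℝ) : E →ₗ.[ℂ] E :=
  N + ((lam / 2 : ℝ) : ℂ) • opMul P P + ((eta : ℝ) : ℂ) • Q

theorem mem_total_graph {N P Q : E →ₗ.[ℂ] E} {eta lam : ℝ} {x z : E} :
    (x, z) ∈ (total N P Q eta lam).graph ↔ ∃ y u v t, (x, y) ∈ N.graph ∧ (x, u) ∈ P.graph ∧
      (u, v) ∈ P.graph ∧ (x, t) ∈ Q.graph ∧
      z = y + ((lam / 2 : ℝ) : ℂ) • v + ((eta : ℝ) : ℂ) • t := by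
  unfold total
  constructor
  · intro h
    obtain ⟨a, c, ha, hc, rfl⟩ := mem_add_graph.1 h
    obtain ⟨t, ht, rfl⟩ := mem_smul_graph.1 hc
    obtain ⟨y, d, hy, hd, rfl⟩ := mem_add_graph.1 ha
    obtain ⟨v, hv, rfl⟩ := mem_smul_graph.1 hd
    obtain ⟨u, hu, huv⟩ := mem_opMul_graph.1 hv
    exact ⟨y, u, v, t, hy, hu, huv, ht, rfl⟩
  · rintro ⟨y, u, v, t, hy, hu, hv, ht, rfl⟩
    exact mem_add_graph.2 ⟨_, _, mem_add_graph.2 ⟨_, _, hy, mem_smul_graph.2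
      ⟨_, mem_opMul_graph.2 ⟨_, hu, hv⟩, rfl⟩, rfl⟩, mem_smul_graph.2 ⟨_, ht, rfl⟩, rfl⟩

end FieldBounds

variable [CompleteSpace E]

/-- The operator bounds, on a core `D` of a non-negative self-adjoint operator `N`, for symmetric
operators `P` and `Q` on which the analysis of `N + (λ / 2) P² + η Q` rests. -/
structure FieldBounds (N P Q : E →ₗ.[ℂ] E) (D : Submodule ℂ E) (s b q s' b' C : ℝ) : Prop where
  selfAdjoint : IsSelfAdjoint N
  nonneg : IsNonneg N
  core : GraphCore N D
  le_domain : D ≤ N.domain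
  isClosed_left : P.IsClosed
  isClosed_right : Q.IsClosed
  symm_left : SymmGraph P.graph
  symm_right : SymmGraph Q.graph
  b_nonneg : 0 ≤ b
  q_nonneg : 0 ≤ q
  b'_nonneg : 0 ≤ b'
  C_nonneg : 0 ≤ C
  maps_left : ∀ x ∈ D, ∃ u ∈ D, (x, u) ∈ P.graph
  le_domain_right : D ≤ Q.domain
  norm_left : ∀ x y u, x ∈ D → (x, y) ∈ N.graph → (x, u) ∈ P.graph →
    ‖u‖ ^ 2 ≤ 2 * s ^ 2 * (inner ℂ x y).re + b * ‖x‖ ^ 2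
  norm_right : ∀ x y u, x ∈ D → (x, y) ∈ N.graph → (x, u) ∈ Q.graph →
    ‖u‖ ^ 2 ≤ 2 * s' ^ 2 * (inner ℂ x y).re + b' * ‖x‖ ^ 2
  double_commutator : ∀ x y u v w, x ∈ D → (x, y) ∈ N.graph → (x, u) ∈ P.graph →
    (u, v) ∈ P.graph → (u, w) ∈ N.graph →
    (inner ℂ u w).re = (inner ℂ v y).re + q / 2 * ‖x‖ ^ 2
  commutator_left : ∀ x y u v, x ∈ D → (x, y) ∈ N.graph → (x, u) ∈ P.graph →
    (u, v) ∈ P.graph → |(inner ℂ y v).im| ≤ C * ((inner ℂ x y).re + ‖x‖ ^ 2)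

theorem le_of_sq_le_mul_add {X a c : ℝ} (ha : 0 ≤ a) (hc : 0 ≤ c)
    (h : X ^ 2 ≤ X * a + c ^ 2) : X ≤ a + c := by
  by_contra hlt
  push Not at hlt
  nlinarith [mul_pos (show 0 < X - a - c by linarith) (show 0 < X by linarith)]

namespace FieldBounds

variable {N P Q : E →ₗ.[ℂ] E} {D : Submodule ℂ E} {s b q s' b' C : ℝ}

theorem norm_sq_left (h : FieldBounds N P Q D s b q s' b' C) {x y u v : E} (hx : x ∈ D)
    (hy : (x, y) ∈ N.graph) (hu : (x, u) ∈ P.graph) (hv : (u, v) ∈ P.graph) :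
    ‖v‖ ≤ 2 * s ^ 2 * ‖y‖ + (b + |s| * √q) * ‖x‖ := by
  obtain ⟨u', hu', hm⟩ := h.maps_left x hx
  obtain rfl := P.mem_graph_snd_inj hu hm rfl
  obtain ⟨w, hw⟩ := LinearPMap.mem_domain_iff.1 (h.le_domain hu')
  have h1 := h.norm_left u w v hu' hw hv
  have h2 := h.double_commutator x y u v w hx hy hu hv hw
  have h3 : ‖u‖ ^ 2 ≤ ‖x‖ * ‖v‖ := by
    have h4 := h.symm_left _ hu _ hv
    simp only at h4
    have h5 : ‖u‖ ^ 2 = (inner ℂ u u).re := (inner_self_eq_norm_sq (𝕜 := ℂ) u).symm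
    rw [h5, h4]
    exact re_le_mul x v
  have h6 : (inner ℂ v y).re ≤ ‖v‖ * ‖y‖ := re_le_mul v y
  have hb := h.b_nonneg
  have hq := h.q_nonneg
  have h7 : ‖v‖ ≤ (2 * s ^ 2 * ‖y‖ + b * ‖x‖) + |s| * √q * ‖x‖ := by
    refine le_of_sq_le_mul_add (by positivity) (by positivity) ?_
    rw [mul_pow, mul_pow, sq_abs, Real.sq_sqrt hq]
    have h8 : b * ‖u‖ ^ 2 ≤ b * (‖x‖ * ‖v‖) := by gcongr
    have h9 : 2 * s ^ 2 * (inner ℂ v y).re ≤ 2 * s ^ 2 * (‖v‖ * ‖y‖) := by gcongr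
    rw [h2] at h1
    nlinarith
  linarith

/-- The relation `((x, N x), (P x, P² x, Q x))` on the core. -/
def relation (N P Q : E →ₗ.[ℂ] E) (D : Submodule ℂ E) : Submodule ℂ ((E × E) × (E × E × E)) where
  carrier := {p | p.1.1 ∈ D ∧ p.1 ∈ N.graph ∧ (p.1.1, p.2.1) ∈ P.graph ∧
    (p.2.1, p.2.2.1) ∈ P.graph ∧ (p.1.1, p.2.2.2) ∈ Q.graph}
  add_mem' hp hq := ⟨D.add_mem hp.1 hq.1, N.graph.add_mem hp.2.1 hq.2.1,
    P.graph.add_mem hp.2.2.1 hq.2.2.1, P.graph.add_mem hp.2.2.2.1 hq.2.2.2.1,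
    Q.graph.add_mem hp.2.2.2.2 hq.2.2.2.2⟩
  zero_mem' := ⟨D.zero_mem, N.graph.zero_mem, P.graph.zero_mem, P.graph.zero_mem,
    Q.graph.zero_mem⟩
  smul_mem' c _ hp := ⟨D.smul_mem c hp.1, N.graph.smul_mem c hp.2.1,
    P.graph.smul_mem c hp.2.2.1, P.graph.smul_mem c hp.2.2.2.1, Q.graph.smul_mem c hp.2.2.2.2⟩

theorem exists_mem_closure (h : FieldBounds N P Q D s b q s' b' C) {x y : E}
    (hxy : (x, y) ∈ N.graph) :
    ∃ u v t, (x, u) ∈ P.graph ∧ (u, v) ∈ P.graph ∧ (x, t) ∈ Q.graph ∧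
      ((x, y), (u, v, t)) ∈ closure (relation N P Q D : Set ((E × E) × (E × E × E))) := by
  have hb := h.b_nonneg
  have hb' := h.b'_nonneg
  set K : ℝ := (1 + (s ^ 2 / 1 + b + 1)) + (2 * s ^ 2 + (b + |s| * √q)) +
    (1 + (s' ^ 2 / 1 + b' + 1)) with hK
  have hex : ∃ w : E × E × E,
      ((x, y), w) ∈ closure (relation N P Q D : Set ((E × E) × (E × E × E))) := by
    refine exists_mem_closure_of_bound (relation N P Q D) (K := K) ?_ ?_
    · rintro ⟨⟨x, y⟩, u, v, t⟩ ⟨hx, hy, hu, hv, ht⟩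
      simp only at hx hy hu hv ht
      have e1 : ‖x‖ ≤ ‖(x, y)‖ := norm_fst_le (x, y)
      have e2 : ‖y‖ ≤ ‖(x, y)‖ := norm_snd_le (x, y)
      have f1 := norm_le_add hb (h.norm_left x y u hx hy hu) one_pos
      have f2 := h.norm_sq_left hx hy hu hv
      have f3 := norm_le_add hb' (h.norm_right x y t hx hy ht) one_pos
      have g1 : ‖u‖ ≤ (1 + (s ^ 2 / 1 + b + 1)) * ‖(x, y)‖ := by
        exact f1.trans ((add_le_add (mul_le_mul_of_nonneg_left e2 (by positivity))
          (mul_le_mul_of_nonneg_left e1 (by positivity))).trans_eq (add_mul _ _ _).symm)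
      have g2 : ‖v‖ ≤ (2 * s ^ 2 + (b + |s| * √q)) * ‖(x, y)‖ := by
        exact f2.trans ((add_le_add (mul_le_mul_of_nonneg_left e2 (by positivity))
          (mul_le_mul_of_nonneg_left e1 (by positivity))).trans_eq (add_mul _ _ _).symm)
      have g3 : ‖t‖ ≤ (1 + (s' ^ 2 / 1 + b' + 1)) * ‖(x, y)‖ := by
        exact f3.trans ((add_le_add (mul_le_mul_of_nonneg_left e2 (by positivity))
          (mul_le_mul_of_nonneg_left e1 (by positivity))).trans_eq (add_mul _ _ _).symm)
      have k1 : 0 ≤ (1 + (s ^ 2 / 1 + b + 1)) * ‖(x, y)‖ := by positivity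
      have k2 : 0 ≤ (2 * s ^ 2 + (b + |s| * √q)) * ‖(x, y)‖ := by positivity
      have k3 : 0 ≤ (1 + (s' ^ 2 / 1 + b' + 1)) * ‖(x, y)‖ := by positivity
      change max ‖u‖ (max ‖v‖ ‖t‖) ≤ K * ‖(x, y)‖
      rw [hK, add_mul, add_mul]
      refine max_le ?_ (max_le ?_ ?_) <;> linarith
    · refine closure_mono ?_ (h.core _ hxy)
      rintro ⟨x, y⟩ ⟨hq1, hq2⟩
      obtain ⟨u, hu, hxu⟩ := h.maps_left x hq2
      obtain ⟨v, -, huv⟩ := h.maps_left u hu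
      obtain ⟨t, ht⟩ := LinearPMap.mem_domain_iff.1 (h.le_domain_right hq2)
      exact ⟨((x, y), (u, v, t)), ⟨hq2, hq1, hxu, huv, ht⟩, rfl⟩
  obtain ⟨⟨u, v, t⟩, hw⟩ := hex
  have hPc : closure (P.graph : Set (E × E)) = P.graph := IsClosed.closure_eq h.isClosed_left
  have hQc : closure (Q.graph : Set (E × E)) = Q.graph := IsClosed.closure_eq h.isClosed_right
  have m1 : (x, u) ∈ closure (P.graph : Set (E × E)) :=
    map_mem_closure (f := fun p : (E × E) × (E × E × E) => (p.1.1, p.2.1)) (by fun_prop) hw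
      fun p hp => hp.2.2.1
  have m2 : (u, v) ∈ closure (P.graph : Set (E × E)) :=
    map_mem_closure (f := fun p : (E × E) × (E × E × E) => (p.2.1, p.2.2.1)) (by fun_prop) hw
      fun p hp => hp.2.2.2.1
  have m3 : (x, t) ∈ closure (Q.graph : Set (E × E)) :=
    map_mem_closure (f := fun p : (E × E) × (E × E × E) => (p.1.1, p.2.2.2)) (by fun_prop) hw
      fun p hp => hp.2.2.2.2
  rw [hPc] at m1 m2
  rw [hQc] at m3
  exact ⟨u, v, t, m1, m2, m3, hw⟩

/-- Closed conditions pass from the core to the whole domain of `N`. -/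
theorem of_core (h : FieldBounds N P Q D s b q s' b' C)
    {p : (E × E) × (E × E × E) → Prop} (hp : IsClosed {z | p z})
    (hD : ∀ x y u v t, x ∈ D → (x, y) ∈ N.graph → (x, u) ∈ P.graph → (u, v) ∈ P.graph →
      (x, t) ∈ Q.graph → p ((x, y), (u, v, t)))
    {x y u v t : E} (hy : (x, y) ∈ N.graph) (hu : (x, u) ∈ P.graph) (hv : (u, v) ∈ P.graph)
    (ht : (x, t) ∈ Q.graph) : p ((x, y), (u, v, t)) := by
  obtain ⟨u', v', t', hu', hv', ht', hc⟩ := h.exists_mem_closure hy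
  obtain rfl := P.mem_graph_snd_inj hu hu' rfl
  obtain rfl := P.mem_graph_snd_inj hv hv' rfl
  obtain rfl := Q.mem_graph_snd_inj ht ht' rfl
  exact closure_minimal (t := {z | p z})
    (fun z hz => hD _ _ _ _ _ hz.1 hz.2.1 hz.2.2.1 hz.2.2.2.1 hz.2.2.2.2) hp hc

section Domain

variable {x y u v t : E}

theorem domain_norm_sq_left (h : FieldBounds N P Q D s b q s' b' C) (hy : (x, y) ∈ N.graph)
    (hu : (x, u) ∈ P.graph) (hv : (u, v) ∈ P.graph) (ht : (x, t) ∈ Q.graph) :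
    ‖v‖ ≤ 2 * s ^ 2 * ‖y‖ + (b + |s| * √q) * ‖x‖ :=
  h.of_core (p := fun z => ‖z.2.2.1‖ ≤ 2 * s ^ 2 * ‖z.1.2‖ + (b + |s| * √q) * ‖z.1.1‖)
    (isClosed_le (by fun_prop) (by fun_prop))
    (fun _ _ _ _ _ hx hy hu hv _ => h.norm_sq_left hx hy hu hv) hy hu hv ht

theorem domain_norm_left (h : FieldBounds N P Q D s b q s' b' C) (hy : (x, y) ∈ N.graph)
    (hu : (x, u) ∈ P.graph) (hv : (u, v) ∈ P.graph) (ht : (x, t) ∈ Q.graph) :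
    ‖u‖ ^ 2 ≤ 2 * s ^ 2 * (inner ℂ x y).re + b * ‖x‖ ^ 2 :=
  h.of_core (p := fun z => ‖z.2.1‖ ^ 2 ≤ 2 * s ^ 2 * (inner ℂ z.1.1 z.1.2).re + b * ‖z.1.1‖ ^ 2)
    (isClosed_le (by fun_prop) (((Complex.continuous_re.comp (by fun_prop)).const_mul _).add
      (by fun_prop)))
    (fun _ _ _ _ _ hx hy hu _ _ => h.norm_left _ _ _ hx hy hu) hy hu hv ht

theorem domain_norm_right (h : FieldBounds N P Q D s b q s' b' C) (hy : (x, y) ∈ N.graph)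
    (hu : (x, u) ∈ P.graph) (hv : (u, v) ∈ P.graph) (ht : (x, t) ∈ Q.graph) :
    ‖t‖ ^ 2 ≤ 2 * s' ^ 2 * (inner ℂ x y).re + b' * ‖x‖ ^ 2 :=
  h.of_core (p := fun z => ‖z.2.2.2‖ ^ 2 ≤
      2 * s' ^ 2 * (inner ℂ z.1.1 z.1.2).re + b' * ‖z.1.1‖ ^ 2)
    (isClosed_le (by fun_prop) (((Complex.continuous_re.comp (by fun_prop)).const_mul _).add
      (by fun_prop)))
    (fun _ _ _ _ _ hx hy _ _ ht => h.norm_right _ _ _ hx hy ht) hy hu hv ht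

theorem domain_commutator_left (h : FieldBounds N P Q D s b q s' b' C) (hy : (x, y) ∈ N.graph)
    (hu : (x, u) ∈ P.graph) (hv : (u, v) ∈ P.graph) (ht : (x, t) ∈ Q.graph) :
    |(inner ℂ y v).im| ≤ C * ((inner ℂ x y).re + ‖x‖ ^ 2) :=
  h.of_core (p := fun z => |(inner ℂ z.1.2 z.2.2.1).im| ≤
      C * ((inner ℂ z.1.1 z.1.2).re + ‖z.1.1‖ ^ 2))
    (isClosed_le (Complex.continuous_im.comp (by fun_prop)).abs
      (((Complex.continuous_re.comp (by fun_prop)).add (by fun_prop)).const_mul _))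
    (fun _ _ _ _ _ hx hy hu hv _ => h.commutator_left _ _ _ _ hx hy hu hv) hy hu hv ht

theorem domain_commutator_right (h : FieldBounds N P Q D s b q s' b' C) {C' : ℝ}
    (hC : ∀ x y t, x ∈ D → (x, y) ∈ N.graph → (x, t) ∈ Q.graph →
      |(inner ℂ y t).im| ≤ C' * ((inner ℂ x y).re + ‖x‖ ^ 2))
    (hy : (x, y) ∈ N.graph)
    (hu : (x, u) ∈ P.graph) (hv : (u, v) ∈ P.graph) (ht : (x, t) ∈ Q.graph) :
    |(inner ℂ y t).im| ≤ C' * ((inner ℂ x y).re + ‖x‖ ^ 2) :=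
  h.of_core (p := fun z => |(inner ℂ z.1.2 z.2.2.2).im| ≤
      C' * ((inner ℂ z.1.1 z.1.2).re + ‖z.1.1‖ ^ 2))
    (isClosed_le (Complex.continuous_im.comp (by fun_prop)).abs
      (((Complex.continuous_re.comp (by fun_prop)).add (by fun_prop)).const_mul _))
    (fun _ _ _ _ _ hx hy _ _ ht => hC _ _ _ hx hy ht) hy hu hv ht

theorem domain_re_inner (h : FieldBounds N P Q D s b q s' b' C) (hy : (x, y) ∈ N.graph)
    (hu : (x, u) ∈ P.graph) (hv : (u, v) ∈ P.graph) (ht : (x, t) ∈ Q.graph) :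
    -(q / 2 * ‖x‖ ^ 2) ≤ (inner ℂ v y).re :=
  h.of_core (p := fun z => -(q / 2 * ‖z.1.1‖ ^ 2) ≤ (inner ℂ z.2.2.1 z.1.2).re)
    (isClosed_le (by fun_prop) (Complex.continuous_re.comp (by fun_prop)))
    (fun x y u v _ hx hy hu hv _ => by
      obtain ⟨u', hu', hm⟩ := h.maps_left x hx
      obtain rfl := P.mem_graph_snd_inj hu hm rfl
      obtain ⟨w, hw⟩ := LinearPMap.mem_domain_iff.1 (h.le_domain hu')
      have h1 := h.double_commutator x y u v w hx hy hu hv hw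
      have h2 := h.nonneg.re_inner_nonneg hw
      simp only at h2 ⊢
      linarith) hy hu hv ht

end Domain

theorem total_domain (h : FieldBounds N P Q D s b q s' b' C) (eta lam : ℝ) :
    (total N P Q eta lam).domain = N.domain := by
  refine le_antisymm (fun x hx => hx.1.1) fun x hx => ?_
  obtain ⟨y, hy⟩ := LinearPMap.mem_domain_iff.1 hx
  obtain ⟨u, v, t, hu, hv, ht, -⟩ := h.exists_mem_closure hy
  exact LinearPMap.mem_domain_of_mem_graph (mem_total_graph.2 ⟨y, u, v, t, hy, hu, hv, ht, rfl⟩)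

theorem total_symm (h : FieldBounds N P Q D s b q s' b' C) (eta lam : ℝ) :
    SymmGraph (total N P Q eta lam).graph := by
  rintro ⟨x, z⟩ hp ⟨x', z'⟩ hp'
  obtain ⟨y, u, v, t, hy, hu, hv, ht, rfl⟩ := mem_total_graph.1 hp
  obtain ⟨y', u', v', t', hy', hu', hv', ht', rfl⟩ := mem_total_graph.1 hp'
  have h1 := h.selfAdjoint.symmGraph _ hy _ hy'
  have h2 := h.symm_left _ hv _ hu'
  have h3 := h.symm_left _ hu _ hv'
  have h4 := h.symm_right _ ht _ ht'
  simp only at h1 h2 h3 h4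
  simp only [inner_add_left, inner_add_right, inner_smul_left, inner_smul_right,
    Complex.conj_ofReal, h1, h2, h3, h4]

theorem total_isClosable (h : FieldBounds N P Q D s b q s' b' C) (eta lam : ℝ) :
    (total N P Q eta lam).IsClosable :=
  (h.total_symm eta lam).isClosable (by rw [h.total_domain]; exact h.selfAdjoint.dense_domain)

theorem norm_perturbation_le (h : FieldBounds N P Q D s b q s' b' C) (eta lam : ℝ) {δ : ℝ}
    (hδ : 0 < δ) : ∃ c : ℝ, 0 ≤ c ∧ ∀ x y z : E, (x, y) ∈ N.graph →
      (x, z) ∈ (total N P Q eta lam).graph → ‖z - y‖ ≤ (|lam| * s ^ 2 + δ) * ‖y‖ + c * ‖x‖ := by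
  have hb := h.b_nonneg
  have hb' := h.b'_nonneg
  set ε := δ / (|eta| + 1) with hε
  have hε0 : 0 < ε := by positivity
  refine ⟨|lam| / 2 * (b + |s| * √q) + |eta| * (s' ^ 2 / ε + b' + 1), by positivity, ?_⟩
  intro x y z hy hz
  obtain ⟨y', u, v, t, hy', hu, hv, ht, rfl⟩ := mem_total_graph.1 hz
  obtain rfl := N.mem_graph_snd_inj hy hy' rfl
  have h1 := h.domain_norm_sq_left hy hu hv ht
  have h2 := norm_le_add hb' (h.domain_norm_right hy hu hv ht) hε0
  have e : y + ((lam / 2 : ℝ) : ℂ) • v + ((eta : ℝ) : ℂ) • t - y =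
      ((lam / 2 : ℝ) : ℂ) • v + ((eta : ℝ) : ℂ) • t := by abel
  rw [e]
  refine (norm_add_le _ _).trans ?_
  rw [norm_smul, norm_smul, Complex.norm_real, Complex.norm_real, Real.norm_eq_abs,
    Real.norm_eq_abs, abs_div, abs_two]
  have h3 : |lam| / 2 * ‖v‖ ≤ |lam| / 2 * (2 * s ^ 2 * ‖y‖ + (b + |s| * √q) * ‖x‖) := by gcongr
  have h4 : |eta| * ‖t‖ ≤ |eta| * (ε * ‖y‖ + (s' ^ 2 / ε + b' + 1) * ‖x‖) := by gcongr
  have h5 : |eta| * ε ≤ δ := by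
    rw [hε, ← mul_div_assoc, div_le_iff₀ (by positivity)]
    nlinarith [abs_nonneg eta]
  have h6 : |eta| * ε * ‖y‖ ≤ δ * ‖y‖ := by gcongr
  nlinarith

theorem total_relBound (h : FieldBounds N P Q D s b q s' b' C) (eta lam : ℝ) :
    ∃ K : ℝ, ∀ x y z : E, (x, y) ∈ N.graph →
      (x, z) ∈ (total N P Q eta lam).graph → ‖z‖ ≤ K * (‖x‖ + ‖y‖) := by
  obtain ⟨c, hc, hbd⟩ := h.norm_perturbation_le eta lam one_pos
  refine ⟨(|lam| * s ^ 2 + 2) + c, fun x y z hy hz => ?_⟩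
  have h1 := hbd x y z hy hz
  have h2 : ‖z‖ ≤ ‖z - y‖ + ‖y‖ := by
    have := norm_add_le (z - y) y
    rwa [sub_add_cancel] at this
  have h3 : 0 ≤ (|lam| * s ^ 2 + 2) * ‖x‖ := by positivity
  have h4 : 0 ≤ c * ‖y‖ := by positivity
  nlinarith

theorem essentiallySelfAdjointOn (h : FieldBounds N P Q D s b q s' b' C) {eta lam : ℝ}
    (hsa : IsSelfAdjoint (total N P Q eta lam).closure) {D' : Submodule ℂ E}
    (hD' : N.HasCore D') : IsEssentiallySelfAdjointOn (total N P Q eta lam) D' := by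
  have hle : D' ≤ N.domain := hD'.le_domain
  refine ⟨by rwa [h.total_domain], ?_⟩
  obtain ⟨K, hK⟩ := h.total_relBound eta lam
  rw [closure_domRestrict_of_graphCore (h.total_isClosable eta lam)
    (graphCore_of_relBound (h.total_isClosable eta lam)
      (hasCore_graphCore h.selfAdjoint.isClosed.isClosable hD') (h.total_domain eta lam) hle hK)]
  exact hsa

theorem closure_isSelfAdjoint_of_small (h : FieldBounds N P Q D s b q s' b' C) (eta : ℝ) {lam : ℝ}
    (hlam : |lam| * s ^ 2 < 1) : IsSelfAdjoint (total N P Q eta lam).closure := by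
  obtain ⟨c, hc, hbd⟩ := h.norm_perturbation_le eta lam (δ := (1 - |lam| * s ^ 2) / 2) (by linarith)
  refine isSelfAdjoint_closure_of_relBound h.selfAdjoint (h.total_symm eta lam)
    (h.total_domain eta lam) (by nlinarith [mul_nonneg (abs_nonneg lam) (sq_nonneg s)]) hc (by linarith) hbd

theorem isSelfAdjoint_of_small (h : FieldBounds N P Q D s b q s' b' C) (eta : ℝ) {lam : ℝ}
    (hlam : |lam| * s ^ 2 < 1) : IsSelfAdjoint (total N P Q eta lam) := by
  refine isSelfAdjoint_closure_of_isClosed (h.closure_isSelfAdjoint_of_small eta hlam) ?_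
  obtain ⟨c, hc, hbd⟩ := h.norm_perturbation_le eta lam (δ := (1 - |lam| * s ^ 2) / 2) (by linarith)
  set a := |lam| * s ^ 2 + (1 - |lam| * s ^ 2) / 2 with ha
  have ha1 : 0 < 1 - a := by linarith
  refine isClosed_of_relBound h.selfAdjoint.isClosed (h.total_isClosable eta lam)
    (h.total_domain eta lam) (K := (1 + c) / (1 - a)) fun x y z hy hz => ?_
  have h1 := hbd x y z hy hz
  have h2 : ‖y‖ ≤ ‖z - y‖ + ‖z‖ := by
    have := norm_sub_le z (z - y)
    rw [sub_sub_cancel] at this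
    linarith
  rw [div_mul_eq_mul_div, le_div_iff₀ ha1]
  have h3 : 0 ≤ c * ‖z‖ := by positivity
  nlinarith [norm_nonneg x]

theorem closure_isSelfAdjoint (h : FieldBounds N P Q D s b q s' b' C) {C' : ℝ} (hC0 : 0 ≤ C')
    (hC : ∀ x y t, x ∈ D → (x, y) ∈ N.graph → (x, t) ∈ Q.graph →
      |(inner ℂ y t).im| ≤ C' * ((inner ℂ x y).re + ‖x‖ ^ 2)) (eta lam : ℝ) :
    IsSelfAdjoint (total N P Q eta lam).closure := by
  have hC1 := h.C_nonneg
  refine isSelfAdjoint_closure_of_commutator h.selfAdjoint h.nonneg (h.total_symm eta lam)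
    (h.total_domain eta lam) (K := |lam / 2| * C + |eta| * C') (by positivity) ?_
  intro x y z hy hz
  obtain ⟨y', u, v, t, hy', hu, hv, ht, rfl⟩ := mem_total_graph.1 hz
  obtain rfl := N.mem_graph_snd_inj hy hy' rfl
  have h1 := h.domain_commutator_left hy hu hv ht
  have h2 := h.domain_commutator_right hC hy hu hv ht
  have e : (inner ℂ y (y + ((lam / 2 : ℝ) : ℂ) • v + ((eta : ℝ) : ℂ) • t)).im =
      lam / 2 * (inner ℂ y v).im + eta * (inner ℂ y t).im := by
    rw [inner_add_right, inner_add_right, inner_smul_right, inner_smul_right, Complex.add_im,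
      Complex.add_im, Complex.im_ofReal_mul, Complex.im_ofReal_mul]
    have : (inner ℂ y y).im = 0 := inner_self_im (𝕜 := ℂ) y
    rw [this, zero_add]
  rw [e]
  refine (abs_add_le _ _).trans ?_
  rw [abs_mul, abs_mul, add_mul, mul_assoc, mul_assoc]
  gcongr

theorem isSelfAdjoint_of_nonneg (h : FieldBounds N P Q D s b q s' b' C) {eta lam : ℝ}
    (hlam : 0 ≤ lam) (hsa : IsSelfAdjoint (total N P Q eta lam).closure) :
    IsSelfAdjoint (total N P Q eta lam) := by
  refine isSelfAdjoint_closure_of_isClosed hsa ?_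
  have hb' := h.b'_nonneg
  have hq := h.q_nonneg
  set ε := 1 / (2 * (|eta| + 1)) with hε
  have hε0 : 0 < ε := by positivity
  set c := s' ^ 2 / ε + b' + 1 with hc
  have hc0 : 0 ≤ c := by positivity
  refine isClosed_of_relBound h.selfAdjoint.isClosed (h.total_isClosable eta lam)
    (h.total_domain eta lam) (K := 2 + 2 * (|eta| * c) + 2 * √(lam / 2 * q)) fun x y z hy hz => ?_
  obtain ⟨y', u, v, t, hy', hu, hv, ht, hz'⟩ := mem_total_graph.1 hz
  obtain rfl := N.mem_graph_snd_inj hy hy' rfl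
  have h1 := h.domain_re_inner hy hu hv ht
  have h2 := norm_le_add hb' (h.domain_norm_right hy hu hv ht) hε0
  set w := y + ((lam / 2 : ℝ) : ℂ) • v with hw
  have h3 : ‖w‖ ^ 2 = ‖y‖ ^ 2 + lam * (inner ℂ v y).re + (lam / 2) ^ 2 * ‖v‖ ^ 2 := by
    rw [hw, @norm_add_sq ℂ, inner_smul_right, norm_smul]
    have : (inner ℂ y v).re = (inner ℂ v y).re := inner_re_symm (𝕜 := ℂ) y v
    have e2 : RCLike.re (((lam / 2 : ℝ) : ℂ) * inner ℂ y v) = lam / 2 * (inner ℂ v y).re := by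
      rw [← this]
      exact Complex.re_ofReal_mul _ _
    rw [e2, mul_pow, Complex.norm_real, Real.norm_eq_abs, sq_abs]
    ring
  have h4 : ‖y‖ ≤ ‖w‖ + √(lam / 2 * q) * ‖x‖ := by
    refine abs_le_of_sq_le_sq' ?_ (by positivity) |>.2
    have e1 : (√(lam / 2 * q) * ‖x‖) ^ 2 = lam / 2 * q * ‖x‖ ^ 2 := by
      rw [mul_pow, Real.sq_sqrt (by positivity)]
    have e2 : 0 ≤ ‖w‖ * (√(lam / 2 * q) * ‖x‖) := by positivity
    have e3 : lam * -(q / 2 * ‖x‖ ^ 2) ≤ lam * (inner ℂ v y).re := by gcongr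
    nlinarith [mul_nonneg (sq_nonneg (lam / 2)) (sq_nonneg ‖v‖)]
  have h5 : ‖w‖ ≤ ‖z‖ + |eta| * ‖t‖ := by
    have : w = z - ((eta : ℝ) : ℂ) • t := by rw [hz']; abel
    rw [this]
    refine (norm_sub_le _ _).trans ?_
    rw [norm_smul, Complex.norm_real, Real.norm_eq_abs]
  have h6 : |eta| * ‖t‖ ≤ |eta| * (ε * ‖y‖ + c * ‖x‖) := by gcongr
  have h7 : |eta| * ε ≤ 1 / 2 := by
    rw [hε, mul_one_div, div_le_div_iff₀ (by positivity) (by positivity)]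
    nlinarith [abs_nonneg eta]
  have h8 : |eta| * ε * ‖y‖ ≤ 1 / 2 * ‖y‖ := by gcongr
  have h9 : 0 ≤ (2 * (|eta| * c) + 2 * √(lam / 2 * q)) * ‖z‖ := by positivity
  nlinarith [norm_nonneg x]

theorem form_bounds (h : FieldBounds N P Q D s b q s' b' C) (eta : ℝ) {lam : ℝ}
    (hlam : -1 < lam * s ^ 2) : ∃ ε c K : ℝ, 0 < ε ∧ 0 ≤ c ∧ 0 ≤ K ∧
      ∀ x y z : E, (x, y) ∈ N.graph → (x, z) ∈ (total N P Q eta lam).graph →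
        ε * (inner ℂ x y).re - c * ‖x‖ ^ 2 ≤ (inner ℂ x z).re ∧
        (inner ℂ x z).re ≤ K * ((inner ℂ x y).re + ‖x‖ ^ 2) := by
  have hb := h.b_nonneg
  have hb' := h.b'_nonneg
  set m := min lam 0 with hm
  have hm0 : m ≤ 0 := min_le_right _ _
  have hml : m ≤ lam := min_le_left _ _
  have hms : 0 < 1 + m * s ^ 2 := by
    rcases min_choice lam 0 with h1 | h1
    · rw [hm, h1]; linarith
    · rw [hm, h1]; linarith
  set δ := (1 + m * s ^ 2) / 2 with hδ
  have hδ0 : 0 < δ := by positivity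
  set r := 2 * s' ^ 2 + 1 with hr
  have hr0 : 0 < r := by positivity
  set d := δ / r * b' + eta ^ 2 * r / (4 * δ) with hd
  have hd0 : 0 ≤ d := by positivity
  refine ⟨δ, -(m / 2 * b) + d, 1 + |lam| * s ^ 2 + |lam| / 2 * b + δ + d, hδ0, ?_, by positivity, ?_⟩
  · have : 0 ≤ -(m / 2 * b) := by nlinarith
    linarith
  intro x y z hy hz
  obtain ⟨y', u, v, t, hy', hu, hv, ht, rfl⟩ := mem_total_graph.1 hz
  obtain rfl := N.mem_graph_snd_inj hy hy' rfl
  have hF := h.nonneg.re_inner_nonneg hy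
  simp only at hF
  have h1 := h.domain_norm_left hy hu hv ht
  have h2 := h.domain_norm_right hy hu hv ht
  have e1 : (inner ℂ x v).re = ‖u‖ ^ 2 := by
    have := h.symm_left _ hu _ hv
    simp only at this
    rw [← this]
    exact inner_self_eq_norm_sq (𝕜 := ℂ) u
  have e2 : (inner ℂ x (y + ((lam / 2 : ℝ) : ℂ) • v + ((eta : ℝ) : ℂ) • t)).re =
      (inner ℂ x y).re + lam / 2 * ‖u‖ ^ 2 + eta * (inner ℂ x t).re := by
    rw [inner_add_right, inner_add_right, inner_smul_right, inner_smul_right, Complex.add_re,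
      Complex.add_re, Complex.re_ofReal_mul, Complex.re_ofReal_mul, e1]
  have h3 : |eta * (inner ℂ x t).re| ≤ δ * (inner ℂ x y).re + d * ‖x‖ ^ 2 := by
    have k1 : |eta * (inner ℂ x t).re| ≤ |eta| * (‖x‖ * ‖t‖) := by
      rw [abs_mul]
      gcongr
      exact (Complex.abs_re_le_norm _).trans (norm_inner_le_norm _ _)
    have k2 : |eta| * (‖x‖ * ‖t‖) ≤ δ / r * ‖t‖ ^ 2 + eta ^ 2 * r / (4 * δ) * ‖x‖ ^ 2 := by
      have k3 : 0 ≤ δ / r * (‖t‖ - |eta| * r / (2 * δ) * ‖x‖) ^ 2 := by positivity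
      have k4 : δ / r * (‖t‖ - |eta| * r / (2 * δ) * ‖x‖) ^ 2 =
          δ / r * ‖t‖ ^ 2 - |eta| * (‖x‖ * ‖t‖) + |eta| ^ 2 * r / (4 * δ) * ‖x‖ ^ 2 := by
        field_simp
        ring
      rw [k4, sq_abs] at k3
      linarith
    have k5 : δ / r * ‖t‖ ^ 2 ≤ δ / r * (2 * s' ^ 2 * (inner ℂ x y).re + b' * ‖x‖ ^ 2) := by
      gcongr
    have k6 : δ / r * (2 * s' ^ 2 * (inner ℂ x y).re) ≤ δ * (inner ℂ x y).re := by
      rw [div_mul_eq_mul_div, div_le_iff₀ hr0, hr]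
      nlinarith [mul_nonneg hδ0.le hF]
    rw [hd]
    nlinarith
  rw [e2]
  have h4 := abs_le.1 h3
  have hu0 : 0 ≤ ‖u‖ ^ 2 := sq_nonneg _
  constructor
  · have k1 : m / 2 * ‖u‖ ^ 2 ≤ lam / 2 * ‖u‖ ^ 2 := by gcongr
    have k2 : m / 2 * (2 * s ^ 2 * (inner ℂ x y).re + b * ‖x‖ ^ 2) ≤ m / 2 * ‖u‖ ^ 2 :=
      mul_le_mul_of_nonpos_left h1 (by linarith)
    have k3 : 2 * δ = 1 + m * s ^ 2 := by rw [hδ]; ring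
    have k4 : (inner ℂ x y).re + m / 2 * (2 * s ^ 2 * (inner ℂ x y).re) =
        2 * δ * (inner ℂ x y).re := by rw [k3]; ring
    nlinarith [h4.1]
  · have k1 : lam / 2 * ‖u‖ ^ 2 ≤ |lam| / 2 * ‖u‖ ^ 2 := by
      gcongr
      exact le_abs_self lam
    have k2 : |lam| / 2 * ‖u‖ ^ 2 ≤
        |lam| / 2 * (2 * s ^ 2 * (inner ℂ x y).re + b * ‖x‖ ^ 2) := by gcongr
    have k3 : 0 ≤ ‖x‖ ^ 2 := sq_nonneg _
    have l1 : 0 ≤ (|lam| / 2 * b + d) * (inner ℂ x y).re := by positivity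
    have l2 : 0 ≤ (1 + |lam| * s ^ 2 + δ) * ‖x‖ ^ 2 := by positivity
    nlinarith [h4.2]

theorem isBoundedBelow (h : FieldBounds N P Q D s b q s' b' C) (eta : ℝ) {lam : ℝ}
    (hlam : -1 < lam * s ^ 2) : IsBoundedBelow (total N P Q eta lam) := by
  obtain ⟨ε, c, K, hε, hc, hK, hbd⟩ := h.form_bounds eta hlam
  refine ⟨-c, isBoundedBelowBy_iff.2 ?_⟩
  rintro ⟨x, z⟩ hz
  obtain ⟨y, u, v, t, hy, hu, hv, ht, e⟩ := mem_total_graph.1 hz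
  have h1 := (hbd x y z hy hz).1
  have h2 := h.nonneg.re_inner_nonneg hy
  simp only at h2 ⊢
  have := mul_nonneg hε.le h2
  linarith

theorem isBoundedBelow_critical (h : FieldBounds N P Q D s b q s' b' C) {lam : ℝ}
    (hlam0 : lam ≤ 0) (hlam : -1 ≤ lam * s ^ 2) :
    IsBoundedBelow (N + ((lam / 2 : ℝ) : ℂ) • opMul P P) := by
  refine ⟨lam / 2 * b, isBoundedBelowBy_iff.2 ?_⟩
  rintro ⟨x, z⟩ hz
  obtain ⟨y, d, hy, hd, rfl⟩ := mem_add_graph.1 hz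
  obtain ⟨v, hv, rfl⟩ := mem_smul_graph.1 hd
  obtain ⟨u, hu, huv⟩ := mem_opMul_graph.1 hv
  obtain ⟨-, -, t, -, -, ht, -⟩ := h.exists_mem_closure hy
  have h1 := h.domain_norm_left hy hu huv ht
  have e1 : (inner ℂ x v).re = ‖u‖ ^ 2 := by
    have := h.symm_left _ hu _ huv
    simp only at this
    rw [← this]
    exact inner_self_eq_norm_sq (𝕜 := ℂ) u
  simp only
  rw [inner_add_right, inner_smul_right, Complex.add_re, Complex.re_ofReal_mul, e1]
  have h2 := h.nonneg.re_inner_nonneg hy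
  simp only at h2
  have k2 : lam / 2 * (2 * s ^ 2 * (inner ℂ x y).re + b * ‖x‖ ^ 2) ≤ lam / 2 * ‖u‖ ^ 2 :=
    mul_le_mul_of_nonpos_left h1 (by linarith)
  nlinarith

theorem opSqrt_domain_eq (h : FieldBounds N P Q D s b q s' b' C) {eta lam : ℝ}
    (hlam : -1 < lam * s ^ 2) (hsa : IsSelfAdjoint (total N P Q eta lam).closure) {M : ℝ}
    (hM : 0 ≤ M) (hM' : IsNonneg (addConst (total N P Q eta lam).closure M)) :
    (opSqrt N).domain = (opSqrt (addConst (total N P Q eta lam).closure M)).domain := by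
  obtain ⟨ε, c, K, hε, hc, hK, hbd⟩ := h.form_bounds eta hlam
  set B := addConst (total N P Q eta lam).closure M with hB
  have hBsa : IsSelfAdjoint B := isSelfAdjoint_addConst hsa M
  have hS := isSqrt_opSqrt h.selfAdjoint h.nonneg
  have hS' := isSqrt_opSqrt hBsa hM'
  have hle : (total N P Q eta lam) ≤ (total N P Q eta lam).closure := LinearPMap.le_closure _
  have hdom : N.domain ≤ B.domain := by
    rw [← h.total_domain eta lam]
    exact hle.1
  have hcoreB : GraphCore B N.domain := by
    refine graphCore_addConst (fun p hp => ?_) M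
    rw [← (h.total_isClosable eta lam).graph_closure_eq_closure_graph] at hp
    refine closure_mono ?_ hp
    intro q hq
    refine ⟨LinearPMap.le_graph_of_le hle hq, ?_⟩
    rw [← h.total_domain eta lam]
    exact LinearPMap.mem_domain_of_mem_graph (y := q.2) hq
  have hform : ∀ x y w : E, (x, y) ∈ N.graph → (x, w) ∈ B.graph →
      ∃ z, (x, z) ∈ (total N P Q eta lam).graph ∧
        (inner ℂ x w).re = (inner ℂ x z).re + M * ‖x‖ ^ 2 := by
    intro x y w hy hw
    have hx : x ∈ (total N P Q eta lam).domain := by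
      rw [h.total_domain]
      exact LinearPMap.mem_domain_of_mem_graph hy
    obtain ⟨z, hz⟩ := LinearPMap.mem_domain_iff.1 hx
    obtain ⟨z', hz', rfl⟩ := mem_addConst_graph.1 hw
    obtain rfl := LinearPMap.mem_graph_snd_inj _ hz' (LinearPMap.le_graph_of_le hle hz) rfl
    refine ⟨z', hz, ?_⟩
    rw [inner_add_right, inner_smul_right, Complex.add_re, Complex.re_ofReal_mul]
    have : (inner ℂ x x).re = ‖x‖ ^ 2 := inner_self_eq_norm_sq (𝕜 := ℂ) x
    rw [this]
    ring
  refine le_antisymm ?_ ?_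
  · refine hS.domain_le hS' (graphCore_domain N) le_rfl hdom (K := K + M) (by positivity) ?_
    intro x y w _ hy hw
    obtain ⟨z, hz, e⟩ := hform x y w hy hw
    have h1 := (hbd x y z hy hz).2
    have h2 := h.nonneg.re_inner_nonneg hy
    simp only at h2
    rw [e]
    nlinarith [mul_nonneg hM h2]
  · refine hS'.domain_le hS hcoreB hdom le_rfl (K := (1 + c) / ε) (by positivity) ?_
    intro x w y _ hw hy
    obtain ⟨z, hz, e⟩ := hform x y w hy hw
    have h1 := (hbd x y z hy hz).1
    have h2 := hM'.re_inner_nonneg hw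
    simp only at h2
    rw [div_mul_eq_mul_div, le_div_iff₀ hε]
    have h3 := mul_nonneg hM (sq_nonneg ‖x‖)
    have h4 := mul_nonneg hc h2
    nlinarith [sq_nonneg ‖x‖]

end FieldBounds

end Model

/-! ### Operators on tensor powers -/

section TensorOperators

open Filter Topology

variable {K H : Type*} [NormedAddCommGroup K] [InnerProductSpace ℂ K]
  [NormedAddCommGroup H] [InnerProductSpace ℂ H] {n : ℕ}

theorem algTensor_ext {V : Type*} [AddCommGroup V] [Module ℂ V] {φ ψ : AlgTensor H n →ₗ[ℂ] V}
    (h : ∀ x : Fin n → H, φ (algTprod x) = ψ (algTprod x)) (t : AlgTensor H n) : φ t = ψ t := by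
  induction t using algTensor_induction with
  | smul_tprod c x => rw [map_smul, map_smul, h]
  | add s t hs ht => rw [map_add, map_add, hs, ht]

/-- The canonical map from the algebraic tensor power to its completion. -/
def toHT : AlgTensor H n →L[ℂ] HTensor H n := UniformSpace.Completion.toComplL

theorem toHT_apply (t : AlgTensor H n) : toHT t = (t : HTensor H n) := rfl

theorem toHT_algTprod (x : Fin n → H) : toHT (algTprod x) = pureTensor x := rfl

theorem inner_toHT (s t : AlgTensor H n) : inner ℂ (toHT s) (toHT t) = inner ℂ s t :=
  UniformSpace.Completion.inner_coe s t

theorem norm_toHT (s : AlgTensor H n) : ‖toHT s‖ = ‖s‖ := UniformSpace.Completion.norm_coe s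

theorem denseRange_toHT : DenseRange (toHT : AlgTensor H n → HTensor H n) :=
  UniformSpace.Completion.denseRange_coe

theorem inner_pureTensor (x y : Fin n → H) :
    inner ℂ (pureTensor x) (pureTensor y) = ∏ i, inner ℂ (x i) (y i) :=
  (inner_toHT _ _).trans (inner_algTprod x y)

theorem norm_pureTensor (x : Fin n → H) : ‖pureTensor x‖ = ∏ i, ‖x i‖ := by
  have h : ‖pureTensor x‖ ^ 2 = (∏ i, ‖x i‖) ^ 2 := by
    have h1 := inner_pureTensor x x
    simp only [inner_self_eq_norm_sq_to_K] at h1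
    rw [← Finset.prod_pow]
    exact_mod_cast h1
  exact (sq_eq_sq₀ (norm_nonneg _) (Finset.prod_nonneg fun i _ => norm_nonneg _)).1 h

theorem continuous_pureTensor : Continuous (pureTensor : (Fin n → H) → HTensor H n) := by
  let f : MultilinearMap ℂ (fun _ : Fin n => H) (HTensor H n) :=
    (toHT (H := H) (n := n)).toLinearMap.compMultilinearMap algTprod
  exact (f.mkContinuous 1 fun x => by rw [one_mul]; exact (norm_pureTensor x).le).cont

/-- Continuous linear maps that agree on pure tensors are equal. -/
theorem hTensor_ext {V : Type*} [NormedAddCommGroup V] [NormedSpace ℂ V]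
    {φ ψ : HTensor H n →L[ℂ] V} (h : ∀ x : Fin n → H, φ (pureTensor x) = ψ (pureTensor x))
    (t : HTensor H n) : φ t = ψ t := by
  induction t using UniformSpace.Completion.induction_on with
  | hp => exact isClosed_eq (by fun_prop) (by fun_prop)
  | ih t =>
    exact algTensor_ext (φ := φ.toLinearMap.comp toHT.toLinearMap)
      (ψ := ψ.toLinearMap.comp toHT.toLinearMap) h t

/-- Sesquilinear identities only have to be checked on pure tensors. -/
theorem hTensor_inner_ext {m : ℕ} {V : Type*} [NormedAddCommGroup V] [InnerProductSpace ℂ V]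
    {W : Type*} [NormedAddCommGroup W] [InnerProductSpace ℂ W]
    {φ : HTensor H n →L[ℂ] V} {φ' : HTensor K m →L[ℂ] V}
    {ψ : HTensor H n →L[ℂ] W} {ψ' : HTensor K m →L[ℂ] W}
    (h : ∀ (x : Fin n → H) (y : Fin m → K), inner ℂ (φ (pureTensor x)) (φ' (pureTensor y)) =
      inner ℂ (ψ (pureTensor x)) (ψ' (pureTensor y))) (s : HTensor H n) (t : HTensor K m) :
    inner ℂ (φ s) (φ' t) = inner ℂ (ψ s) (ψ' t) := by
  have h1 : ∀ (y : Fin m → K) (s : HTensor H n), inner ℂ (φ s) (φ' (pureTensor y)) =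
      inner ℂ (ψ s) (ψ' (pureTensor y)) := by
    intro y s
    have := hTensor_ext (φ := (innerSL ℂ (φ' (pureTensor y))).comp φ)
      (ψ := (innerSL ℂ (ψ' (pureTensor y))).comp ψ) (fun x => by
        have := congrArg (starRingEnd ℂ) (h x y)
        simpa [inner_conj_symm] using this) s
    have := congrArg (starRingEnd ℂ) this
    simpa [inner_conj_symm] using this
  exact hTensor_ext (φ := (innerSL ℂ (φ s)).comp φ') (ψ := (innerSL ℂ (ψ s)).comp ψ')
    (fun y => h1 y s) t

/-- The tensor product of linear maps. -/
def algMap (L : Fin n → K →ₗ[ℂ] H) : AlgTensor K n →ₗ[ℂ] AlgTensor H n :=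
  algLift (algTprod.compLinearMap L)

@[simp]
theorem algMap_algTprod (L : Fin n → K →ₗ[ℂ] H) (x : Fin n → K) :
    algMap L (algTprod x) = algTprod fun i => L i (x i) := by
  simp [algMap]

theorem inner_algMap {K' H' : Type*} [NormedAddCommGroup K'] [InnerProductSpace ℂ K']
    [NormedAddCommGroup H'] [InnerProductSpace ℂ H']
    {L : Fin n → K →ₗ[ℂ] H} {M : Fin n → K' →ₗ[ℂ] H}
    {L' : Fin n → K →ₗ[ℂ] H'} {M' : Fin n → K' →ₗ[ℂ] H'}
    (h : ∀ i x y, inner ℂ (L i x) (M i y) = inner ℂ (L' i x) (M' i y))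
    (s : AlgTensor K n) (t : AlgTensor K' n) :
    inner ℂ (algMap L s) (algMap M t) = inner ℂ (algMap L' s) (algMap M' t) := by
  induction s using algTensor_induction with
  | smul_tprod c x =>
    induction t using algTensor_induction with
    | smul_tprod d y =>
      simp only [map_smul, inner_smul_left, inner_smul_right, algMap_algTprod, inner_algTprod, h]
    | add s t hs ht => simp only [map_add, inner_add_right, hs, ht]
  | add s t hs ht => simp only [map_add, inner_add_left, hs, ht]

/-- The map that applies `L` to the `j`-th factor and `ι` to all the others. -/
def slot (ι L : K →ₗ[ℂ] H) (j : Fin n) : AlgTensor K n →ₗ[ℂ] AlgTensor H n :=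
  algMap (Function.update (fun _ => ι) j L)

@[simp]
theorem slot_algTprod (ι L : K →ₗ[ℂ] H) (j : Fin n) (x : Fin n → K) :
    slot ι L j (algTprod x) = algTprod (Function.update (fun i => ι (x i)) j (L (x j))) := by
  rw [slot, algMap_algTprod]
  congr 1
  funext i
  by_cases hi : i = j
  · subst hi
    simp
  · simp [hi]

theorem inner_slot {ι L M L' M' : K →ₗ[ℂ] H}
    (h : ∀ x y, inner ℂ (L x) (M y) = inner ℂ (L' x) (M' y)) (j : Fin n) (s t : AlgTensor K n) :
    inner ℂ (slot ι L j s) (slot ι M j t) = inner ℂ (slot ι L' j s) (slot ι M' j t) := by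
  refine inner_algMap (fun i x y => ?_) s t
  by_cases hi : i = j
  · subst hi
    simpa using h x y
  · simp [hi]

theorem slot_self (ι : K →ₗ[ℂ] H) (j : Fin n) : slot ι ι j = algMap fun _ => ι := by
  simp [slot]

theorem inner_algTprod_update (x y : Fin n → H) (j : Fin n) (a b : H) :
    inner ℂ (algTprod (Function.update x j a)) (algTprod (Function.update y j b)) =
      inner ℂ a b * ∏ i ∈ Finset.univ.erase j, inner ℂ (x i) (y i) := by
  rw [inner_algTprod, ← Finset.mul_prod_erase _ _ (Finset.mem_univ j)]
  simp only [Function.update_self]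
  congr 1
  refine Finset.prod_congr rfl fun i hi => ?_
  have : i ≠ j := Finset.ne_of_mem_erase hi
  simp [this]

theorem inner_slot_add {L M : H →ₗ[ℂ] H} {c : ℂ}
    (h : ∀ x y, inner ℂ (L x) (L y) + inner ℂ (M x) (M y) = c * inner ℂ x y) (j : Fin n)
    (s t : AlgTensor H n) :
    inner ℂ (slot LinearMap.id L j s) (slot LinearMap.id L j t) +
      inner ℂ (slot LinearMap.id M j s) (slot LinearMap.id M j t) = c * inner ℂ s t := by
  induction s using algTensor_induction with
  | smul_tprod a x =>
    induction t using algTensor_induction with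
    | smul_tprod d y =>
      simp only [map_smul, inner_smul_left, inner_smul_right, slot_algTprod,
        inner_algTprod_update, LinearMap.id_apply]
      rw [inner_algTprod, ← Finset.mul_prod_erase Finset.univ (fun i => inner ℂ (x i) (y i))
        (Finset.mem_univ j)]
      linear_combination (starRingEnd ℂ a * d * ∏ i ∈ Finset.univ.erase j, inner ℂ (x i) (y i)) *
        h (x j) (y j)
    | add s t hs ht =>
      simp only [map_add, inner_add_right]
      linear_combination hs + ht
  | add s t hs ht =>
    simp only [map_add, inner_add_left]
    linear_combination hs + ht

theorem norm_slot_le [CompleteSpace H] (Y : H →L[ℂ] H) (j : Fin n) (t : AlgTensor H n) :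
    ‖slot LinearMap.id Y.toLinearMap j t‖ ≤ ‖Y‖ * ‖t‖ := by
  let B : H →L[ℂ] H := ((‖Y‖ ^ 2 : ℝ) : ℂ) • 1 - Y.adjoint * Y
  have hB : ∀ x y, inner ℂ (B x) y = ((‖Y‖ ^ 2 : ℝ) : ℂ) * inner ℂ x y - inner ℂ (Y x) (Y y) := by
    intro x y
    change inner ℂ (((‖Y‖ ^ 2 : ℝ) : ℂ) • x - Y.adjoint (Y x)) y = _
    rw [inner_sub_left, inner_smul_left, ContinuousLinearMap.adjoint_inner_left,
      Complex.conj_ofReal]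
  have hB' : ∀ x y, inner ℂ x (B y) = ((‖Y‖ ^ 2 : ℝ) : ℂ) * inner ℂ x y - inner ℂ (Y x) (Y y) := by
    intro x y
    change inner ℂ x (((‖Y‖ ^ 2 : ℝ) : ℂ) • y - Y.adjoint (Y y)) = _
    rw [inner_sub_right, inner_smul_right, ContinuousLinearMap.adjoint_inner_right]
  have hB0 : 0 ≤ B := by
    rw [ContinuousLinearMap.nonneg_iff_isPositive]
    refine ⟨fun x y => ?_, fun x => ?_⟩
    · exact (hB x y).trans (hB' x y).symm
    · change 0 ≤ (inner ℂ (B x) x).re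
      have e1 : (inner ℂ x x).re = ‖x‖ ^ 2 := inner_self_eq_norm_sq (𝕜 := ℂ) x
      have e2 : (inner ℂ (Y x) (Y x)).re = ‖Y x‖ ^ 2 := inner_self_eq_norm_sq (𝕜 := ℂ) (Y x)
      rw [hB, Complex.sub_re, Complex.re_ofReal_mul, e1, e2, ← mul_pow, sub_nonneg]
      gcongr
      exact Y.le_opNorm x
  let Z : H →L[ℂ] H := CFC.sqrt B
  have hZ0 : 0 ≤ Z := CFC.sqrt_nonneg _
  have hZs : ∀ x y, inner ℂ (Z x) y = inner ℂ x (Z y) :=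
    ((ContinuousLinearMap.nonneg_iff_isPositive Z).1 hZ0).isSymmetric
  have hZZ : ∀ x, Z (Z x) = B x := fun x =>
    congrArg (fun B : H →L[ℂ] H => B x) (CFC.sqrt_mul_sqrt_self B hB0)
  have h1 := inner_slot_add (L := Y.toLinearMap) (M := Z.toLinearMap) (c := ((‖Y‖ ^ 2 : ℝ) : ℂ))
    (fun x y => by
      change inner ℂ (Y x) (Y y) + inner ℂ (Z x) (Z y) = _
      rw [hZs, hZZ, hB']
      ring) j t t
  have h2 := congrArg Complex.re h1
  have e : ∀ s : AlgTensor H n, (inner ℂ s s).re = ‖s‖ ^ 2 :=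
    fun s => inner_self_eq_norm_sq (𝕜 := ℂ) s
  rw [Complex.add_re, Complex.re_ofReal_mul, e, e, e] at h2
  refine abs_le_of_sq_le_sq' ?_ (by positivity) |>.2
  rw [mul_pow]
  nlinarith [sq_nonneg ‖slot LinearMap.id Z.toLinearMap j t‖]

theorem algPerm_algMap (σ : Equiv.Perm (Fin n)) (ι : K →ₗ[ℂ] H) (t : AlgTensor K n) :
    algPerm σ (algMap (fun _ => ι) t) = algMap (fun _ => ι) (algPerm σ t) := by
  refine algTensor_ext (φ := (algPerm σ).comp (algMap fun _ => ι))
    (ψ := (algMap fun _ => ι).comp (algPerm σ)) (fun x => ?_) t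
  simp

theorem algPerm_slot (σ : Equiv.Perm (Fin n)) (ι L : K →ₗ[ℂ] H) (j : Fin n) (t : AlgTensor K n) :
    algPerm σ (slot ι L (σ j) t) = slot ι L j (algPerm σ t) := by
  refine algTensor_ext (φ := (algPerm σ).comp (slot ι L (σ j)))
    (ψ := (slot ι L j).comp (algPerm σ)) (fun x => ?_) t
  simp only [LinearMap.comp_apply, slot_algTprod, algPerm_algTprod]
  congr 1
  funext i
  by_cases hi : i = j
  · subst hi
    simp
  · simp [hi]

theorem permOp_toHT (σ : Equiv.Perm (Fin n)) (t : AlgTensor H n) :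
    permOp σ (toHT t) = toHT (algPerm σ t) := by
  refine algTensor_ext (φ := (permOp σ).toLinearMap.comp toHT.toLinearMap)
    (ψ := toHT.toLinearMap.comp (algPerm σ)) (fun x => ?_) t
  change permOp σ (pureTensor x) = toHT (algPerm σ (algTprod x))
  rw [permOp_pureTensor, algPerm_algTprod, toHT_algTprod]

theorem inner_permOp (σ : Equiv.Perm (Fin n)) (φ ψ : HTensor H n) :
    inner ℂ (permOp σ φ) (permOp σ ψ) = inner ℂ φ ψ := by
  refine hTensor_inner_ext (φ := permOp σ) (φ' := permOp σ) (ψ := ContinuousLinearMap.id ℂ _)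
    (ψ' := ContinuousLinearMap.id ℂ _) (fun x y => ?_) φ ψ
  rw [permOp_pureTensor, permOp_pureTensor, inner_pureTensor]
  exact (Equiv.prod_comp σ fun i => inner ℂ (x i) (y i)).trans (inner_pureTensor x y).symm

theorem permOp_one (ψ : HTensor H n) : permOp 1 ψ = ψ :=
  hTensor_ext (φ := permOp 1) (ψ := ContinuousLinearMap.id ℂ _)
    (fun x => by rw [permOp_pureTensor]; rfl) ψ

theorem inner_permOp_left (σ : Equiv.Perm (Fin n)) (φ ψ : HTensor H n) :
    inner ℂ (permOp σ φ) ψ = inner ℂ φ (permOp σ⁻¹ ψ) := by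
  rw [← inner_permOp σ φ (permOp σ⁻¹ ψ), permOp_permOp, inv_mul_cancel, permOp_one]

theorem inner_symmetrizer (φ : HTensor H n) {ψ : HTensor H n} (h : ψ ∈ symTensor H n) :
    inner ℂ (symmetrizer H n φ) ψ = inner ℂ φ ψ := by
  have h1 : ∀ σ : Equiv.Perm (Fin n), inner ℂ (permOp σ φ) ψ = inner ℂ φ ψ := fun σ => by
    rw [inner_permOp_left, mem_symTensor.1 h]
  have h0 : (n.factorial : ℂ) ≠ 0 := by exact_mod_cast n.factorial_ne_zero
  simp only [symmetrizer, smul_apply, sum_apply, inner_smul_left, sum_inner, h1]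
  simp [Fintype.card_perm, h0]

theorem inner_toSym (φ : HTensor H n) (ψ : symTensor H n) :
    inner ℂ (toSym H n φ) ψ = inner ℂ φ (ψ : HTensor H n) :=
  inner_symmetrizer φ ψ.2

theorem toSym_coe (ψ : symTensor H n) : toSym H n (ψ : HTensor H n) = ψ :=
  Subtype.ext (symmetrizer_of_mem ψ.2)

/-- The symmetrization of algebraic tensors. -/
def algSym : AlgTensor K n →ₗ[ℂ] AlgTensor K n :=
  ((n.factorial : ℂ)⁻¹) • ∑ σ : Equiv.Perm (Fin n), algPerm σ

theorem algPerm_algPerm (σ τ : Equiv.Perm (Fin n)) (t : AlgTensor K n) :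
    algPerm σ (algPerm τ t) = algPerm (τ * σ) t :=
  algTensor_ext (φ := (algPerm σ).comp (algPerm τ)) (ψ := algPerm (τ * σ)) (fun x => by simp) t

theorem algPerm_algSym (σ : Equiv.Perm (Fin n)) (t : AlgTensor K n) :
    algPerm σ (algSym t) = algSym t := by
  simp only [algSym, LinearMap.smul_apply, LinearMap.sum_apply, map_smul, map_sum, algPerm_algPerm]
  congr 1
  exact Equiv.sum_comp (Equiv.mulRight σ) fun τ => algPerm τ t

/-- A bounded operator acting on the `j`-th factor. -/
def slotOp [CompleteSpace H] (Y : H →L[ℂ] H) (j : Fin n) : HTensor H n →L[ℂ] HTensor H n :=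
  ((slot LinearMap.id Y.toLinearMap j).mkContinuous ‖Y‖ (norm_slot_le Y j)).completion

theorem slotOp_toHT [CompleteSpace H] (Y : H →L[ℂ] H) (j : Fin n) (t : AlgTensor H n) :
    slotOp Y j (toHT t) = toHT (slot LinearMap.id Y.toLinearMap j t) := by
  simp [slotOp, toHT_apply]

theorem consTensor_toHT (f : H) (t : AlgTensor H n) :
    consTensor f (toHT t) = toHT (algConsTensor f t) := by
  simp [consTensor, toHT_apply]

theorem consTensor_pureTensor (f : H) (x : Fin n → H) :
    consTensor f (pureTensor x) = pureTensor (Fin.cons f x : Fin (n + 1) → H) := by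
  rw [← toHT_algTprod, consTensor_toHT, algConsTensor_algTprod, toHT_algTprod]

end TensorOperators

/-! ### Self-adjointness of the `n`-particle operators -/

section NParticle

open Filter Topology

variable {H : Type*} [NormedAddCommGroup H] [InnerProductSpace ℂ H] {n : ℕ}

/-- The inclusion of the algebraic tensor power of `D(T)`. -/
def domEmb (T : H →ₗ.[ℂ] H) (n : ℕ) : AlgTensor T.domain n →ₗ[ℂ] HTensor H n :=
  toHT.toLinearMap.comp (algMap fun _ => T.domain.subtype)

/-- `∑ⱼ I ⊗ ⋯ ⊗ T ⊗ ⋯ ⊗ I` on the algebraic tensor power of `D(T)`. -/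
def domSum (T : H →ₗ.[ℂ] H) (n : ℕ) : AlgTensor T.domain n →ₗ[ℂ] HTensor H n :=
  ∑ j, toHT.toLinearMap.comp (slot T.domain.subtype T.toFun j)

theorem domEmb_apply (T : H →ₗ.[ℂ] H) (t : AlgTensor T.domain n) :
    domEmb T n t = toHT (algMap (fun _ => T.domain.subtype) t) := rfl

theorem domSum_apply (T : H →ₗ.[ℂ] H) (t : AlgTensor T.domain n) :
    domSum T n t = ∑ j, toHT (slot T.domain.subtype T.toFun j t) := by
  simp [domSum]

theorem domEmb_algTprod (T : H →ₗ.[ℂ] H) (x : Fin n → T.domain) :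
    domEmb T n (algTprod x) = pureTensor fun i => (x i : H) := by
  rw [domEmb_apply, algMap_algTprod, toHT_algTprod]
  rfl

theorem domSum_algTprod (T : H →ₗ.[ℂ] H) (x : Fin n → T.domain) :
    domSum T n (algTprod x) =
      ∑ j, pureTensor (Function.update (fun i => (x i : H)) j (T (x j))) := by
  rw [domSum_apply]
  refine Finset.sum_congr rfl fun j _ => ?_
  rw [slot_algTprod, toHT_algTprod]
  rfl

theorem permOp_domEmb (T : H →ₗ.[ℂ] H) (σ : Equiv.Perm (Fin n)) (t : AlgTensor T.domain n) :
    permOp σ (domEmb T n t) = domEmb T n (algPerm σ t) := by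
  rw [domEmb_apply, permOp_toHT, algPerm_algMap, domEmb_apply]

theorem permOp_domSum (T : H →ₗ.[ℂ] H) (σ : Equiv.Perm (Fin n)) (t : AlgTensor T.domain n) :
    permOp σ (domSum T n t) = domSum T n (algPerm σ t) := by
  rw [domSum_apply, domSum_apply, map_sum, ← Equiv.sum_comp σ]
  refine Finset.sum_congr rfl fun j _ => ?_
  rw [permOp_toHT, algPerm_slot]

theorem symmetrizer_domEmb (T : H →ₗ.[ℂ] H) (t : AlgTensor T.domain n) :
    symmetrizer H n (domEmb T n t) = domEmb T n (algSym t) := by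
  simp only [symmetrizer, algSym, smul_apply, sum_apply, permOp_domEmb, map_smul, map_sum,
    LinearMap.smul_apply, LinearMap.sum_apply]

theorem symmetrizer_domSum (T : H →ₗ.[ℂ] H) (t : AlgTensor T.domain n) :
    symmetrizer H n (domSum T n t) = domSum T n (algSym t) := by
  simp only [symmetrizer, algSym, smul_apply, sum_apply, permOp_domSum, map_smul, map_sum,
    LinearMap.smul_apply, LinearMap.sum_apply]

theorem inner_domSum {T : H →ₗ.[ℂ] H} (hs : SymmGraph T.graph) (s t : AlgTensor T.domain n) :
    inner ℂ (domSum T n s) (domEmb T n t) = inner ℂ (domEmb T n s) (domSum T n t) := by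
  rw [domSum_apply, domSum_apply, sum_inner, inner_sum]
  refine Finset.sum_congr rfl fun j _ => ?_
  rw [domEmb_apply, domEmb_apply, inner_toHT, inner_toHT, ← slot_self _ j]
  exact inner_slot (fun x y => hs _ (T.mem_graph x) _ (T.mem_graph y)) j s t

/-- The restriction of a square root of `T` to `D(T)`. -/
theorem IsSqrt.exists_linearMap [CompleteSpace H] {S T : H →ₗ.[ℂ] H} (h : IsSqrt S T) :
    ∃ L : T.domain →ₗ[ℂ] H, (∀ x : T.domain, ((x : H), L x) ∈ S.graph) ∧
      ∀ x y : T.domain, inner ℂ (L x) (L y) = inner ℂ (x : H) (T y) := by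
  have hle : T.domain ≤ S.domain := by
    intro x hx
    obtain ⟨y, hy⟩ := LinearPMap.mem_domain_iff.1 hx
    obtain ⟨w, hw, -⟩ := h.exists_graph hy
    exact LinearPMap.mem_domain_of_mem_graph hw
  refine ⟨S.toFun.comp (Submodule.inclusion hle), fun x => S.mem_graph ⟨x, hle x.2⟩,
    fun x y => ?_⟩
  have hx : ((x : H), S ⟨x, hle x.2⟩) ∈ S.graph := S.mem_graph ⟨x, hle x.2⟩
  have hy : ((y : H), S ⟨y, hle y.2⟩) ∈ S.graph := S.mem_graph ⟨y, hle y.2⟩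
  obtain ⟨w, hw, hw'⟩ := h.exists_graph (T.mem_graph y)
  obtain rfl := S.mem_graph_snd_inj hy hw rfl
  exact h.1.symmGraph _ hx _ hw'

theorem re_inner_slot_nonneg [CompleteSpace H] {S T : H →ₗ.[ℂ] H} (h : IsSqrt S T)
    (j : Fin n) (t : AlgTensor T.domain n) :
    0 ≤ (inner ℂ (algMap (fun _ => T.domain.subtype) t) (slot T.domain.subtype T.toFun j t)).re := by
  obtain ⟨L, -, hL⟩ := h.exists_linearMap
  rw [← slot_self _ j, ← inner_slot (L := L) (M := L) (fun x y => hL x y)]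
  exact inner_self_nonneg (𝕜 := ℂ)

theorem re_inner_domSum_nonneg [CompleteSpace H] {S T : H →ₗ.[ℂ] H} (h : IsSqrt S T)
    (t : AlgTensor T.domain n) : 0 ≤ (inner ℂ (domEmb T n t) (domSum T n t)).re := by
  rw [domSum_apply, inner_sum, Complex.re_sum]
  refine Finset.sum_nonneg fun j _ => ?_
  rw [domEmb_apply, inner_toHT]
  exact re_inner_slot_nonneg h j t

theorem denseRange_domEmb {T : H →ₗ.[ℂ] H} (hd : Dense (T.domain : Set H)) :
    DenseRange (domEmb T n) := by
  let V : Submodule ℂ (HTensor H n) := (LinearMap.range (domEmb T n)).topologicalClosure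
  have hV : ∀ x : Fin n → H, pureTensor x ∈ V := by
    intro x
    have h1 : Dense (Set.pi Set.univ fun _ : Fin n => (T.domain : Set H)) :=
      dense_pi _ fun _ _ => hd
    refine map_mem_closure continuous_pureTensor (h1 x) fun y hy => ?_
    exact ⟨algTprod fun i => ⟨y i, hy i (Set.mem_univ i)⟩, domEmb_algTprod T _⟩
  have hV' : ∀ t : AlgTensor H n, toHT t ∈ V := by
    intro t
    induction t using algTensor_induction with
    | smul_tprod c x => rw [map_smul]; exact V.smul_mem c (hV x)
    | add s t hs ht => rw [map_add]; exact V.add_mem hs ht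
  intro ψ
  have : closure (Set.range (toHT : AlgTensor H n → HTensor H n)) ⊆ (V : Set (HTensor H n)) :=
    closure_minimal (by rintro _ ⟨t, rfl⟩; exact hV' t) (Submodule.isClosed_topologicalClosure _)
  exact this (denseRange_toHT ψ)

/-- Invariant closed subspaces of a bounded non-negative operator `D` are invariant under
`(1 + D)⁻¹`. -/
theorem exists_add_eq_of_invariant {F : Type*} [NormedAddCommGroup F] [InnerProductSpace ℂ F]
    [CompleteSpace F] {D : F →L[ℂ] F} (hD : ∀ x, 0 ≤ (inner ℂ x (D x)).re) {W : Submodule ℂ F}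
    (hW : IsClosed (W : Set F)) (hDW : ∀ x ∈ W, D x ∈ W) {w : F} (hw : w ∈ W) :
    ∃ v ∈ W, D v + v = w := by
  have : CompleteSpace W := hW.completeSpace_coe
  let D' : W →L[ℂ] W := (D.comp W.subtypeL).codRestrict W fun x => hDW x x.2
  have hG : IsClosed ((LinearMap.range
      ((ContinuousLinearMap.id ℂ W).prod D').toLinearMap : Submodule ℂ (W × W)) : Set (W × W)) := by
    have : ((LinearMap.range ((ContinuousLinearMap.id ℂ W).prod D').toLinearMap :
        Submodule ℂ (W × W)) : Set (W × W)) = {p | p.2 = D' p.1} := by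
      ext ⟨a, b⟩
      constructor
      · rintro ⟨c, hc⟩
        obtain ⟨rfl, rfl⟩ := Prod.ext_iff.1 hc
        rfl
      · rintro h
        exact ⟨a, Prod.ext rfl (Eq.symm h)⟩
    rw [this]
    exact isClosed_eq (by fun_prop) (by fun_prop)
  have hp : ∀ x : W, 0 ≤ (inner ℂ x (D' x)).re := fun x => hD x
  obtain ⟨p, ⟨v, hv⟩, hpw⟩ := exists_sub_eq hG (μ := ((-1 : ℝ) : ℂ)) one_pos
    (by
      rintro _ ⟨v, rfl⟩
      exact le_norm_add_of_nonneg (hp v) zero_le_one)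
    (by
      intro y hy
      have h1 := hy (y, D' y) ⟨y, rfl⟩
      have h2 := congrArg Complex.re h1
      simp only [Complex.ofReal_neg, Complex.ofReal_one, neg_smul, one_smul, sub_neg_eq_add,
        inner_add_left, Complex.add_re, Complex.zero_re] at h2
      have e1 : (inner ℂ (D' y) y).re = (inner ℂ y (D' y)).re := inner_re_symm (𝕜 := ℂ) _ _
      have e2 : (inner ℂ y y).re = ‖y‖ ^ 2 := inner_self_eq_norm_sq (𝕜 := ℂ) y
      have h3 : ‖y‖ ^ 2 ≤ 0 := by
        have := hp y
        linarith
      have : ‖y‖ = 0 := by nlinarith [norm_nonneg y, sq_nonneg ‖y‖]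
      simpa using this) (⟨w, hw⟩ : W)
  refine ⟨v, v.2, ?_⟩
  subst hv
  have := congrArg (Subtype.val : W → F) hpw
  have h2 : (D' v : F) + v = w := by simpa using this
  exact h2

theorem slot_comm {K : Type*} [NormedAddCommGroup K] [InnerProductSpace ℂ K] {ι L : K →ₗ[ℂ] H}
    {Y : H →ₗ[ℂ] H} {Y' : K →ₗ[ℂ] K} (h1 : ∀ x, Y (ι x) = ι (Y' x)) (h2 : ∀ x, Y (L x) = L (Y' x))
    (i j : Fin n) (t : AlgTensor K n) :
    slot LinearMap.id Y i (slot ι L j t) = slot ι L j (slot LinearMap.id Y' i t) := by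
  refine algTensor_ext (φ := (slot LinearMap.id Y i).comp (slot ι L j))
    (ψ := (slot ι L j).comp (slot LinearMap.id Y' i)) (fun x => ?_) t
  simp only [LinearMap.comp_apply, slot_algTprod, LinearMap.id_apply]
  congr 1
  funext k
  by_cases hi : k = i
  · subst hi
    by_cases hj : k = j
    · subst hj
      simp [h2]
    · simp [hj, h1]
  · by_cases hj : k = j
    · subst hj
      simp [hi]
    · simp [hi, hj]

theorem slot_algMap_comm {K : Type*} [NormedAddCommGroup K] [InnerProductSpace ℂ K]
    {ι : K →ₗ[ℂ] H} {Y : H →ₗ[ℂ] H} {Y' : K →ₗ[ℂ] K} (h1 : ∀ x, Y (ι x) = ι (Y' x))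
    (i : Fin n) (t : AlgTensor K n) :
    slot LinearMap.id Y i (algMap (fun _ => ι) t) =
      algMap (fun _ => ι) (slot LinearMap.id Y' i t) := by
  rw [← slot_self ι i]
  exact slot_comm h1 h1 i i t

/-- The range of `1 + ∑ⱼ I ⊗ ⋯ ⊗ T ⊗ ⋯ ⊗ I` is dense. -/
theorem denseRange_domEmb_add_domSum [CompleteSpace H] {T : H →ₗ.[ℂ] H} (hT : IsSelfAdjoint T)
    (hT0 : IsNonneg T)
    (n : ℕ) : DenseRange (domEmb T n + domSum T n) := by
  let W : Submodule ℂ (HTensor H n) := (LinearMap.range (domEmb T n + domSum T n)).topologicalClosure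
  have hWc : IsClosed (W : Set (HTensor H n)) := Submodule.isClosed_topologicalClosure _
  obtain ⟨R, hR, hlim⟩ := exists_resolvent_seq hT hT0
  have hpos : ∀ k : ℕ, (0 : ℝ) < k + 1 := fun k => by positivity
  let Y : ℕ → H →L[ℂ] H := fun k => (((k + 1 : ℝ)) : ℂ) • (1 - R k)
  have hY : ∀ k x, Y k x = (((k + 1 : ℝ)) : ℂ) • (x - R k x) := fun k x => rfl
  have hYT : ∀ k (x : T.domain), Y k x = R k (T x) := fun k x =>
    ((hR k).smul_apply hT0 (hpos k) (T.mem_graph x)).symm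
  have hYdom : ∀ k (x : T.domain), Y k x ∈ T.domain := by
    intro k x
    refine T.domain.smul_mem _ (T.domain.sub_mem x.2 ?_)
    exact LinearPMap.mem_domain_of_mem_graph (hR k x)
  let Y' : ℕ → T.domain →ₗ[ℂ] T.domain := fun k =>
    ((Y k).toLinearMap.comp T.domain.subtype).codRestrict T.domain fun x => hYdom k x
  have hY'1 : ∀ k x, (Y k).toLinearMap (T.domain.subtype x) = T.domain.subtype (Y' k x) :=
    fun k x => rfl
  have hY'2 : ∀ k x, (Y k).toLinearMap (T.toFun x) = T.toFun (Y' k x) := by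
    intro k x
    change Y k (T x) = T (Y' k x)
    have h1 : ((Y' k x : H), T (Y' k x)) ∈ T.graph := T.mem_graph _
    have h2 : ((Y' k x : H), Y k (T x)) ∈ T.graph := by
      have h3 := T.mem_graph x
      have h4 := (hR k).mem_graph hT0 (hpos k) h3
      exact T.graph.smul_mem _ (T.graph.sub_mem h3 h4)
    exact T.mem_graph_snd_inj h2 h1 rfl
  have hsqrt := isSqrt_opSqrt hT hT0
  obtain ⟨L, hL1, hL2⟩ := hsqrt.exists_linearMap
  let Rd : ℕ → H →ₗ[ℂ] T.domain := fun k =>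
    (R k).toLinearMap.codRestrict T.domain fun x => LinearPMap.mem_domain_of_mem_graph (hR k x)
  have hTR : ∀ k x, T (Rd k x) = Y k x := fun k x =>
    T.mem_graph_snd_inj (T.mem_graph _) (hR k x) rfl
  let D : ℕ → HTensor H n →L[ℂ] HTensor H n := fun k => ∑ j, slotOp (Y k) j
  have hDapp : ∀ k ψ, D k ψ = ∑ j, slotOp (Y k) j ψ := fun k ψ => by simp [D]
  have hslot_nonneg : ∀ k j (t : AlgTensor H n),
      0 ≤ (inner ℂ t (slot LinearMap.id (Y k).toLinearMap j t)).re := by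
    intro k j t
    let c : ℝ := √(1 / (k + 1))
    have hc : ((c : ℂ)) * c = 1 / ((k : ℂ) + 1) := by
      rw [← Complex.ofReal_mul, Real.mul_self_sqrt (by positivity)]
      push_cast
      ring
    have hk : ((k : ℂ) + 1) ≠ 0 := by exact_mod_cast Nat.succ_ne_zero k
    have key : ∀ s t : AlgTensor H n, inner ℂ s (slot LinearMap.id (Y k).toLinearMap j t) =
        inner ℂ (slot LinearMap.id (L.comp (Rd k)) j s) (slot LinearMap.id (L.comp (Rd k)) j t) +
        inner ℂ (slot LinearMap.id ((c : ℂ) • (Y k).toLinearMap) j s)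
          (slot LinearMap.id ((c : ℂ) • (Y k).toLinearMap) j t) := by
      intro s t
      induction s using algTensor_induction with
      | smul_tprod a x =>
        induction t using algTensor_induction with
        | smul_tprod d y =>
          simp only [map_smul, inner_smul_left, inner_smul_right, slot_algTprod,
            inner_algTprod_update, LinearMap.id_apply]
          have e : algTprod x = algTprod (Function.update x j (x j)) := by simp
          rw [e, inner_algTprod_update]
          have h1 : inner ℂ (x j) (Y k (y j)) =
              inner ℂ (L (Rd k (x j))) (L (Rd k (y j))) +
                (c : ℂ) * c * inner ℂ (Y k (x j)) (Y k (y j)) := by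
            have h2 : x j = (Rd k (x j) : H) + (1 / ((k : ℂ) + 1)) • Y k (x j) := by
              rw [hY, smul_smul]
              push_cast
              rw [one_div_mul_cancel hk, one_smul]
              change x j = R k (x j) + (x j - R k (x j))
              abel
            rw [hL2, hTR]
            nth_rw 1 [h2]
            rw [inner_add_left, inner_smul_left, hc]
            congr 2
            simp
          simp only [LinearMap.comp_apply, LinearMap.smul_apply, inner_smul_left,
            inner_smul_right, Complex.conj_ofReal, ContinuousLinearMap.coe_coe]
          rw [h1]
          ring
        | add s t hs ht =>
          simp only [map_add, inner_add_right]
          rw [hs, ht]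
          ring
      | add s t hs ht =>
        simp only [map_add, inner_add_left]
        rw [hs, ht]
        ring
    rw [key, Complex.add_re]
    exact add_nonneg (inner_self_nonneg (𝕜 := ℂ)) (inner_self_nonneg (𝕜 := ℂ))
  have hD0 : ∀ k ψ, 0 ≤ (inner ℂ ψ (D k ψ)).re := by
    intro k ψ
    induction ψ using UniformSpace.Completion.induction_on with
    | hp => exact isClosed_le continuous_const (Complex.continuous_re.comp (by fun_prop))
    | ih t =>
      rw [← toHT_apply, hDapp, inner_sum, Complex.re_sum]
      refine Finset.sum_nonneg fun j _ => ?_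
      rw [slotOp_toHT, inner_toHT]
      exact hslot_nonneg k j t
  have hDemb : ∀ k t, D k (domEmb T n t) =
      domEmb T n (∑ j, slot LinearMap.id (Y' k) j t) := by
    intro k t
    rw [hDapp, map_sum]
    refine Finset.sum_congr rfl fun j _ => ?_
    rw [domEmb_apply, slotOp_toHT, slot_algMap_comm (hY'1 k), domEmb_apply]
  have hDsum : ∀ k t, D k (domSum T n t) =
      domSum T n (∑ j, slot LinearMap.id (Y' k) j t) := by
    intro k t
    rw [hDapp, map_sum]
    refine Finset.sum_congr rfl fun j _ => ?_
    rw [domSum_apply, domSum_apply, map_sum]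
    refine Finset.sum_congr rfl fun i _ => ?_
    rw [slotOp_toHT, slot_comm (hY'1 k) (hY'2 k)]
  have hDW : ∀ k, ∀ ψ ∈ W, D k ψ ∈ W := by
    intro k ψ hψ
    refine map_mem_closure (D k).continuous hψ ?_
    rintro _ ⟨t, rfl⟩
    refine ⟨∑ j, slot LinearMap.id (Y' k) j t, ?_⟩
    rw [LinearMap.add_apply, LinearMap.add_apply, map_add, hDemb, hDsum]
  have hDlim : ∀ t, Tendsto (fun k => D k (domEmb T n t)) atTop (𝓝 (domSum T n t)) := by
    intro t
    induction t using algTensor_induction with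
    | smul_tprod c x =>
      simp only [map_smul]
      refine Tendsto.const_smul ?_ c
      rw [domSum_algTprod]
      simp_rw [hDapp]
      refine tendsto_finsetSum _ fun j _ => ?_
      have e : ∀ k, slotOp (Y k) j (domEmb T n (algTprod x)) =
          pureTensor (Function.update (fun i => (x i : H)) j (R k (T (x j)))) := by
        intro k
        rw [domEmb_apply, slotOp_toHT, algMap_algTprod, slot_algTprod, toHT_algTprod, ← hYT]
        rfl
      simp_rw [e]
      have hc : Continuous fun y : H =>
          (pureTensor (Function.update (fun i => (x i : H)) j y) : HTensor H n) :=
        continuous_pureTensor.comp (by fun_prop)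
      exact (hc.tendsto _).comp (hlim (T (x j)))
    | add s t hs ht =>
      simp only [map_add]
      exact hs.add ht
  have hmem : ∀ t, domEmb T n t ∈ W := by
    intro t
    have hw : domEmb T n t + domSum T n t ∈ W :=
      Submodule.le_topologicalClosure _ ⟨t, rfl⟩
    choose v hvW hv using fun k => exists_add_eq_of_invariant (hD0 k) hWc (hDW k) hw
    have hbd : ∀ k, ‖v k - domEmb T n t‖ ≤ ‖D k (domEmb T n t) - domSum T n t‖ := by
      intro k
      have h1 := le_norm_add_of_nonneg (hD0 k (v k - domEmb T n t)) zero_le_one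
      have e : D k (v k - domEmb T n t) - ((-1 : ℝ) : ℂ) • (v k - domEmb T n t) =
          -(D k (domEmb T n t) - domSum T n t) := by
        have h2 : D k (v k) = domEmb T n t + domSum T n t - v k := eq_sub_of_add_eq (hv k)
        rw [map_sub, h2]
        push_cast
        module
      rwa [e, norm_neg, one_mul] at h1
    have hlim' : Tendsto v atTop (𝓝 (domEmb T n t)) := by
      rw [tendsto_iff_norm_sub_tendsto_zero]
      refine squeeze_zero (fun k => norm_nonneg _) hbd ?_
      exact tendsto_iff_norm_sub_tendsto_zero.1 (hDlim t)
    exact hWc.mem_of_tendsto hlim' (Eventually.of_forall hvW)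
  intro ψ
  have : closure (Set.range (domEmb T n)) ⊆ (W : Set (HTensor H n)) :=
    closure_minimal (by rintro _ ⟨t, rfl⟩; exact hmem t) hWc
  exact this (denseRange_domEmb hT.dense_domain ψ)

/-- The graph of `∑ⱼ I ⊗ ⋯ ⊗ T ⊗ ⋯ ⊗ I` on the algebraic symmetric tensor power. -/
def algGraph (T : H →ₗ.[ℂ] H) (n : ℕ) : Submodule ℂ (symTensor H n × symTensor H n) :=
  LinearMap.range (((toSym H n).toLinearMap.comp (domEmb T n)).prod
    ((toSym H n).toLinearMap.comp (domSum T n)))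

theorem mem_algGraph {T : H →ₗ.[ℂ] H} {p : symTensor H n × symTensor H n} :
    p ∈ algGraph T n ↔ ∃ t, (toSym H n (domEmb T n t), toSym H n (domSum T n t)) = p := Iff.rfl

theorem span_eq_algGraph (T : H →ₗ.[ℂ] H) (n : ℕ) :
    Submodule.span ℂ (Set.range fun x : Fin n → T.domain =>
      (toSym H n (pureTensor fun i => (x i : H)),
        ∑ j, toSym H n (pureTensor (Function.update (fun i => (x i : H)) j (T (x j)))))) =
      algGraph T n := by
  refine le_antisymm (Submodule.span_le.2 ?_) ?_
  · rintro _ ⟨x, rfl⟩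
    refine mem_algGraph.2 ⟨algTprod x, ?_⟩
    rw [domEmb_algTprod, domSum_algTprod, map_sum]
  · rintro _ ⟨t, rfl⟩
    induction t using algTensor_induction with
    | smul_tprod c x =>
      rw [map_smul]
      refine Submodule.smul_mem _ c (Submodule.subset_span ⟨x, ?_⟩)
      change _ = (toSym H n (domEmb T n (algTprod x)), toSym H n (domSum T n (algTprod x)))
      rw [domEmb_algTprod, domSum_algTprod, map_sum]
    | add s t hs ht =>
      rw [map_add]
      exact Submodule.add_mem _ hs ht

/-- Every element of `algGraph T n` comes from a symmetric algebraic tensor. -/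
theorem exists_sym_of_mem_algGraph {T : H →ₗ.[ℂ] H} {p : symTensor H n × symTensor H n}
    (hp : p ∈ algGraph T n) : ∃ t : AlgTensor T.domain n, (∀ σ, algPerm σ t = t) ∧
      (p.1 : HTensor H n) = domEmb T n t ∧ (p.2 : HTensor H n) = domSum T n t := by
  obtain ⟨t, rfl⟩ := mem_algGraph.1 hp
  exact ⟨algSym t, fun σ => algPerm_algSym σ t, symmetrizer_domEmb T t, symmetrizer_domSum T t⟩

theorem algGraph_symm {T : H →ₗ.[ℂ] H} (hs : SymmGraph T.graph) (n : ℕ) :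
    SymmGraph (algGraph T n) := by
  intro p hp q hq
  obtain ⟨s, -, hs1, hs2⟩ := exists_sym_of_mem_algGraph hp
  obtain ⟨t, -, ht1, ht2⟩ := exists_sym_of_mem_algGraph hq
  rw [Submodule.coe_inner, Submodule.coe_inner, hs1, hs2, ht1, ht2]
  exact inner_domSum hs s t

theorem toSym_surjective : Function.Surjective (toSym H n) := fun ψ => ⟨ψ, toSym_coe ψ⟩

theorem dense_fst_algGraph {T : H →ₗ.[ℂ] H} (hd : Dense (T.domain : Set H)) :
    Dense (Prod.fst '' (algGraph T n : Set (symTensor H n × symTensor H n))) := by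
  have h1 : DenseRange (toSym H n ∘ domEmb T n) :=
    toSym_surjective.denseRange.comp (denseRange_domEmb hd) (toSym H n).continuous
  refine h1.mono ?_
  rintro _ ⟨t, rfl⟩
  exact ⟨_, ⟨t, rfl⟩, rfl⟩

theorem dGammaN_graph {T : H →ₗ.[ℂ] H} (hd : Dense (T.domain : Set H)) (hs : SymmGraph T.graph)
    (n : ℕ) : (dGammaN T n).graph = (algGraph T n).topologicalClosure := by
  unfold dGammaN
  rw [span_eq_algGraph]
  refine Submodule.toLinearPMap_graph_eq _ fun p hp hp0 => ?_
  have hsym := (algGraph_symm hs n).topologicalClosure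
  refine (dense_fst_algGraph hd).eq_zero_of_inner_left ℂ ?_
  rintro _ ⟨q, hq, rfl⟩
  rw [hsym p hp q (Submodule.le_topologicalClosure _ hq), hp0, inner_zero_left]

theorem algGraph_le_dGammaN {T : H →ₗ.[ℂ] H} (hd : Dense (T.domain : Set H))
    (hs : SymmGraph T.graph) (n : ℕ) : algGraph T n ≤ (dGammaN T n).graph := by
  rw [dGammaN_graph hd hs]
  exact Submodule.le_topologicalClosure _

variable [CompleteSpace H]

theorem isNonneg_dGammaN {T : H →ₗ.[ℂ] H} (hT : IsSelfAdjoint T) (hT0 : IsNonneg T) (n : ℕ) :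
    IsNonneg (dGammaN T n) := by
  refine isNonneg_of_graph fun p hp => ?_
  rw [dGammaN_graph hT.dense_domain hT.symmGraph] at hp
  refine closure_minimal (s := (algGraph T n : Set (symTensor H n × symTensor H n)))
    (t := {p | 0 ≤ (inner ℂ p.1 p.2).re}) (fun p hp => ?_)
    (isClosed_le continuous_const (Complex.continuous_re.comp (by fun_prop))) hp
  obtain ⟨t, -, ht1, ht2⟩ := exists_sym_of_mem_algGraph hp
  change 0 ≤ (inner ℂ (p.1 : HTensor H n) (p.2 : HTensor H n)).re
  rw [ht1, ht2]
  exact re_inner_domSum_nonneg (isSqrt_opSqrt hT hT0) t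

theorem dGammaN_isClosed {T : H →ₗ.[ℂ] H} (hT : IsSelfAdjoint T) (n : ℕ) :
    IsClosed ((dGammaN T n).graph : Set (symTensor H n × symTensor H n)) := by
  rw [dGammaN_graph hT.dense_domain hT.symmGraph]
  exact Submodule.isClosed_topologicalClosure _

theorem exists_dGammaN_add {T : H →ₗ.[ℂ] H} (hT : IsSelfAdjoint T) (hT0 : IsNonneg T) (n : ℕ)
    (z : symTensor H n) : ∃ p ∈ (dGammaN T n).graph, p.2 - ((-1 : ℝ) : ℂ) • p.1 = z := by
  refine exists_sub_eq (dGammaN_isClosed hT n) one_pos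
    (fun p hp => le_norm_add_of_nonneg ((isNonneg_dGammaN hT hT0 n).re_inner_nonneg hp)
      zero_le_one) (fun y hy => ?_) z
  have h1 : DenseRange (toSym H n ∘ (domEmb T n + domSum T n)) :=
    toSym_surjective.denseRange.comp (denseRange_domEmb_add_domSum hT hT0 n) (toSym H n).continuous
  refine h1.eq_zero_of_inner_right ℂ fun t => ?_
  have h2 := hy _ (algGraph_le_dGammaN hT.dense_domain hT.symmGraph n (mem_algGraph.2 ⟨t, rfl⟩))
  simp only [Complex.ofReal_neg, Complex.ofReal_one, neg_smul, one_smul, sub_neg_eq_add] at h2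
  rw [Function.comp_apply, LinearMap.add_apply, map_add, add_comm]
  exact h2

theorem isSelfAdjoint_dGammaN {T : H →ₗ.[ℂ] H} (hT : IsSelfAdjoint T) (hT0 : IsNonneg T) (n : ℕ) :
    IsSelfAdjoint (dGammaN T n) := by
  refine isSelfAdjoint_of_surjective ?_ ?_ ((-1 : ℝ) : ℂ) (exists_dGammaN_add hT hT0 n) ?_
  · refine (dense_fst_algGraph (n := n) hT.dense_domain).mono ?_
    rintro _ ⟨p, hp, rfl⟩
    exact LinearPMap.mem_domain_of_mem_graph (y := p.2)
      (algGraph_le_dGammaN hT.dense_domain hT.symmGraph n hp)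
  · rw [dGammaN_graph hT.dense_domain hT.symmGraph]
    exact (algGraph_symm hT.symmGraph n).topologicalClosure
  · rw [Complex.conj_ofReal]
    exact exists_dGammaN_add hT hT0 n

end NParticle

/-! ### Creation and annihilation operators between particle sectors -/

section CreationN

open Filter Topology

variable {H : Type*} [NormedAddCommGroup H] [InnerProductSpace ℂ H] {n : ℕ}

theorem symTensor_inner_smul_right (x y : symTensor H n) (r : ℂ) :
    inner ℂ x (r • y) = r * inner ℂ x y := inner_smul_right x y r

theorem symTensor_inner_smul_left (x y : symTensor H n) (r : ℂ) :
    inner ℂ (r • x) y = starRingEnd ℂ r * inner ℂ x y := inner_smul_left x y r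

theorem symTensor_norm_inner_self (x : symTensor H n) : ‖(inner ℂ x x : ℂ)‖ = ‖x‖ ^ 2 := by
  rw [inner_self_eq_norm_sq_to_K (𝕜 := ℂ) x]
  simp

theorem inner_toSym_right (φ : HTensor H n) (ψ : symTensor H n) :
    inner ℂ ψ (toSym H n φ) = inner ℂ (ψ : HTensor H n) φ := by
  rw [← inner_conj_symm (𝕜 := ℂ) ψ, inner_toSym, inner_conj_symm]

/-- The permutation of `Fin (n + 1)` that fixes `0` and acts as `e` on the rest. -/
def liftPerm (e : Equiv.Perm (Fin n)) : Equiv.Perm (Fin (n + 1)) :=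
  Equiv.Perm.decomposeFin.symm (0, e)

@[simp]
theorem liftPerm_zero (e : Equiv.Perm (Fin n)) : liftPerm e 0 = 0 := by
  simp [liftPerm]

@[simp]
theorem liftPerm_succ (e : Equiv.Perm (Fin n)) (i : Fin n) : liftPerm e i.succ = (e i).succ := by
  simp [liftPerm]

theorem decomposeFin_symm_eq (p : Fin (n + 1)) (e : Equiv.Perm (Fin n)) :
    Equiv.Perm.decomposeFin.symm (p, e) = Equiv.swap 0 p * liftPerm e := by
  ext i
  refine Fin.cases ?_ (fun i => ?_) i <;> simp

theorem consTensor_permOp (f : H) (e : Equiv.Perm (Fin n)) (φ : HTensor H n) :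
    consTensor f (permOp e φ) = permOp (liftPerm e) (consTensor f φ) := by
  refine hTensor_ext (φ := (consTensor f).comp (permOp e))
    (ψ := (permOp (liftPerm e)).comp (consTensor f)) (fun x => ?_) φ
  simp only [ContinuousLinearMap.comp_apply, permOp_pureTensor, consTensor_pureTensor]
  congr 1
  funext i
  refine Fin.cases ?_ (fun i => ?_) i <;> simp

theorem symmetrizer_permOp (σ : Equiv.Perm (Fin n)) (φ : HTensor H n) :
    symmetrizer H n (permOp σ φ) = symmetrizer H n φ := by
  simp only [symmetrizer, smul_apply, sum_apply, permOp_permOp]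
  congr 1
  exact Equiv.sum_comp (Equiv.mulLeft σ) fun τ => permOp τ φ

theorem symmetrizer_consTensor_symmetrizer (f : H) (φ : HTensor H n) :
    symmetrizer H (n + 1) (consTensor f (symmetrizer H n φ)) =
      symmetrizer H (n + 1) (consTensor f φ) := by
  have h0 : (n.factorial : ℂ) ≠ 0 := by exact_mod_cast n.factorial_ne_zero
  have e : symmetrizer H n φ = ((n.factorial : ℂ)⁻¹) • ∑ σ : Equiv.Perm (Fin n), permOp σ φ := by
    simp [symmetrizer]
  rw [e]
  simp only [map_smul, map_sum, consTensor_permOp, symmetrizer_permOp]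
  simp [Fintype.card_perm, ← Nat.cast_smul_eq_nsmul ℂ, smul_smul, h0]

theorem consTensor_consTensor_swap (f g : H) (φ : HTensor H n) :
    permOp (Equiv.swap 0 1) (consTensor f (consTensor g φ)) = consTensor g (consTensor f φ) := by
  refine hTensor_ext (φ := (permOp (Equiv.swap 0 1)).comp ((consTensor f).comp (consTensor g)))
    (ψ := (consTensor g).comp (consTensor f)) (fun x => ?_) φ
  simp only [ContinuousLinearMap.comp_apply, permOp_pureTensor, consTensor_pureTensor]
  congr 1
  funext i
  refine Fin.cases ?_ (fun i => ?_) i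
  · simp
  · refine Fin.cases ?_ (fun i => ?_) i
    · rw [Fin.succ_zero_eq_one, Equiv.swap_apply_right]
      rfl
    · rw [Equiv.swap_apply_of_ne_of_ne (Fin.succ_ne_zero _) (by simp [Fin.ext_iff])]
      simp

theorem inner_consTensor (f g : H) (φ ψ : HTensor H n) :
    inner ℂ (consTensor f φ) (consTensor g ψ) = inner ℂ f g * inner ℂ φ ψ := by
  have h := hTensor_inner_ext (φ := consTensor f) (φ' := consTensor g)
    (ψ := ContinuousLinearMap.id ℂ (HTensor H n))
    (ψ' := inner ℂ f g • ContinuousLinearMap.id ℂ (HTensor H n)) (fun x y => by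
      rw [consTensor_pureTensor, consTensor_pureTensor, inner_pureTensor, Fin.prod_univ_succ]
      simp only [Fin.cons_zero, Fin.cons_succ]
      change _ = inner ℂ (pureTensor x) (inner ℂ f g • pureTensor y)
      rw [inner_smul_right, inner_pureTensor]) φ ψ
  rw [h]
  exact inner_smul_right _ _ _

theorem norm_consTensor (f : H) (φ : HTensor H n) : ‖consTensor f φ‖ = ‖f‖ * ‖φ‖ := by
  have h : ‖consTensor f φ‖ ^ 2 = (‖f‖ * ‖φ‖) ^ 2 := by
    have h1 := inner_consTensor f f φ φ
    simp only [inner_self_eq_norm_sq_to_K] at h1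
    rw [mul_pow]
    exact_mod_cast h1
  exact (sq_eq_sq₀ (norm_nonneg _) (by positivity)).1 h

theorem consTensor_sub (f g : H) (φ : HTensor H n) :
    consTensor (f - g) φ = consTensor f φ - consTensor g φ := by
  refine hTensor_ext (φ := consTensor (f - g)) (ψ := consTensor f - consTensor g) (fun x => ?_) φ
  change consTensor (f - g) (toHT (algTprod x)) =
    consTensor f (toHT (algTprod x)) - consTensor g (toHT (algTprod x))
  rw [consTensor_toHT, consTensor_toHT, consTensor_toHT, ← map_sub]
  congr 1
  simp only [algConsTensor, algLift_algTprod]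
  rw [map_sub, sub_apply]

theorem norm_toSym_le (φ : HTensor H n) : ‖toSym H n φ‖ ≤ ‖φ‖ := by
  have h1 := inner_toSym φ (toSym H n φ)
  have h2 : ‖toSym H n φ‖ ^ 2 ≤ ‖φ‖ * ‖toSym H n φ‖ := by
    rw [← symTensor_norm_inner_self, h1]
    exact norm_inner_le_norm _ _
  by_contra h
  push Not at h
  nlinarith [norm_nonneg φ]

/-- The creation operator `⊗ₛⁿ H → ⊗ₛⁿ⁺¹ H`. -/
def creN (f : H) (n : ℕ) : symTensor H n →L[ℂ] symTensor H (n + 1) :=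
  ((√((n : ℝ) + 1) : ℝ) : ℂ) • (toSym H (n + 1)).comp ((consTensor f).comp (symTensor H n).subtypeL)

theorem creN_apply (f : H) (φ : symTensor H n) : creN f n φ =
    ((√((n : ℝ) + 1) : ℝ) : ℂ) • toSym H (n + 1) (consTensor f (φ : HTensor H n)) := rfl

/-- The annihilation operator `⊗ₛⁿ⁺¹ H → ⊗ₛⁿ H`. -/
def annN (f : H) (n : ℕ) : symTensor H (n + 1) →L[ℂ] symTensor H n := (creN f n).adjoint

theorem inner_annN (f : H) (φ : symTensor H (n + 1)) (ψ : symTensor H n) :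
    inner ℂ (annN f n φ) ψ = inner ℂ φ (creN f n ψ) :=
  ContinuousLinearMap.adjoint_inner_left _ _ _

theorem inner_creN (f : H) (φ : symTensor H n) (ψ : symTensor H (n + 1)) :
    inner ℂ (creN f n φ) ψ = inner ℂ φ (annN f n ψ) :=
  (ContinuousLinearMap.adjoint_inner_right _ _ _).symm

theorem creN_sub (f g : H) (φ : symTensor H n) : creN (f - g) n φ = creN f n φ - creN g n φ := by
  rw [creN_apply, creN_apply, creN_apply, consTensor_sub, map_sub, smul_sub]

theorem norm_creN_le (f : H) (φ : symTensor H n) :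
    ‖creN f n φ‖ ≤ √((n : ℝ) + 1) * ‖φ‖ * ‖f‖ := by
  rw [creN_apply, norm_smul, Complex.norm_real, Real.norm_eq_abs, abs_of_nonneg (Real.sqrt_nonneg _),
    mul_assoc]
  gcongr
  refine (norm_toSym_le _).trans ?_
  rw [norm_consTensor, mul_comm]
  exact le_rfl

theorem continuous_creN (φ : symTensor H n) : Continuous fun f : H => creN f n φ := by
  have : LipschitzWith (Real.toNNReal (√((n : ℝ) + 1) * ‖φ‖)) fun f : H => creN f n φ := by
    refine LipschitzWith.of_dist_le_mul fun f g => ?_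
    rw [dist_eq_norm, dist_eq_norm, ← creN_sub, Real.coe_toNNReal _ (by positivity)]
    exact norm_creN_le _ _
  exact this.continuous

theorem creN_comm (f g : H) (φ : symTensor H n) :
    creN f (n + 1) (creN g n φ) = creN g (n + 1) (creN f n φ) := by
  have key : ∀ f g : H, toSym H (n + 2) (consTensor f
      ((toSym H (n + 1) (consTensor g (φ : HTensor H n)) : symTensor H (n + 1)) :
        HTensor H (n + 1))) =
      toSym H (n + 2) (consTensor f (consTensor g (φ : HTensor H n))) :=
    fun f g => Subtype.ext (symmetrizer_consTensor_symmetrizer f _)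
  have key2 : toSym H (n + 2) (consTensor f (consTensor g (φ : HTensor H n))) =
      toSym H (n + 2) (consTensor g (consTensor f (φ : HTensor H n))) := by
    refine Subtype.ext ?_
    change symmetrizer H (n + 2) _ = symmetrizer H (n + 2) _
    rw [← consTensor_consTensor_swap, symmetrizer_permOp]
  simp only [creN_apply f, creN_apply g, map_smul, Submodule.coe_smul]
  rw [key, key, key2]

/-- The contraction of the first factor with `f`. -/
def contract (f : H) (n : ℕ) : HTensor H (n + 1) →L[ℂ] HTensor H n :=
  (consTensor f).adjoint

theorem inner_contract (f : H) (φ : HTensor H (n + 1)) (ψ : HTensor H n) :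
    inner ℂ (contract f n φ) ψ = inner ℂ φ (consTensor f ψ) :=
  ContinuousLinearMap.adjoint_inner_left _ _ _

theorem contract_pureTensor (f : H) (x : Fin (n + 1) → H) :
    contract f n (pureTensor x) = inner ℂ f (x 0) • pureTensor fun i => x i.succ := by
  refine ext_inner_right ℂ fun ψ => ?_
  rw [inner_contract]
  refine hTensor_ext (φ := (innerSL ℂ (pureTensor x)).comp (consTensor f))
    (ψ := innerSL ℂ (inner ℂ f (x 0) • pureTensor fun i => x i.succ)) (fun y => ?_) ψ
  simp only [ContinuousLinearMap.comp_apply, innerSL_apply_apply, consTensor_pureTensor,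
    inner_smul_left, inner_pureTensor, Fin.prod_univ_succ, Fin.cons_zero, Fin.cons_succ,
    inner_conj_symm]

theorem contract_mem (f : H) (ψ : symTensor H (n + 1)) :
    contract f n (ψ : HTensor H (n + 1)) ∈ symTensor H n := by
  rw [mem_symTensor]
  intro σ
  refine ext_inner_right ℂ fun φ => ?_
  rw [inner_permOp_left, inner_contract, inner_contract, consTensor_permOp, ← inv_inv (liftPerm _),
    ← inner_permOp_left, mem_symTensor.1 ψ.2]

theorem annN_apply (f : H) (ψ : symTensor H (n + 1)) : ((annN f n ψ : symTensor H n) : HTensor H n) =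
    ((√((n : ℝ) + 1) : ℝ) : ℂ) • contract f n (ψ : HTensor H (n + 1)) := by
  have h : annN f n ψ = ((√((n : ℝ) + 1) : ℝ) : ℂ) •
      (⟨contract f n (ψ : HTensor H (n + 1)), contract_mem f ψ⟩ : symTensor H n) := by
    refine ext_inner_right ℂ fun φ => ?_
    rw [inner_annN, creN_apply, symTensor_inner_smul_right, symTensor_inner_smul_left,
      Complex.conj_ofReal, inner_toSym_right]
    congr 1
    exact (inner_contract f _ _).symm
  rw [h]
  rfl

theorem inner_swap_consTensor (f g : H) (φ ψ : HTensor H (n + 1)) :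
    inner ℂ (permOp (Equiv.swap 0 1) (consTensor f φ)) (consTensor g ψ) =
      inner ℂ (contract g n φ) (contract f n ψ) := by
  refine hTensor_inner_ext (φ := (permOp (Equiv.swap 0 1)).comp (consTensor f))
    (φ' := consTensor g) (ψ := contract g n) (ψ' := contract f n) (fun x y => ?_) φ ψ
  have e : permOp (Equiv.swap 0 1) (consTensor f (pureTensor x)) =
      consTensor (x 0) (consTensor f (pureTensor fun i => x i.succ)) := by
    have : pureTensor x = consTensor (x 0) (pureTensor fun i => x i.succ) := by
      rw [consTensor_pureTensor]
      congr 1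
      exact (Fin.cons_self_tail x).symm
    rw [this, consTensor_consTensor_swap]
  have e2 : pureTensor y = consTensor (y 0) (pureTensor fun i => y i.succ) := by
    rw [consTensor_pureTensor]
    congr 1
    exact (Fin.cons_self_tail y).symm
  rw [ContinuousLinearMap.comp_apply, e, contract_pureTensor, contract_pureTensor, e2,
    inner_consTensor, inner_consTensor, inner_smul_left, inner_smul_right, inner_conj_symm]

theorem inner_creN_creN_eq_sum (f g : H) (φ ψ : symTensor H n) :
    inner ℂ (creN f n φ) (creN g n ψ) = ∑ p : Fin (n + 1),
      inner ℂ (permOp (Equiv.swap 0 p) (consTensor f (φ : HTensor H n)))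
        (consTensor g (ψ : HTensor H n)) := by
  have hψ : ∀ e : Equiv.Perm (Fin n), permOp (liftPerm e) (consTensor g (ψ : HTensor H n)) =
      consTensor g (ψ : HTensor H n) := fun e => by
    rw [← consTensor_permOp, mem_symTensor.1 ψ.2]
  have hψ' : ∀ e : Equiv.Perm (Fin n), permOp (liftPerm e)⁻¹ (consTensor g (ψ : HTensor H n)) =
      consTensor g (ψ : HTensor H n) := fun e => by
    conv_lhs => rw [← hψ e]
    rw [permOp_permOp, mul_inv_cancel, permOp_one]
  have h1 : ∀ (p : Fin (n + 1)) (e : Equiv.Perm (Fin n)),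
      inner ℂ (permOp (Equiv.Perm.decomposeFin.symm (p, e)) (consTensor f (φ : HTensor H n)))
        (consTensor g (ψ : HTensor H n)) =
      inner ℂ (permOp (Equiv.swap 0 p) (consTensor f (φ : HTensor H n)))
        (consTensor g (ψ : HTensor H n)) := by
    intro p e
    rw [decomposeFin_symm_eq, ← permOp_permOp, inner_permOp_left, hψ']
  have h2 : inner ℂ (toSym H (n + 1) (consTensor f (φ : HTensor H n)))
      (toSym H (n + 1) (consTensor g (ψ : HTensor H n))) =
      (((n + 1).factorial : ℂ)⁻¹) * ((n.factorial : ℂ) * ∑ p : Fin (n + 1),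
      inner ℂ (permOp (Equiv.swap 0 p) (consTensor f (φ : HTensor H n)))
        (consTensor g (ψ : HTensor H n))) := by
    rw [inner_toSym_right]
    change inner ℂ (symmetrizer H (n + 1) _) _ = _
    simp only [symmetrizer, smul_apply, sum_apply, inner_smul_left, sum_inner]
    rw [← Equiv.sum_comp Equiv.Perm.decomposeFin.symm, Fintype.sum_prod_type]
    simp only [h1, Finset.sum_const, Finset.card_univ, Fintype.card_perm, Fintype.card_fin,
      nsmul_eq_mul]
    simp [Finset.mul_sum]
  rw [creN_apply, creN_apply, symTensor_inner_smul_left, symTensor_inner_smul_right, h2,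
    Complex.conj_ofReal,
    ← mul_assoc, ← Complex.ofReal_mul, Real.mul_self_sqrt (by positivity), ← mul_assoc, ← mul_assoc]
  have h0 : (n.factorial : ℂ) ≠ 0 := by exact_mod_cast n.factorial_ne_zero
  have h3 : ((n : ℂ) + 1) ≠ 0 := by exact_mod_cast Nat.succ_ne_zero n
  have h4 : (((n : ℝ) + 1 : ℝ) : ℂ) * (((n + 1).factorial : ℂ)⁻¹) * (n.factorial : ℂ) = 1 := by
    rw [Nat.factorial_succ]
    push_cast
    field_simp
  rw [h4, one_mul]

theorem inner_creN_creN_zero (f g : H) (φ ψ : symTensor H 0) :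
    inner ℂ (creN f 0 φ) (creN g 0 ψ) = inner ℂ f g * inner ℂ φ ψ := by
  rw [inner_creN_creN_eq_sum]
  rw [Fin.sum_univ_succ, Fin.sum_univ_zero, add_zero, Equiv.swap_self]
  change inner ℂ (permOp 1 _) _ = _
  rw [permOp_one, inner_consTensor]
  rfl

theorem inner_creN_creN_succ (f g : H) (φ ψ : symTensor H (n + 1)) :
    inner ℂ (creN f (n + 1) φ) (creN g (n + 1) ψ) =
      inner ℂ f g * inner ℂ φ ψ + inner ℂ (annN g n φ) (annN f n ψ) := by
  rw [inner_creN_creN_eq_sum, Fin.sum_univ_succ]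
  congr 1
  · rw [Equiv.swap_self]
    change inner ℂ (permOp 1 _) _ = _
    rw [permOp_one, inner_consTensor]
    rfl
  · have h1 : ∀ j : Fin (n + 1), inner ℂ (permOp (Equiv.swap 0 j.succ)
        (consTensor f (φ : HTensor H (n + 1)))) (consTensor g (ψ : HTensor H (n + 1))) =
        inner ℂ (contract g n (φ : HTensor H (n + 1))) (contract f n (ψ : HTensor H (n + 1))) := by
      intro j
      have hfix : ∀ (h : H) (χ : symTensor H (n + 1)) (e : Equiv.Perm (Fin (n + 1))),
          permOp (liftPerm e) (consTensor h (χ : HTensor H (n + 1))) =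
          consTensor h (χ : HTensor H (n + 1)) := fun h χ e => by
        rw [← consTensor_permOp, mem_symTensor.1 χ.2]
      have e1 : Equiv.swap (0 : Fin (n + 2)) j.succ =
          liftPerm (Equiv.swap 0 j) * Equiv.swap 0 1 * liftPerm (Equiv.swap 0 j) := by
        have e2 : liftPerm (Equiv.swap (0 : Fin (n + 1)) j) =
            (liftPerm (Equiv.swap (0 : Fin (n + 1)) j))⁻¹ := by
          rw [eq_comm, inv_eq_iff_mul_eq_one]
          ext i
          refine Fin.cases ?_ (fun i => ?_) i <;> simp
        conv_rhs => rw [e2]; arg 2; rw [e2, inv_inv]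
        rw [← e2]
        nth_rw 2 [e2]
        rw [Equiv.mul_swap_eq_swap_mul, mul_assoc, mul_inv_cancel, mul_one, liftPerm_zero,
          ← Fin.succ_zero_eq_one, liftPerm_succ, Equiv.swap_apply_left]
      rw [e1, mul_assoc, ← permOp_permOp, ← permOp_permOp, hfix, inner_permOp_left]
      have e3 : (liftPerm (Equiv.swap (0 : Fin (n + 1)) j))⁻¹ =
          liftPerm (Equiv.swap (0 : Fin (n + 1)) j) := by
        rw [inv_eq_iff_mul_eq_one]
        ext i
        refine Fin.cases ?_ (fun i => ?_) i <;> simp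
      rw [e3, hfix, inner_swap_consTensor]
    simp only [h1, Finset.sum_const, Finset.card_univ, Fintype.card_fin, nsmul_eq_mul]
    rw [Submodule.coe_inner, annN_apply, annN_apply, inner_smul_left, inner_smul_right,
      Complex.conj_ofReal, ← mul_assoc, ← Complex.ofReal_mul, Real.mul_self_sqrt (by positivity)]
    push_cast
    rfl

theorem annN_creN_zero (f g : H) (ψ : symTensor H 0) :
    annN f 0 (creN g 0 ψ) = inner ℂ f g • ψ := by
  refine ext_inner_left ℂ fun φ => ?_
  rw [← inner_creN, inner_creN_creN_zero, symTensor_inner_smul_right]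

/-- The canonical commutation relations. -/
theorem annN_creN_succ (f g : H) (ψ : symTensor H (n + 1)) :
    annN f (n + 1) (creN g (n + 1) ψ) = creN g n (annN f n ψ) + inner ℂ f g • ψ := by
  refine ext_inner_left ℂ fun φ => ?_
  rw [← inner_creN, inner_creN_creN_succ, inner_add_right, symTensor_inner_smul_right,
    inner_annN, add_comm]

/-! ### Commutation with the second quantization -/

theorem domEmb_algConsTensor (T : H →ₗ.[ℂ] H) (h : T.domain) (t : AlgTensor T.domain n) :
    domEmb T (n + 1) (algConsTensor h t) = consTensor (h : H) (domEmb T n t) := by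
  refine algTensor_ext (φ := (domEmb T (n + 1)).comp (algConsTensor h))
    (ψ := (consTensor (h : H)).toLinearMap.comp (domEmb T n)) (fun x => ?_) t
  change domEmb T (n + 1) (algConsTensor h (algTprod x)) =
    consTensor (h : H) (domEmb T n (algTprod x))
  rw [algConsTensor_algTprod, domEmb_algTprod, domEmb_algTprod, consTensor_pureTensor]
  congr 1
  funext i
  refine Fin.cases ?_ (fun i => ?_) i <;> simp

theorem domSum_algConsTensor (T : H →ₗ.[ℂ] H) (h : T.domain) (t : AlgTensor T.domain n) :
    domSum T (n + 1) (algConsTensor h t) =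
      consTensor (T h) (domEmb T n t) + consTensor (h : H) (domSum T n t) := by
  refine algTensor_ext (φ := (domSum T (n + 1)).comp (algConsTensor h))
    (ψ := (consTensor (T h)).toLinearMap.comp (domEmb T n) +
      (consTensor (h : H)).toLinearMap.comp (domSum T n)) (fun x => ?_) t
  change domSum T (n + 1) (algConsTensor h (algTprod x)) =
    consTensor (T h) (domEmb T n (algTprod x)) + consTensor (h : H) (domSum T n (algTprod x))
  rw [algConsTensor_algTprod, domSum_algTprod, domEmb_algTprod, domSum_algTprod,
    consTensor_pureTensor, Fin.sum_univ_succ, map_sum]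
  have e : (fun i => ((Fin.cons h x : Fin (n + 1) → T.domain) i : H)) =
      (Fin.cons (h : H) fun i => (x i : H) : Fin (n + 1) → H) := by
    funext i
    refine Fin.cases ?_ (fun i => ?_) i <;> simp
  rw [e]
  congr 1
  · rw [Fin.cons_zero, Fin.update_cons_zero]
  · refine Finset.sum_congr rfl fun j _ => ?_
    rw [consTensor_pureTensor, Fin.cons_succ, Fin.cons_update]

theorem creN_mem_graph {T : H →ₗ.[ℂ] H} (hd : Dense (T.domain : Set H)) (hs : SymmGraph T.graph)
    {h k : H} (hk : (h, k) ∈ T.graph) {p : symTensor H n × symTensor H n}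
    (hp : p ∈ (dGammaN T n).graph) :
    (creN h n p.1, creN h n p.2 + creN k n p.1) ∈ (dGammaN T (n + 1)).graph := by
  rw [dGammaN_graph hd hs] at hp ⊢
  have hc : Continuous fun p : symTensor H n × symTensor H n =>
      (creN h n p.1, creN h n p.2 + creN k n p.1) :=
    ((creN h n).continuous.comp continuous_fst).prodMk
      (((creN h n).continuous.comp continuous_snd).add ((creN k n).continuous.comp continuous_fst))
  refine map_mem_closure (f := fun p : symTensor H n × symTensor H n =>
    (creN h n p.1, creN h n p.2 + creN k n p.1)) (s := (algGraph T n : Set _))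
    (t := (algGraph T (n + 1) : Set _)) hc hp fun p hp => ?_
  obtain ⟨h', rfl, rfl⟩ := (LinearPMap.mem_graph_iff _).1 hk
  obtain ⟨t, -, ht1, ht2⟩ := exists_sym_of_mem_algGraph hp
  refine mem_algGraph.2 ⟨((√((n : ℝ) + 1) : ℝ) : ℂ) • algConsTensor h' t, Prod.ext ?_ ?_⟩
  · simp only [map_smul]
    rw [domEmb_algConsTensor, creN_apply, ht1]
  · simp only [map_smul]
    rw [domSum_algConsTensor, creN_apply, creN_apply, ht1, ht2, map_add, smul_add]
    exact add_comm _ _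

theorem inner_domEmb_consTensor {S T : H →ₗ.[ℂ] H} (hS : SymmGraph S.graph)
    {L : T.domain →ₗ[ℂ] H} (hL : ∀ x : T.domain, ((x : H), L x) ∈ S.graph) {u h : H}
    (hu : (u, h) ∈ S.graph) (t : AlgTensor T.domain (n + 1)) (φ : HTensor H n) :
    inner ℂ (domEmb T (n + 1) t) (consTensor h φ) =
      inner ℂ (toHT (slot T.domain.subtype L 0 t)) (consTensor u φ) := by
  refine hTensor_ext (φ := (innerSL ℂ (domEmb T (n + 1) t)).comp (consTensor h))
    (ψ := (innerSL ℂ (toHT (slot T.domain.subtype L 0 t))).comp (consTensor u)) (fun y => ?_) φ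
  simp only [ContinuousLinearMap.comp_apply, innerSL_apply_apply, consTensor_pureTensor]
  induction t using algTensor_induction with
  | smul_tprod c x =>
    simp only [map_smul, inner_smul_left]
    rw [domEmb_algTprod, slot_algTprod, toHT_algTprod, inner_pureTensor, inner_pureTensor,
      Fin.prod_univ_succ, Fin.prod_univ_succ]
    simp only [Fin.cons_zero, Fin.cons_succ, Function.update_self]
    congr 2
    exact (hS _ (hL (x 0)) _ hu).symm
  | add s t hs ht => simp only [map_add, inner_add_left, hs, ht]

variable [CompleteSpace H]

theorem annN_mem_graph {T : H →ₗ.[ℂ] H} (hT : IsSelfAdjoint T) (hT0 : IsNonneg T)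
    {h k : H} (hk : (h, k) ∈ T.graph) {p : symTensor H (n + 1) × symTensor H (n + 1)}
    (hp : p ∈ (dGammaN T (n + 1)).graph) :
    (annN h n p.1, annN h n p.2 - annN k n p.1) ∈ (dGammaN T n).graph := by
  rw [(isSelfAdjoint_dGammaN hT hT0 n).mem_graph_iff]
  intro q hq
  have h1 := creN_mem_graph hT.dense_domain hT.symmGraph hk hq
  have h2 := (isSelfAdjoint_dGammaN hT hT0 (n + 1)).symmGraph _ h1 _ hp
  simp only [inner_add_left] at h2
  rw [inner_sub_right, ← inner_creN, ← inner_creN, ← inner_creN, ← h2]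
  ring

/-- The fundamental bound `‖A(S u) ψ‖² ≤ ‖u‖² ⟨ψ, dΓ(S²) ψ⟩`. -/
theorem norm_annN_sq_le {S T : H →ₗ.[ℂ] H} (hT : IsSelfAdjoint T) (hS : IsSqrt S T) {u h : H}
    (hu : (u, h) ∈ S.graph) {p : symTensor H (n + 1) × symTensor H (n + 1)}
    (hp : p ∈ (dGammaN T (n + 1)).graph) :
    ‖annN h n p.1‖ ^ 2 ≤ ‖u‖ ^ 2 * (inner ℂ p.1 p.2).re := by
  rw [dGammaN_graph hT.dense_domain hT.symmGraph] at hp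
  refine closure_minimal (s := (algGraph T (n + 1) :
      Set (symTensor H (n + 1) × symTensor H (n + 1))))
    (t := {p | ‖annN h n p.1‖ ^ 2 ≤ ‖u‖ ^ 2 * (inner ℂ p.1 p.2).re}) (fun p hp => ?_)
    (isClosed_le (by fun_prop) ((Complex.continuous_re.comp (by fun_prop)).const_mul _)) hp
  obtain ⟨L, hL1, hL2⟩ := hS.exists_linearMap
  obtain ⟨t, ht, ht1, ht2⟩ := exists_sym_of_mem_algGraph hp
  set Z := slot T.domain.subtype L 0 t with hZ
  have h1 : ‖annN h n p.1‖ ≤ √((n : ℝ) + 1) * (‖u‖ * ‖Z‖) := by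
    set ψ := annN h n p.1 with hψ
    have e1 : inner ℂ ψ ψ = ((√((n : ℝ) + 1) : ℝ) : ℂ) *
        inner ℂ (toHT Z) (consTensor u (ψ : HTensor H n)) := by
      rw [hψ, inner_annN, creN_apply, symTensor_inner_smul_right, inner_toSym_right, ht1,
        inner_domEmb_consTensor hS.1.symmGraph hL1 hu]
    have e2 : ‖ψ‖ ^ 2 ≤ √((n : ℝ) + 1) * (‖u‖ * ‖Z‖) * ‖ψ‖ := by
      rw [← symTensor_norm_inner_self, e1, norm_mul, Complex.norm_real, Real.norm_eq_abs,
        abs_of_nonneg (Real.sqrt_nonneg _), mul_assoc]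
      gcongr
      refine (norm_inner_le_norm _ _).trans ?_
      rw [norm_toHT, norm_consTensor]
      exact le_of_eq (by rw [Submodule.coe_norm]; ring)
    by_contra hcon
    push Not at hcon
    nlinarith [norm_nonneg ψ, show 0 ≤ √((n : ℝ) + 1) * (‖u‖ * ‖Z‖) by positivity]
  have h2 : (inner ℂ p.1 p.2).re = ((n : ℝ) + 1) * ‖Z‖ ^ 2 := by
    rw [Submodule.coe_inner, ht1, ht2, domSum_apply, inner_sum, Complex.re_sum]
    have e1 : ∀ j : Fin (n + 1), (inner ℂ (domEmb T (n + 1) t)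
        (toHT (slot T.domain.subtype T.toFun j t))).re = ‖Z‖ ^ 2 := by
      intro j
      have e2 : inner ℂ (domEmb T (n + 1) t) (toHT (slot T.domain.subtype T.toFun j t)) =
          inner ℂ (domEmb T (n + 1) t) (toHT (slot T.domain.subtype T.toFun 0 t)) := by
        have e3 := algPerm_slot (Equiv.swap 0 j) T.domain.subtype T.toFun 0 t
        rw [Equiv.swap_apply_left, ht] at e3
        rw [← e3, ← permOp_toHT, ← inner_permOp (Equiv.swap 0 j), permOp_domEmb, ht]
      rw [e2, domEmb_apply, inner_toHT, ← slot_self _ 0, ← inner_slot (L := L) (M := L)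
        (fun x y => hL2 x y)]
      exact inner_self_eq_norm_sq (𝕜 := ℂ) Z
    simp [e1]
  change ‖annN h n p.1‖ ^ 2 ≤ ‖u‖ ^ 2 * (inner ℂ p.1 p.2).re
  rw [h2]
  calc ‖annN h n p.1‖ ^ 2 ≤ (√((n : ℝ) + 1) * (‖u‖ * ‖Z‖)) ^ 2 := by gcongr
    _ = ‖u‖ ^ 2 * (((n : ℝ) + 1) * ‖Z‖ ^ 2) := by
      rw [mul_pow, Real.sq_sqrt (by positivity)]
      ring

end CreationN

/-! ### The second quantization operator on Fock space -/

section SecondQuantization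

open Filter Topology

variable {H : Type*} [NormedAddCommGroup H] [InnerProductSpace ℂ H]

theorem mem_dGamma_graph {T : H →ₗ.[ℂ] H} {p : BosonFock H × BosonFock H} :
    p ∈ (dGamma T).graph ↔ ∀ n, (p.1 n, p.2 n) ∈ (dGammaN T n).graph := by
  rw [dGamma, directSum_graph]
  exact Iff.rfl

theorem re_inner_eq_tsum (ψ φ : BosonFock H) :
    (inner ℂ ψ φ).re = ∑' n, (inner ℂ (ψ n) (φ n)).re := by
  rw [lp.inner_eq_tsum]
  exact Complex.re_tsum (lp.summable_inner ψ φ)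

theorem summable_re_inner (ψ φ : BosonFock H) : Summable fun n => (inner ℂ (ψ n) (φ n)).re :=
  Complex.reCLM.summable (lp.summable_inner ψ φ)

theorem norm_sq_eq_tsum (ψ : BosonFock H) : ‖ψ‖ ^ 2 = ∑' n, ‖ψ n‖ ^ 2 := by
  have h := lp.norm_rpow_eq_tsum (p := 2) (by simp) ψ
  simpa using h

theorem summable_norm_sq (ψ : BosonFock H) : Summable fun n => ‖ψ n‖ ^ 2 := by
  simpa using (lp.memℓp ψ).summable (by simp)

variable (H) in
/-- The finite particle vectors. -/
def finVec : Submodule ℂ (BosonFock H) where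
  carrier := {ψ | ∃ N : ℕ, ∀ n, N ≤ n → ψ n = 0}
  add_mem' := by
    rintro ψ φ ⟨N, hN⟩ ⟨M, hM⟩
    refine ⟨max N M, fun n hn => ?_⟩
    rw [lp.coeFn_add, Pi.add_apply, hN n (le_of_max_le_left hn), hM n (le_of_max_le_right hn),
      add_zero]
  zero_mem' := ⟨0, fun _ _ => rfl⟩
  smul_mem' := by
    rintro c ψ ⟨N, hN⟩
    refine ⟨N, fun n hn => ?_⟩
    rw [lp.coeFn_smul, Pi.smul_apply, hN n hn, smul_zero]

theorem single_mem_finVec (n : ℕ) (a : symTensor H n) :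
    (lp.single 2 n a : BosonFock H) ∈ finVec H :=
  ⟨n + 1, fun m hm => by rw [lp.single_apply_ne _ _ _ (by omega)]⟩

theorem dense_finVec : Dense (finVec H : Set (BosonFock H)) := fun ψ =>
  mem_closure_of_tendsto (lp.hasSum_single (by simp) ψ)
    (Eventually.of_forall fun _ => Submodule.sum_mem _ fun n _ => single_mem_finVec n _)

theorem single_mem_dGamma_graph {T : H →ₗ.[ℂ] H} {n : ℕ} {a b : symTensor H n}
    (h : (a, b) ∈ (dGammaN T n).graph) :
    ((lp.single 2 n a : BosonFock H), (lp.single 2 n b : BosonFock H)) ∈ (dGamma T).graph := by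
  rw [mem_dGamma_graph]
  intro m
  by_cases hm : m = n
  · subst hm
    simpa only [lp.single_apply_self] using h
  · simp only [lp.single_apply_ne _ _ _ hm]
    exact Submodule.zero_mem _

theorem graphCore_dGamma (T : H →ₗ.[ℂ] H) :
    GraphCore (dGamma T) (finVec H ⊓ (dGamma T).domain) := by
  intro p hp
  have h := (lp.hasSum_single (by simp) p.1).prodMk (lp.hasSum_single (by simp) p.2)
  refine mem_closure_of_tendsto h (Eventually.of_forall fun s => ?_)
  have h1 : ∑ n ∈ s, ((lp.single 2 n (p.1 n) : BosonFock H), (lp.single 2 n (p.2 n) : BosonFock H))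
      ∈ (dGamma T).graph :=
    Submodule.sum_mem _ fun n _ => single_mem_dGamma_graph (mem_dGamma_graph.1 hp n)
  refine ⟨h1, ?_, LinearPMap.mem_domain_of_mem_graph
    (y := (∑ n ∈ s, ((lp.single 2 n (p.1 n) : BosonFock H),
      (lp.single 2 n (p.2 n) : BosonFock H))).2) h1⟩
  rw [Prod.fst_sum]
  exact Submodule.sum_mem _ fun n _ => single_mem_finVec n _

theorem mem_finVec_of_mem_graph {T : H →ₗ.[ℂ] H} {p : BosonFock H × BosonFock H}
    (hp : p ∈ (dGamma T).graph) (h : p.1 ∈ finVec H) : p.2 ∈ finVec H := by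
  obtain ⟨N, hN⟩ := h
  exact ⟨N, fun n hn => (dGammaN T n).graph_fst_eq_zero_snd (mem_dGamma_graph.1 hp n) (hN n hn)⟩

variable [CompleteSpace H]

theorem symmGraph_dGamma {T : H →ₗ.[ℂ] H} (hT : IsSelfAdjoint T) (hT0 : IsNonneg T) :
    SymmGraph (dGamma T).graph := by
  intro p hp q hq
  rw [lp.inner_eq_tsum, lp.inner_eq_tsum]
  exact tsum_congr fun n => (isSelfAdjoint_dGammaN hT hT0 n).symmGraph _ (mem_dGamma_graph.1 hp n) _
    (mem_dGamma_graph.1 hq n)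

theorem dGammaN_re_inner_nonneg {T : H →ₗ.[ℂ] H} (hT : IsSelfAdjoint T) (hT0 : IsNonneg T)
    {p : BosonFock H × BosonFock H} (hp : p ∈ (dGamma T).graph) (n : ℕ) :
    0 ≤ (inner ℂ (p.1 n) (p.2 n)).re := by
  have h := (isNonneg_dGammaN hT hT0 n).re_inner_nonneg (mem_dGamma_graph.1 hp n)
  exact h

theorem dGamma_re_inner_nonneg {T : H →ₗ.[ℂ] H} (hT : IsSelfAdjoint T) (hT0 : IsNonneg T)
    {p : BosonFock H × BosonFock H} (hp : p ∈ (dGamma T).graph) : 0 ≤ (inner ℂ p.1 p.2).re := by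
  rw [re_inner_eq_tsum]
  exact tsum_nonneg (dGammaN_re_inner_nonneg hT hT0 hp)

theorem isNonneg_dGamma {T : H →ₗ.[ℂ] H} (hT : IsSelfAdjoint T) (hT0 : IsNonneg T) :
    IsNonneg (dGamma T) :=
  isNonneg_of_graph fun _ hp => dGamma_re_inner_nonneg hT hT0 hp

theorem exists_dGamma_add {T : H →ₗ.[ℂ] H} (hT : IsSelfAdjoint T) (hT0 : IsNonneg T)
    (z : BosonFock H) : ∃ p ∈ (dGamma T).graph, p.2 - ((-1 : ℝ) : ℂ) • p.1 = z := by
  choose p hp hpz using fun n => exists_dGammaN_add hT hT0 n (z n)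
  have h1 : ∀ n, ‖(p n).1‖ ≤ ‖z n‖ := fun n => by
    have := le_norm_add_of_nonneg ((isNonneg_dGammaN hT hT0 n).re_inner_nonneg (hp n)) zero_le_one
    rwa [hpz, one_mul] at this
  let x : BosonFock H := ⟨fun n => (p n).1, (lp.memℓp z).mono' h1⟩
  refine ⟨(x, z - x), mem_dGamma_graph.2 fun n => ?_, ?_⟩
  · have e : (z - x : BosonFock H) n = (p n).2 := by
      rw [lp.coeFn_sub, Pi.sub_apply, ← hpz n]
      change (p n).2 - ((-1 : ℝ) : ℂ) • (p n).1 - (p n).1 = _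
      push_cast
      module
    simp only
    rw [e]
    exact hp n
  · push_cast
    module

theorem isSelfAdjoint_dGamma {T : H →ₗ.[ℂ] H} (hT : IsSelfAdjoint T) (hT0 : IsNonneg T) :
    IsSelfAdjoint (dGamma T) := by
  refine isSelfAdjoint_of_surjective ?_ (symmGraph_dGamma hT hT0) ((-1 : ℝ) : ℂ)
    (exists_dGamma_add hT hT0) ?_
  · rw [Submodule.dense_iff_topologicalClosure_eq_top, Submodule.topologicalClosure_eq_top_iff,
      Submodule.eq_bot_iff]
    intro y hy
    obtain ⟨p, hp, rfl⟩ := exists_dGamma_add hT hT0 y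
    have h1 : inner ℂ p.1 (p.2 - ((-1 : ℝ) : ℂ) • p.1) = 0 :=
      (Submodule.mem_orthogonal _ _).1 hy _ (LinearPMap.mem_domain_of_mem_graph (y := p.2) hp)
    have h2 := (isNonneg_dGamma hT hT0).re_inner_nonneg hp
    have h3 : (inner ℂ p.1 p.2).re + ‖p.1‖ ^ 2 = 0 := by
      have := congrArg Complex.re h1
      rw [inner_sub_right, inner_smul_right, inner_self_eq_norm_sq_to_K] at this
      simpa [← Complex.ofReal_pow] using this
    have h4 : p.1 = 0 := by
      rw [← norm_eq_zero]
      nlinarith [norm_nonneg p.1, sq_nonneg ‖p.1‖]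
    rw [(dGamma T).graph_fst_eq_zero_snd (x := p.1) (x' := p.2) hp h4, h4]
    simp
  · rw [Complex.conj_ofReal]
    exact exists_dGamma_add hT hT0

end SecondQuantization

/-! ### Creation, annihilation and field operators on finite particle vectors -/

section FiniteParticle

open Filter Topology

variable {H : Type*} [NormedAddCommGroup H] [InnerProductSpace ℂ H]

theorem memℓp_of_eventually_zero {f : ∀ n : ℕ, symTensor H n} {N : ℕ} (hN : ∀ n, N ≤ n → f n = 0) :
    Memℓp f 2 := by
  refine (memℓp_zero ((Set.finite_lt_nat N).subset fun n hn => ?_)).of_exponent_ge zero_le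
  by_contra h
  exact hn (hN n (not_lt.1 h))

/-- The components of `A(h)^* ψ`. -/
def creSeq (h : H) (ψ : ∀ n : ℕ, symTensor H n) : ∀ n : ℕ, symTensor H n
  | 0 => 0
  | n + 1 => creN h n (ψ n)

/-- The creation operator on finite particle vectors. -/
def creF (h : H) : finVec H →ₗ[ℂ] finVec H where
  toFun ψ :=
    have hψ : ∃ N : ℕ, ∀ n, N ≤ n → creSeq h (ψ : BosonFock H) n = 0 := by
      obtain ⟨N, hN⟩ := ψ.2
      refine ⟨N + 1, fun n hn => ?_⟩
      obtain ⟨m, rfl⟩ := Nat.exists_eq_add_of_lt hn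
      change creN h _ _ = 0
      rw [hN _ (by omega), map_zero]
    ⟨⟨creSeq h (ψ : BosonFock H), memℓp_of_eventually_zero hψ.choose_spec⟩, hψ⟩
  map_add' ψ φ := by
    refine Subtype.ext (lp.ext (funext fun n => ?_))
    cases n with
    | zero => exact (add_zero _).symm
    | succ n => exact map_add (creN h n) _ _
  map_smul' c ψ := by
    refine Subtype.ext (lp.ext (funext fun n => ?_))
    cases n with
    | zero => exact (smul_zero c).symm
    | succ n => exact map_smul (creN h n) _ _

/-- The annihilation operator on finite particle vectors. -/
def annF (h : H) : finVec H →ₗ[ℂ] finVec H where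
  toFun ψ :=
    have hψ : ∃ N : ℕ, ∀ n, N ≤ n → annN h n ((ψ : BosonFock H) (n + 1)) = 0 := by
      obtain ⟨N, hN⟩ := ψ.2
      exact ⟨N, fun n hn => by rw [hN _ (by omega), map_zero]⟩
    ⟨⟨fun n => annN h n ((ψ : BosonFock H) (n + 1)), memℓp_of_eventually_zero hψ.choose_spec⟩, hψ⟩
  map_add' ψ φ := Subtype.ext (lp.ext (funext fun n => map_add (annN h n) _ _))
  map_smul' c ψ := Subtype.ext (lp.ext (funext fun n => map_smul (annN h n) _ _))

theorem creF_apply_zero (h : H) (ψ : finVec H) : (creF h ψ : BosonFock H) 0 = 0 := rfl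

theorem creF_apply_succ (h : H) (ψ : finVec H) (n : ℕ) :
    (creF h ψ : BosonFock H) (n + 1) = creN h n ((ψ : BosonFock H) n) := rfl

theorem annF_apply (h : H) (ψ : finVec H) (n : ℕ) :
    (annF h ψ : BosonFock H) n = annN h n ((ψ : BosonFock H) (n + 1)) := rfl

theorem mem_creation_graph {h : H} {p : BosonFock H × BosonFock H} :
    p ∈ (creation h).graph ↔ p.2 0 = 0 ∧ ∀ n, p.2 (n + 1) = creN h n (p.1 n) := by
  rw [creation_graph]
  exact Iff.rfl

theorem creF_mem_graph (h : H) (ψ : finVec H) :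
    ((ψ : BosonFock H), (creF h ψ : BosonFock H)) ∈ (creation h).graph :=
  mem_creation_graph.2 ⟨rfl, fun _ => rfl⟩

theorem dense_creation_domain (h : H) : Dense ((creation h).domain : Set (BosonFock H)) :=
  dense_finVec.mono fun ψ hψ => LinearPMap.mem_domain_of_mem_graph (creF_mem_graph h ⟨ψ, hψ⟩)

theorem inner_eq_zero_add_tsum (ψ φ : BosonFock H) : inner ℂ ψ φ =
    inner ℂ (ψ 0) (φ 0) + ∑' n, inner ℂ (ψ (n + 1)) (φ (n + 1)) := by
  rw [lp.inner_eq_tsum]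
  exact Summable.tsum_eq_zero_add (f := fun n => inner ℂ (ψ n) (φ n)) (lp.summable_inner ψ φ)

theorem inner_creation {h : H} {p : BosonFock H × BosonFock H} (hp : p ∈ (creation h).graph)
    (ψ : finVec H) : inner ℂ p.2 (ψ : BosonFock H) = inner ℂ p.1 (annF h ψ : BosonFock H) := by
  obtain ⟨h0, h1⟩ := mem_creation_graph.1 hp
  rw [inner_eq_zero_add_tsum, h0, inner_zero_left, zero_add, lp.inner_eq_tsum]
  refine tsum_congr fun n => ?_
  rw [h1, annF_apply]
  exact inner_creN h _ _

theorem inner_creF (h : H) (ψ φ : finVec H) :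
    inner ℂ (creF h ψ : BosonFock H) (φ : BosonFock H) =
      inner ℂ (ψ : BosonFock H) (annF h φ : BosonFock H) :=
  inner_creation (creF_mem_graph h ψ) φ

theorem inner_annF (h : H) (ψ φ : finVec H) :
    inner ℂ (annF h ψ : BosonFock H) (φ : BosonFock H) =
      inner ℂ (ψ : BosonFock H) (creF h φ : BosonFock H) := by
  rw [← inner_conj_symm, ← inner_creF, inner_conj_symm]

theorem annF_creF (h k : H) (ψ : finVec H) :
    annF h (creF k ψ) = creF k (annF h ψ) + inner ℂ h k • ψ := by
  refine Subtype.ext (lp.ext (funext fun n => ?_))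
  rw [Submodule.coe_add, lp.coeFn_add, Pi.add_apply, Submodule.coe_smul, lp.coeFn_smul,
    Pi.smul_apply, annF_apply, creF_apply_succ]
  cases n with
  | zero =>
    rw [creF_apply_zero, annN_creN_zero]
    exact (zero_add _).symm
  | succ n => rw [creF_apply_succ, annF_apply, annN_creN_succ]

theorem creF_comm (h k : H) (ψ : finVec H) : creF h (creF k ψ) = creF k (creF h ψ) := by
  refine Subtype.ext (lp.ext (funext fun n => ?_))
  match n with
  | 0 => rw [creF_apply_zero, creF_apply_zero]
  | 1 => rw [creF_apply_succ, creF_apply_succ, creF_apply_zero, creF_apply_zero, map_zero, map_zero]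
  | n + 2 =>
    rw [creF_apply_succ, creF_apply_succ, creF_apply_succ, creF_apply_succ, creN_comm]

theorem annF_mem_graph (h : H) (ψ : finVec H) :
    ((ψ : BosonFock H), (annF h ψ : BosonFock H)) ∈ (annihilation h).graph := by
  rw [annihilation, LinearPMap.adjoint_graph_eq_graph_adjoint (dense_creation_domain h),
    Submodule.mem_adjoint_iff]
  exact fun a b hab => sub_eq_zero.2 (inner_creation hab ψ)

/-- The field operator on finite particle vectors. -/
def fieldF (h : H) : finVec H →ₗ[ℂ] finVec H := ((1 / √2 : ℝ) : ℂ) • (annF h + creF h)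

theorem fieldF_apply (h : H) (ψ : finVec H) :
    (fieldF h ψ : BosonFock H) = ((1 / √2 : ℝ) : ℂ) •
      ((annF h ψ : BosonFock H) + (creF h ψ : BosonFock H)) := rfl

theorem fieldF_mem_graph_of_sum (h : H) (ψ : finVec H) :
    ((ψ : BosonFock H), (fieldF h ψ : BosonFock H)) ∈
      (((1 / √2 : ℝ) : ℂ) • (annihilation h + creation h)).graph :=
  mem_smul_graph.2 ⟨_, mem_add_graph.2 ⟨_, _, annF_mem_graph h ψ, creF_mem_graph h ψ, rfl⟩, rfl⟩

theorem dense_field_domain (h : H) : Dense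
    ((((1 / √2 : ℝ) : ℂ) • (annihilation h + creation h)).domain : Set (BosonFock H)) :=
  dense_finVec.mono fun ψ hψ => LinearPMap.mem_domain_of_mem_graph (fieldF_mem_graph_of_sum h ⟨ψ, hψ⟩)

theorem symmGraph_field (h : H) :
    SymmGraph (((1 / √2 : ℝ) : ℂ) • (annihilation h + creation h)).graph := by
  have hadj : ∀ x y x' z' : BosonFock H, (x, y) ∈ (annihilation h).graph →
      (x', z') ∈ (creation h).graph → inner ℂ z' x = inner ℂ x' y := by
    intro x y x' z' hy hz
    rw [annihilation, LinearPMap.adjoint_graph_eq_graph_adjoint (dense_creation_domain h),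
      Submodule.mem_adjoint_iff] at hy
    exact sub_eq_zero.1 (hy x' z' hz)
  rintro ⟨x, w⟩ hp ⟨x', w'⟩ hq
  obtain ⟨v, hv, rfl⟩ := mem_smul_graph.1 hp
  obtain ⟨v', hv', rfl⟩ := mem_smul_graph.1 hq
  obtain ⟨y, z, hy, hz, rfl⟩ := mem_add_graph.1 hv
  obtain ⟨y', z', hy', hz', rfl⟩ := mem_add_graph.1 hv'
  have h1 := hadj _ _ _ _ hy' hz
  have h2 : inner ℂ y x' = inner ℂ x z' := by
    rw [← inner_conj_symm, ← hadj _ _ _ _ hy hz', inner_conj_symm]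
  simp only [inner_smul_left, inner_smul_right, Complex.conj_ofReal, inner_add_left,
    inner_add_right, h1, h2]
  ring

theorem segal_graph (h : H) : (segal h).graph =
    (((1 / √2 : ℝ) : ℂ) • (annihilation h + creation h)).graph.topologicalClosure :=
  (symmGraph_field h).closure_graph (dense_field_domain h)

theorem symmGraph_segal (h : H) : SymmGraph (segal h).graph := by
  rw [segal_graph]
  exact (symmGraph_field h).topologicalClosure

theorem isClosed_segal (h : H) : (segal h).IsClosed :=
  ((symmGraph_field h).isClosable (dense_field_domain h)).closure_isClosed

theorem fieldF_mem_graph (h : H) (ψ : finVec H) :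
    ((ψ : BosonFock H), (fieldF h ψ : BosonFock H)) ∈ (segal h).graph := by
  rw [segal_graph]
  exact Submodule.le_topologicalClosure _ (fieldF_mem_graph_of_sum h ψ)

theorem eq_fieldF {h : H} (ψ : finVec H) {u : BosonFock H}
    (hu : ((ψ : BosonFock H), u) ∈ (segal h).graph) : u = fieldF h ψ :=
  (segal h).mem_graph_snd_inj hu (fieldF_mem_graph h ψ) rfl

theorem inner_fieldF (h : H) (ψ φ : finVec H) :
    inner ℂ (fieldF h ψ : BosonFock H) (φ : BosonFock H) =
      inner ℂ (ψ : BosonFock H) (fieldF h φ : BosonFock H) := by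
  have := symmGraph_segal h _ (fieldF_mem_graph h ψ) _ (fieldF_mem_graph h φ)
  exact this

/-- The commutator `[dΓ(T), Φ(h)]`, where `k = T h`. -/
def commF (k : H) : finVec H →ₗ[ℂ] finVec H := ((1 / √2 : ℝ) : ℂ) • (creF k - annF k)

theorem commF_apply (k : H) (ψ : finVec H) :
    (commF k ψ : BosonFock H) = ((1 / √2 : ℝ) : ℂ) •
      ((creF k ψ : BosonFock H) - (annF k ψ : BosonFock H)) := rfl

theorem one_div_sqrt_two_sq : (1 / √2 : ℝ) ^ 2 = 1 / 2 := by
  rw [div_pow, Real.sq_sqrt zero_le_two, one_pow]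

theorem norm_creF_sq (h : H) (ψ : finVec H) : ‖(creF h ψ : BosonFock H)‖ ^ 2 =
    ‖(annF h ψ : BosonFock H)‖ ^ 2 + ‖h‖ ^ 2 * ‖(ψ : BosonFock H)‖ ^ 2 := by
  have h1 : inner ℂ (creF h ψ : BosonFock H) (creF h ψ : BosonFock H) =
      inner ℂ (annF h ψ : BosonFock H) (annF h ψ : BosonFock H) +
        inner ℂ h h * inner ℂ (ψ : BosonFock H) (ψ : BosonFock H) := by
    rw [inner_creF, annF_creF, Submodule.coe_add, inner_add_right, Submodule.coe_smul,
      inner_smul_right, ← inner_annF]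
  simp only [inner_self_eq_norm_sq_to_K] at h1
  exact_mod_cast h1

theorem norm_fieldF_sq_le (h : H) (ψ : finVec H) : ‖(fieldF h ψ : BosonFock H)‖ ^ 2 ≤
    2 * ‖(annF h ψ : BosonFock H)‖ ^ 2 + ‖h‖ ^ 2 * ‖(ψ : BosonFock H)‖ ^ 2 := by
  have h1 := norm_creF_sq h ψ
  have h2 := parallelogram_law_with_norm ℂ (annF h ψ : BosonFock H) (creF h ψ : BosonFock H)
  rw [fieldF_apply, norm_smul, Complex.norm_real, Real.norm_eq_abs, mul_pow, sq_abs,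
    one_div_sqrt_two_sq]
  nlinarith [mul_self_nonneg ‖(annF h ψ : BosonFock H) - (creF h ψ : BosonFock H)‖]

theorem norm_commF_sq_le (h : H) (ψ : finVec H) : ‖(commF h ψ : BosonFock H)‖ ^ 2 ≤
    2 * ‖(annF h ψ : BosonFock H)‖ ^ 2 + ‖h‖ ^ 2 * ‖(ψ : BosonFock H)‖ ^ 2 := by
  have h1 := norm_creF_sq h ψ
  have h2 := parallelogram_law_with_norm ℂ (creF h ψ : BosonFock H) (annF h ψ : BosonFock H)
  rw [commF_apply, norm_smul, Complex.norm_real, Real.norm_eq_abs, mul_pow, sq_abs,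
    one_div_sqrt_two_sq]
  nlinarith [mul_self_nonneg ‖(creF h ψ : BosonFock H) + (annF h ψ : BosonFock H)‖]

theorem re_inner_fieldF_commF (g k : H) (ψ : finVec H) :
    (inner ℂ (fieldF g ψ : BosonFock H) (commF k ψ : BosonFock H)).re =
      (inner ℂ g k).re / 2 * ‖(ψ : BosonFock H)‖ ^ 2 := by
  have h1 : inner ℂ (creF g ψ : BosonFock H) (creF k ψ : BosonFock H) =
      starRingEnd ℂ (inner ℂ (annF g ψ : BosonFock H) (annF k ψ : BosonFock H)) +
        inner ℂ g k * ((‖(ψ : BosonFock H)‖ ^ 2 : ℝ) : ℂ) := by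
    rw [inner_creF, annF_creF, Submodule.coe_add, inner_add_right, Submodule.coe_smul,
      inner_smul_right, ← inner_annF, inner_conj_symm, inner_self_eq_norm_sq_to_K]
    simp
  have h2 : inner ℂ (creF g ψ : BosonFock H) (annF k ψ : BosonFock H) =
      starRingEnd ℂ (inner ℂ (annF g ψ : BosonFock H) (creF k ψ : BosonFock H)) := by
    rw [inner_annF, ← inner_creF, inner_conj_symm, creF_comm]
  rw [fieldF_apply, commF_apply, inner_smul_left, inner_smul_right, inner_add_left, inner_sub_right,
    inner_sub_right, h1, h2, Complex.conj_ofReal, ← mul_assoc, ← Complex.ofReal_mul,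
    Complex.re_ofReal_mul, ← sq, one_div_sqrt_two_sq]
  simp only [Complex.add_re, Complex.sub_re, Complex.conj_re, Complex.re_mul_ofReal]
  ring

end FiniteParticle

/-! ### Commutators of the field operators with the second quantization operator -/

section Commutators

open Filter Topology

variable {H : Type*} [NormedAddCommGroup H] [InnerProductSpace ℂ H]

theorem continuous_inner_creF (φ : BosonFock H) (ψ : finVec H) :
    Continuous fun h : H => inner ℂ φ (creF h ψ : BosonFock H) := by
  obtain ⟨N, hN⟩ := ψ.2
  have e : ∀ h : H, inner ℂ φ (creF h ψ : BosonFock H) =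
      ∑ n ∈ Finset.range N, inner ℂ (φ (n + 1)) (creN h n ((ψ : BosonFock H) n)) := by
    intro h
    rw [inner_eq_zero_add_tsum, creF_apply_zero, inner_zero_right, zero_add]
    refine tsum_eq_sum fun n hn => ?_
    rw [creF_apply_succ, hN n (by simpa using hn), map_zero]
    exact inner_zero_right _
  simp only [e]
  refine continuous_finsetSum _ fun n _ => ?_
  exact continuous_const.inner (continuous_creN _)

theorem inner_fieldF_eq (h : H) (φ ψ : finVec H) :
    inner ℂ (φ : BosonFock H) (fieldF h ψ : BosonFock H) = ((1 / √2 : ℝ) : ℂ) *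
      (starRingEnd ℂ (inner ℂ (ψ : BosonFock H) (creF h φ : BosonFock H)) +
        inner ℂ (φ : BosonFock H) (creF h ψ : BosonFock H)) := by
  rw [fieldF_apply, inner_smul_right, inner_add_right, ← inner_creF, inner_conj_symm]

theorem continuous_inner_fieldF (φ ψ : finVec H) :
    Continuous fun h : H => inner ℂ (φ : BosonFock H) (fieldF h ψ : BosonFock H) := by
  simp only [inner_fieldF_eq]
  exact continuous_const.mul ((Complex.continuous_conj.comp (continuous_inner_creF _ _)).add
    (continuous_inner_creF _ _))

variable [CompleteSpace H] {T : H →ₗ.[ℂ] H}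

theorem creF_mem_dGamma_graph (hT : IsSelfAdjoint T) {h k : H} (hk : (h, k) ∈ T.graph)
    {ψ φ : finVec H} (hψ : ((ψ : BosonFock H), (φ : BosonFock H)) ∈ (dGamma T).graph) :
    ((creF h ψ : BosonFock H), ((creF h φ + creF k ψ : finVec H) : BosonFock H)) ∈
      (dGamma T).graph := by
  refine mem_dGamma_graph.2 fun n => ?_
  cases n with
  | zero =>
    have e : ((creF h φ + creF k ψ : finVec H) : BosonFock H) 0 = 0 := add_zero _
    simp only [e, creF_apply_zero]
    exact Submodule.zero_mem _
  | succ n =>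
    have := creN_mem_graph hT.dense_domain hT.symmGraph hk (mem_dGamma_graph.1 hψ n)
    exact this

theorem annF_mem_dGamma_graph (hT : IsSelfAdjoint T) (hT0 : IsNonneg T) {h k : H}
    (hk : (h, k) ∈ T.graph) {ψ φ : finVec H}
    (hψ : ((ψ : BosonFock H), (φ : BosonFock H)) ∈ (dGamma T).graph) :
    ((annF h ψ : BosonFock H), ((annF h φ - annF k ψ : finVec H) : BosonFock H)) ∈
      (dGamma T).graph := by
  refine mem_dGamma_graph.2 fun n => ?_
  have := annN_mem_graph hT hT0 hk (mem_dGamma_graph.1 hψ (n + 1))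
  exact this

theorem fieldF_mem_dGamma_graph (hT : IsSelfAdjoint T) (hT0 : IsNonneg T) {h k : H}
    (hk : (h, k) ∈ T.graph) {ψ φ : finVec H}
    (hψ : ((ψ : BosonFock H), (φ : BosonFock H)) ∈ (dGamma T).graph) :
    ((fieldF h ψ : BosonFock H), (fieldF h φ : BosonFock H) + (commF k ψ : BosonFock H)) ∈
      (dGamma T).graph := by
  have h1 := (dGamma T).graph.smul_mem ((1 / √2 : ℝ) : ℂ)
    ((dGamma T).graph.add_mem (annF_mem_dGamma_graph hT hT0 hk hψ)
      (creF_mem_dGamma_graph hT hk hψ))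
  convert h1 using 1
  refine Prod.ext (fieldF_apply h ψ) ?_
  change (fieldF h φ : BosonFock H) + (commF k ψ : BosonFock H) = ((1 / √2 : ℝ) : ℂ) • (((annF h φ : BosonFock H) - (annF k ψ : BosonFock H)) +
    ((creF h φ : BosonFock H) + (creF k ψ : BosonFock H)))
  rw [fieldF_apply, commF_apply, ← smul_add]
  congr 1
  abel

theorem norm_annF_sq_le (hT : IsSelfAdjoint T) (hT0 : IsNonneg T) {S : H →ₗ.[ℂ] H}
    (hS : IsSqrt S T) {u h : H} (hu : (u, h) ∈ S.graph) {ψ : finVec H} {φ : BosonFock H}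
    (hψ : ((ψ : BosonFock H), φ) ∈ (dGamma T).graph) :
    ‖(annF h ψ : BosonFock H)‖ ^ 2 ≤ ‖u‖ ^ 2 * (inner ℂ (ψ : BosonFock H) φ).re := by
  have hs := summable_re_inner (ψ : BosonFock H) φ
  have h0 : 0 ≤ (inner ℂ ((ψ : BosonFock H) 0) (φ 0)).re := by
    have := dGammaN_re_inner_nonneg hT hT0 hψ 0
    exact this
  have hs' : Summable fun n => (inner ℂ ((ψ : BosonFock H) (n + 1)) (φ (n + 1))).re :=
    (summable_nat_add_iff 1).2 hs
  have h1 : ∀ n, ‖(annF h ψ : BosonFock H) n‖ ^ 2 ≤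
      ‖u‖ ^ 2 * (inner ℂ ((ψ : BosonFock H) (n + 1)) (φ (n + 1))).re := by
    intro n
    have := norm_annN_sq_le hT hS hu (mem_dGamma_graph.1 hψ (n + 1))
    exact this
  calc ‖(annF h ψ : BosonFock H)‖ ^ 2 = ∑' n, ‖(annF h ψ : BosonFock H) n‖ ^ 2 := norm_sq_eq_tsum _
    _ ≤ ∑' n, ‖u‖ ^ 2 * (inner ℂ ((ψ : BosonFock H) (n + 1)) (φ (n + 1))).re :=
        (summable_norm_sq _).tsum_le_tsum h1 (hs'.mul_left _)
    _ = ‖u‖ ^ 2 * ∑' n, (inner ℂ ((ψ : BosonFock H) (n + 1)) (φ (n + 1))).re := tsum_mul_left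
    _ ≤ ‖u‖ ^ 2 * (inner ℂ (ψ : BosonFock H) φ).re := by
        refine mul_le_mul_of_nonneg_left ?_ (sq_nonneg _)
        rw [re_inner_eq_tsum, hs.tsum_eq_zero_add]
        exact le_add_of_nonneg_left h0

theorem abs_im_inner_fieldF_le_of_mem_domain (hT : IsSelfAdjoint T) (hT0 : IsNonneg T)
    {S : H →ₗ.[ℂ] H} (hS : IsSqrt S T) {h s : H} (hh : h ∈ T.domain) (hs : (h, s) ∈ S.graph)
    {ψ φ : finVec H} (hψ : ((ψ : BosonFock H), (φ : BosonFock H)) ∈ (dGamma T).graph) :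
    |(inner ℂ (φ : BosonFock H) (fieldF h ψ : BosonFock H)).im| ≤
      ‖s‖ * ((inner ℂ (ψ : BosonFock H) (φ : BosonFock H)).re + ‖(ψ : BosonFock H)‖ ^ 2) := by
  obtain ⟨k, hk⟩ := LinearPMap.mem_domain_iff.1 hh
  obtain ⟨s', hs1, hs2⟩ := hS.exists_graph hk
  obtain rfl := S.mem_graph_snd_inj hs hs1 rfl
  have hF := dGamma_re_inner_nonneg hT hT0 hψ
  simp only at hF
  have ha := norm_annF_sq_le hT hT0 hS hs2 hψ
  have h1 : inner ℂ (fieldF h φ : BosonFock H) (ψ : BosonFock H) +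
      inner ℂ (commF k ψ : BosonFock H) (ψ : BosonFock H) =
      inner ℂ (fieldF h ψ : BosonFock H) (φ : BosonFock H) := by
    have := symmGraph_dGamma hT hT0 _ (fieldF_mem_dGamma_graph hT hT0 hk hψ) _ hψ
    simpa only [inner_add_left] using this
  have h2 : ‖inner ℂ (commF k ψ : BosonFock H) (ψ : BosonFock H)‖ ≤
      2 * (‖(ψ : BosonFock H)‖ * ‖(annF k ψ : BosonFock H)‖) := by
    rw [commF_apply, inner_smul_left, inner_sub_left, inner_creF, norm_mul, Complex.conj_ofReal,
      Complex.norm_real, Real.norm_eq_abs]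
    have h3 : |(1 / √2 : ℝ)| ≤ 1 := by
      rw [← sq_le_one_iff_abs_le_one, one_div_sqrt_two_sq]
      norm_num
    have h4 := norm_sub_le (inner ℂ (ψ : BosonFock H) (annF k ψ : BosonFock H))
      (inner ℂ (annF k ψ : BosonFock H) (ψ : BosonFock H))
    have h5 := norm_inner_le_norm (𝕜 := ℂ) (ψ : BosonFock H) (annF k ψ : BosonFock H)
    have h6 := norm_inner_le_norm (𝕜 := ℂ) (annF k ψ : BosonFock H) (ψ : BosonFock H)
    refine (mul_le_of_le_one_left (norm_nonneg _) h3).trans ?_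
    linarith
  have h3 : |(inner ℂ (φ : BosonFock H) (fieldF h ψ : BosonFock H)).im| ≤
      ‖(ψ : BosonFock H)‖ * ‖(annF k ψ : BosonFock H)‖ := by
    rw [inner_fieldF, ← inner_conj_symm (fieldF h ψ : BosonFock H)] at h1
    have h4 := congrArg Complex.im h1
    simp only [Complex.add_im, Complex.conj_im] at h4
    have h5 := (Complex.abs_im_le_norm _).trans h2
    rw [abs_le] at h5 ⊢
    constructor <;> linarith
  refine h3.trans (abs_le_of_sq_le_sq' ?_ (by positivity)).2
  rw [mul_pow, mul_pow]
  have h4 := mul_le_mul_of_nonneg_left ha (sq_nonneg ‖(ψ : BosonFock H)‖)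
  refine h4.trans ?_
  have h5 : ‖(ψ : BosonFock H)‖ ^ 2 * (inner ℂ (ψ : BosonFock H) (φ : BosonFock H)).re ≤
      ((inner ℂ (ψ : BosonFock H) (φ : BosonFock H)).re + ‖(ψ : BosonFock H)‖ ^ 2) ^ 2 := by
    nlinarith [sq_nonneg ‖(ψ : BosonFock H)‖, mul_nonneg (sq_nonneg ‖(ψ : BosonFock H)‖) hF]
  nlinarith [mul_le_mul_of_nonneg_left h5 (sq_nonneg ‖s‖)]

theorem abs_im_inner_fieldF_le (hT : IsSelfAdjoint T) (hT0 : IsNonneg T)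
    {S : H →ₗ.[ℂ] H} (hS : IsSqrt S T) {h s : H} (hs : (h, s) ∈ S.graph)
    {ψ φ : finVec H} (hψ : ((ψ : BosonFock H), (φ : BosonFock H)) ∈ (dGamma T).graph) :
    |(inner ℂ (φ : BosonFock H) (fieldF h ψ : BosonFock H)).im| ≤
      ‖s‖ * ((inner ℂ (ψ : BosonFock H) (φ : BosonFock H)).re + ‖(ψ : BosonFock H)‖ ^ 2) := by
  set c := (inner ℂ (ψ : BosonFock H) (φ : BosonFock H)).re + ‖(ψ : BosonFock H)‖ ^ 2 with hc
  have h1 : Continuous fun q : H × H =>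
      |(inner ℂ (φ : BosonFock H) (fieldF q.1 ψ : BosonFock H)).im| :=
    (Complex.continuous_im.comp ((continuous_inner_fieldF φ ψ).comp continuous_fst)).abs
  have h2 : Continuous fun q : H × H => ‖q.2‖ * c := continuous_snd.norm.mul continuous_const
  have h3 : {q : H × H | q ∈ S.graph ∧ q.1 ∈ T.domain} ⊆
      {q : H × H | |(inner ℂ (φ : BosonFock H) (fieldF q.1 ψ : BosonFock H)).im| ≤ ‖q.2‖ * c} := by
    rintro ⟨h, s⟩ ⟨hq1, hq2⟩
    have := abs_im_inner_fieldF_le_of_mem_domain hT hT0 hS hq2 hq1 hψ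
    exact this
  have h4 := closure_minimal h3 (isClosed_le h1 h2) (hS.graphCore (graphCore_domain T) _ hs)
  exact h4

theorem fieldBounds (hT : IsSelfAdjoint T) (hT0 : IsNonneg T) {S : H →ₗ.[ℂ] H} (hS : IsSqrt S T)
    {f g u u' k s : H} (hu : (u, g) ∈ S.graph) (hu' : (u', f) ∈ S.graph) (hk : (g, k) ∈ T.graph)
    (hs : (g, s) ∈ S.graph) :
    FieldBounds (dGamma T) (segal g) (segal f) (finVec H ⊓ (dGamma T).domain) ‖u‖ (‖g‖ ^ 2)
      (inner ℂ g k).re ‖u'‖ (‖f‖ ^ 2) (‖s‖ ^ 2 + ‖k‖ ^ 2 + ‖u‖ ^ 2 + ‖g‖ ^ 2) := by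
  have hbound : ∀ {h v : H} {x y w : BosonFock H}, (v, h) ∈ S.graph →
      x ∈ finVec H ⊓ (dGamma T).domain → (x, y) ∈ (dGamma T).graph → (x, w) ∈ (segal h).graph →
      ‖w‖ ^ 2 ≤ 2 * ‖v‖ ^ 2 * (inner ℂ x y).re + ‖h‖ ^ 2 * ‖x‖ ^ 2 := by
    intro h v x y w hv hx hy hw
    lift x to finVec H using hx.1
    obtain rfl := eq_fieldF x hw
    have h1 := norm_annF_sq_le hT hT0 hS hv hy
    have h2 := norm_fieldF_sq_le h x
    linarith
  refine ⟨isSelfAdjoint_dGamma hT hT0, isNonneg_dGamma hT hT0, graphCore_dGamma T, inf_le_right,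
    isClosed_segal g, isClosed_segal f, symmGraph_segal g, symmGraph_segal f, by positivity,
    hT0.re_inner_nonneg hk, by positivity, by positivity, ?_, ?_,
    fun x y w hx hy hw => hbound hu hx hy hw, fun x y w hx hy hw => hbound hu' hx hy hw, ?_, ?_⟩
  · intro x hx
    obtain ⟨y, hy⟩ := LinearPMap.mem_domain_iff.1 hx.2
    lift x to finVec H using hx.1
    lift y to finVec H using mem_finVec_of_mem_graph hy x.2
    exact ⟨fieldF g x, ⟨(fieldF g x).2, LinearPMap.mem_domain_of_mem_graph
      (fieldF_mem_dGamma_graph hT hT0 hk hy)⟩, fieldF_mem_graph g x⟩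
  · intro x hx
    exact LinearPMap.mem_domain_of_mem_graph (fieldF_mem_graph f ⟨x, hx.1⟩)
  · intro x y w v z hx hy hw hv hz
    lift x to finVec H using hx.1
    lift y to finVec H using mem_finVec_of_mem_graph hy x.2
    obtain rfl := eq_fieldF x hw
    obtain rfl := eq_fieldF _ hv
    obtain rfl := (dGamma T).mem_graph_snd_inj hz (fieldF_mem_dGamma_graph hT hT0 hk hy) rfl
    rw [inner_add_right, Complex.add_re, re_inner_fieldF_commF, ← inner_fieldF]
  · intro x y w v hx hy hw hv
    lift x to finVec H using hx.1
    lift y to finVec H using mem_finVec_of_mem_graph hy x.2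
    have hw' := hbound hu hx hy hw
    obtain rfl := eq_fieldF x hw
    obtain rfl := eq_fieldF _ hv
    have hm := fieldF_mem_dGamma_graph hT hT0 hk hy
    have him := (symmGraph_dGamma hT hT0).im_inner hm
    obtain ⟨s', hs1, hs2⟩ := hS.exists_graph hk
    obtain rfl := S.mem_graph_snd_inj hs hs1 rfl
    have h1 := norm_annF_sq_le hT hT0 hS hs2 hy
    have h2 := norm_commF_sq_le k x
    have hF := dGamma_re_inner_nonneg hT hT0 hy
    simp only [inner_add_right, Complex.add_im] at him hF
    have h3 : (inner ℂ (y : BosonFock H) (fieldF g (fieldF g x) : BosonFock H)).im =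
        (inner ℂ (fieldF g x : BosonFock H) (commF k x : BosonFock H)).im := by
      rw [← inner_fieldF, ← inner_conj_symm, Complex.conj_im]
      linarith
    have h4 := (Complex.abs_im_le_norm _).trans
      (norm_inner_le_norm (𝕜 := ℂ) (fieldF g x : BosonFock H) (commF k x : BosonFock H))
    rw [h3]
    nlinarith [sq_nonneg (‖(fieldF g x : BosonFock H)‖ - ‖(commF k x : BosonFock H)‖),
      sq_nonneg ‖(x : BosonFock H)‖, mul_nonneg (sq_nonneg ‖k‖) hF, mul_nonneg (sq_nonneg ‖g‖) hF,
      mul_nonneg (sq_nonneg ‖u‖) (sq_nonneg ‖(x : BosonFock H)‖),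
      mul_nonneg (sq_nonneg ‖s‖) (sq_nonneg ‖(x : BosonFock H)‖),
      mul_nonneg (sq_nonneg ‖k‖) (sq_nonneg ‖(x : BosonFock H)‖),
      mul_nonneg (sq_nonneg ‖g‖) (sq_nonneg ‖(x : BosonFock H)‖)]

end Commutators

section InverseSquareRoot

variable {H : Type*} [NormedAddCommGroup H] [InnerProductSpace ℂ H] [CompleteSpace H]
  {T : H →ₗ.[ℂ] H}

theorem ker_opSqrt_eq_bot (hT : IsSelfAdjoint T) (hT0 : IsNonneg T)
    (hinj : Function.Injective T.toFun) : (opSqrt T).toFun.ker = ⊥ := by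
  rw [LinearMap.ker_eq_bot']
  intro x hx
  have h1 : ((x : H), (0 : H)) ∈ (opSqrt T).graph := by
    have := (opSqrt T).mem_graph x
    rwa [show (opSqrt T) x = 0 from hx] at this
  have h2 : ((x : H), (0 : H)) ∈ T.graph := by
    have := mem_opMul_graph.2 ⟨0, h1, (opSqrt T).graph.zero_mem⟩
    rwa [(isSqrt_opSqrt hT hT0).2.2] at this
  obtain ⟨y, hy1, hy2⟩ := (LinearPMap.mem_graph_iff _).1 h2
  have h3 : y = 0 := hinj (hy2.trans (map_zero T.toFun).symm)
  refine Subtype.ext (hy1.symm.trans ?_)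
  rw [h3]
  rfl

theorem mem_graph_opInvSqrt (h : (opSqrt T).toFun.ker = ⊥) {g : H}
    (hg : g ∈ (opInvSqrt T).domain) : (opInvSqrt T ⟨g, hg⟩, g) ∈ (opSqrt T).graph := by
  have h1 : (g, opInvSqrt T ⟨g, hg⟩) ∈ (opSqrt T).inverse.graph := (opInvSqrt T).mem_graph ⟨g, hg⟩
  rw [LinearPMap.inverse_graph h] at h1
  obtain ⟨⟨x, y⟩, hp, he⟩ := h1
  obtain ⟨h2, h3⟩ := Prod.mk.inj he
  rw [← h3]
  exact h2 ▸ hp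

end InverseSquareRoot

end FockModel

end

open FockModel

theorem theorem2p3 {H : Type*} [NormedAddCommGroup H] [InnerProductSpace ℂ H] [CompleteSpace H]
    (T : H →ₗ.[ℂ] H) (hT : IsSelfAdjoint T) (hT0 : IsNonneg T)
    (hTinj : Function.Injective T.toFun)
    (f g : H) (hf : f ∈ (opInvSqrt T).domain)
    (hg : g ∈ (opInvSqrt T).domain) (hg' : g ∈ T.domain) (hg0 : g ≠ 0) :
    (∀ lam : ℝ, |lam| < lambdaT T g hg hg' → ∀ eta : ℝ,
      IsSelfAdjoint (hamEta T f g eta lam) ∧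
      (hamEta T f g eta lam).domain = (dGamma T).domain ∧
      (∀ D : Submodule ℂ (BosonFock H), (dGamma T).HasCore D →
        IsEssentiallySelfAdjointOn (hamEta T f g eta lam) D) ∧
      IsBoundedBelow (hamEta T f g eta lam)) ∧
    (∀ lam : ℝ, lambdaT T g hg hg' ≤ |lam| → f ∈ (opSqrt T).domain → ∀ eta : ℝ,
      (∀ D : Submodule ℂ (BosonFock H), (dGamma T).HasCore D →
        IsEssentiallySelfAdjointOn (hamEta T f g eta lam) D) ∧
      (lambdaT T g hg hg' ≤ lam → IsSelfAdjoint (hamEta T f g eta lam))) ∧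
    (f ∈ (opSqrt T).domain →
      IsBoundedBelow (ham T g (lambdaC0 T g hg)).closure ∧
      ∀ lam : ℝ, lambdaC0 T g hg < lam → ∀ eta : ℝ,
        IsBoundedBelow (hamEta T f g eta lam).closure ∧
        ∀ M : ℝ, 0 ≤ M → IsNonneg (addConst (hamEta T f g eta lam).closure M) →
          (opSqrt (dGamma T)).domain =
            (opSqrt (addConst (hamEta T f g eta lam).closure M)).domain) := by
  have hS := isSqrt_opSqrt hT hT0
  have hker := ker_opSqrt_eq_bot hT hT0 hTinj
  have hu := mem_graph_opInvSqrt hker hg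
  have hu' := mem_graph_opInvSqrt hker hf
  have hk := T.mem_graph ⟨g, hg'⟩
  have hs := (opSqrt T).mem_graph ⟨g, domain_le_domain_opSqrt T hg'⟩
  have h := fieldBounds hT hT0 hS hu hu' hk hs
  have hpos : 0 < ‖opInvSqrt T ⟨g, hg⟩‖ := by
    refine norm_pos_iff.2 fun h0 => hg0 ?_
    exact (opSqrt T).graph_fst_eq_zero_snd hu h0
  set a := ‖opInvSqrt T ⟨g, hg⟩‖ with ha
  set b := ‖opSqrt T ⟨g, domain_le_domain_opSqrt T hg'⟩‖ with hb
  have hb0 : 0 ≤ b := norm_nonneg _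
  have hlam : lambdaT T g hg hg' = a⁻¹ * (a + b)⁻¹ := rfl
  have hlam0 : 0 < lambdaT T g hg hg' := by
    rw [hlam]
    positivity
  have hlam1 : lambdaT T g hg hg' * a ^ 2 ≤ 1 := by
    rw [hlam, show a⁻¹ * (a + b)⁻¹ * a ^ 2 = a / (a + b) by field_simp]
    exact (div_le_one (by positivity)).2 (by linarith)
  have hcrit : lambdaC0 T g hg * a ^ 2 = -1 := by
    change -(a ^ 2)⁻¹ * a ^ 2 = -1
    field_simp
  have hcl : f ∈ (opSqrt T).domain → ∀ eta lam : ℝ,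
      IsSelfAdjoint (FieldBounds.total (dGamma T) (segal g) (segal f) eta lam).closure := by
    intro hf' eta lam
    refine h.closure_isSelfAdjoint (C' := ‖opSqrt T ⟨f, hf'⟩‖) (norm_nonneg _) ?_ eta lam
    intro x y t hx hy ht
    lift x to finVec H using hx.1
    lift y to finVec H using mem_finVec_of_mem_graph hy x.2
    obtain rfl := eq_fieldF x ht
    exact abs_im_inner_fieldF_le hT hT0 hS ((opSqrt T).mem_graph ⟨f, hf'⟩) hy
  refine ⟨fun lam hl eta => ?_, fun lam hl hf' eta => ?_, fun hf' => ⟨?_, fun lam hl eta => ?_⟩⟩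
  · have hl1 : |lam| * a ^ 2 < 1 :=
      (mul_lt_mul_of_pos_right hl (by positivity)).trans_le hlam1
    have hl2 : -1 < lam * a ^ 2 := by
      nlinarith [mul_le_mul_of_nonneg_right (neg_abs_le lam) (sq_nonneg a)]
    exact ⟨h.isSelfAdjoint_of_small eta hl1, h.total_domain eta lam,
      fun D hD => h.essentiallySelfAdjointOn (h.closure_isSelfAdjoint_of_small eta hl1) hD,
      h.isBoundedBelow eta hl2⟩
  · exact ⟨fun D hD => h.essentiallySelfAdjointOn (hcl hf' eta lam) hD,
      fun hl' => h.isSelfAdjoint_of_nonneg (hlam0.le.trans hl') (hcl hf' eta lam)⟩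
  · refine IsBoundedBelow.closure (h.isBoundedBelow_critical ?_ hcrit.ge)
    change -(a ^ 2)⁻¹ ≤ 0
    exact neg_nonpos.2 (by positivity)
  · have hl1 : -1 < lam * a ^ 2 := by
      rw [← hcrit]
      exact mul_lt_mul_of_pos_right hl (by positivity)
    exact ⟨(h.isBoundedBelow eta hl1).closure,
      fun M hM hM' => h.opSqrt_domain_eq hl1 (hcl hf' eta lam) hM hM'⟩
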